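/- Let $\mathfrak g=\mathfrak g_{-1}\oplus\mathfrak g_0\oplus\mathfrak g_1$ be a $|1|$-graded real semisimple Lie algebra such that no simple ideal of $\mathfrak g$ is contained in $\mathfrak g_0$. Put $\mathfrak p=\mathfrak g_0\oplus\mathfrak g_1$. Let $G$ be a Lie group with Lie algebra $\mathfrak g$, let $P\subset G$ be a Lie subgroup with Lie algebra $\mathfrak p$ whose adjoint action preserves the filtration $\mathfrak g\supset\mathfrak p\supset\mathfrak g_1$, and let $G_0\subset P$ be the subgroup of the elements whose adjoint action preserves the grading. Let $(p:\mathcal G\to M,\omega)$ be a Cartan geometry of type $(G,P)$ (a $|1|$-graded geometry): a smooth principal $P$-bundle with a Cartan connection $\omega\in\Omega^1(\mathcal G,\mathfrak g)$. For $X\in\mathfrak g$ let $\omega^{-1}(X)$ be the vector field on $\mathcal G$ with $\omega(\omega^{-1}(X))=X$ and let $\mathrm{Fl}^{\omega^{-1}(X)}_t$ be its flow. Put $\mathcal G_0=\mathcal G/\exp\mathfrak g_1$, with projections $\pi:\mathcal G\to\mathcal G_0$ and $p_0:\mathcal G_0\to M$. A (local) Weyl structure over an open set $U\subset M$ is a smooth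 $G_0$-equivariant section $\sigma:p_0^{-1}(U)\to\mathcal G$ of $\pi$. It is normal at $u\in p^{-1}(U)$, and is then denoted by $\sigma_u$, if $\sigma(\pi(\mathrm{Fl}_1^{\omega^{-1}(X)}(u)))=\mathrm{Fl}_1^{\omega^{-1}(X)}(u)$ for all $X\in\mathfrak g_{-1}$ in some neighborhood of $0$. The Weyl connection $\nabla^\sigma$ of $\sigma$ is the affine connection on $U$ that is induced on $TM|_U\cong p_0^{-1}(U)\times_{G_0}\mathfrak g_{-1}$ by the principal connection given by the $\mathfrak g_0$-component of $\sigma^*\omega$. An automorphism $\varphi$ of the geometry, defined over an open subset of $M$, induces a map $\varphi_0$ on the corresponding part of $\mathcal G_0$ and acts on Weyl structures by $\varphi^*\sigma=\varphi^{-1}\circ\sigma\circ\varphi_0$. A symmetry with the center at $x\in M$ is a locally defined diffeomorphism $s$ of $M$ with $s(x)=x$ and $T_xs=-\mathrm{id}$ that is covered, on some neighborhood of $x$, by a locally defined automorphism of the geometry. Let $s$ be a symmetry with the center at $x$. (1) For every locally defined automorphism $\varphi$ that covers $s$ near $x$ there is exactly one normal Weyl structure $\sigma_u$ with $p(u)=x$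 such that $\varphi^*\sigma_u=\sigma_u$ over some neighborhood of $x$. More precisely, there is a Weyl structure over a neighborhood of $x$ with the following two properties: it is normal at some $u\in p^{-1}(x)$, and it is $\varphi$-invariant over a neighborhood of $x$; and any two Weyl structures over neighborhoods of $x$ with these two properties coincide over some neighborhood of $x$. (2) There is a Weyl structure $\sigma$ over a neighborhood of $x$ whose Weyl connection $\nabla^\sigma$ is $s$-invariant, that is, $s^*\nabla^\sigma=\nabla^\sigma$ over some neighborhood of $x$. -/

import Mathlib

open Set Filter Topology Manifold
open scoped Manifold ContDiff RightActions

noncomputable section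

/-! ## Lie groups -/

/-- A smooth real Lie group is regular enough for Mathlib's bracket on its Lie algebra. -/
instance instLieGroupMinSmoothness {E : Type*} [NormedAddCommGroup E] [NormedSpace ℝ E]
    {G : Type*} [TopologicalSpace G] [ChartedSpace E G] [Group G] [LieGroup 𝓘(ℝ, E) ∞ G] :
    LieGroup 𝓘(ℝ, E) (minSmoothness ℝ 3) G :=
  LieGroup.of_le (n := ∞) (by
    rw [minSmoothness_of_isRCLikeNormedField]
    exact WithTop.coe_le_coe.2 (le_top : (3 : ℕ∞) ≤ ⊤))

section LieGroups

variable {EG : Type*} [NormedAddCommGroup EG] [NormedSpace ℝ EG]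
  {G : Type*} [TopologicalSpace G] [ChartedSpace EG G] [Group G]

variable (EG G) in
/-- The Lie algebra `𝔤 = T₁G` of `G`. -/
abbrev LieAlg : Type _ := GroupLieAlgebra 𝓘(ℝ, EG) G

/-- The adjoint action `Ad_g : 𝔤 → 𝔤`, the derivative at `1` of conjugation by `g`. -/
def Ad (g : G) : LieAlg EG G →L[ℝ] LieAlg EG G :=
  mfderiv 𝓘(ℝ, EG) 𝓘(ℝ, EG) (fun h : G => g * h * g⁻¹) 1

/-- `IsExp Z g` says `g = exp Z`: the integral curve through `1` of the left invariant vector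
field generated by `Z` is at `g` at time `1`. -/
def IsExp (Z : LieAlg EG G) (g : G) : Prop :=
  ∃ γ : ℝ → G, γ 0 = 1 ∧ IsMIntegralCurve γ (mulInvariantVectorField (I := 𝓘(ℝ, EG)) Z) ∧ γ 1 = g

/-- The derivative depends on the base point only, all tangent spaces being the model space. -/
theorem mfderiv_base_congr {G : Type*} [TopologicalSpace G] [ChartedSpace EG G] (f : G → G) {a b : G} (h : a = b) (X : EG) :
    (mfderiv 𝓘(ℝ, EG) 𝓘(ℝ, EG) f a : EG →L[ℝ] EG) X
      = (mfderiv 𝓘(ℝ, EG) 𝓘(ℝ, EG) f b : EG →L[ℝ] EG) X := by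
  subst h; rfl

theorem Ad_conj_aux [LieGroup 𝓘(ℝ, EG) ∞ G] (g : G) :
    MDifferentiable 𝓘(ℝ, EG) 𝓘(ℝ, EG) (fun h : G => g * h * g⁻¹) := by
  have : ContMDiff 𝓘(ℝ, EG) 𝓘(ℝ, EG) ∞ (fun h : G => g * h * g⁻¹) :=
    (contMDiff_const.mul contMDiff_id).mul contMDiff_const
  exact this.mdifferentiable (by simp)

/-- Conjugation intertwines the exponential map with the adjoint action. -/
theorem IsExp.conj [LieGroup 𝓘(ℝ, EG) ∞ G] {Z : LieAlg EG G} {k : G} (h : IsExp Z k) (g : G) :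
    IsExp (Ad g Z) (g * k * g⁻¹) := by
  obtain ⟨γ, h0, hγ, h1⟩ := h
  refine ⟨fun t => g * γ t * g⁻¹, by simp [h0], fun t => ?_, by simp [h1]⟩
  have hc := (Ad_conj_aux (EG := EG) g (γ t)).hasMFDerivAt
  have hcomp := hc.comp t (hγ t)
  have hl : ∀ a : G, MDifferentiable 𝓘(ℝ, EG) 𝓘(ℝ, EG) (fun b : G => a * b) := fun a =>
    (contMDiff_mul_left (I := 𝓘(ℝ, EG)) (n := ∞) (a := a)).mdifferentiable (by simp)
  have key : mfderiv 𝓘(ℝ, EG) 𝓘(ℝ, EG) (fun h : G => g * h * g⁻¹) (γ t)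
      (mulInvariantVectorField (I := 𝓘(ℝ, EG)) Z (γ t))
      = mulInvariantVectorField (I := 𝓘(ℝ, EG)) (Ad g Z) (g * γ t * g⁻¹) := by
    have e : (fun h : G => g * h * g⁻¹) ∘ (fun b : G => γ t * b)
        = (fun b : G => (g * γ t * g⁻¹) * b) ∘ (fun h : G => g * h * g⁻¹) := by
      funext b; simp [mul_assoc]
    have h1 := mfderiv_comp_of_eq (x := (1 : G)) (y := γ t) (I := 𝓘(ℝ, EG)) (I' := 𝓘(ℝ, EG))
      (I'' := 𝓘(ℝ, EG)) (Ad_conj_aux (EG := EG) g (γ t)) (hl (γ t) 1) (by simp)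
    have h2 := mfderiv_comp_of_eq (x := (1 : G)) (y := (1 : G)) (I := 𝓘(ℝ, EG)) (I' := 𝓘(ℝ, EG))
      (I'' := 𝓘(ℝ, EG)) (hl (g * γ t * g⁻¹) 1) (Ad_conj_aux (EG := EG) g 1) (by simp)
    rw [e] at h1
    have h3 := h1.symm.trans h2
    have h4 := DFunLike.congr_fun h3 Z
    exact (mfderiv_base_congr _ (mul_one (γ t)).symm _).trans
      (h4.trans (mfderiv_base_congr _ (by simp) _))
  have hL : (mfderiv 𝓘(ℝ, EG) 𝓘(ℝ, EG) (fun h : G => g * h * g⁻¹) (γ t)).comp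
      ((1 : ℝ →L[ℝ] ℝ).smulRight (mulInvariantVectorField (I := 𝓘(ℝ, EG)) Z (γ t)))
      = ((1 : ℝ →L[ℝ] ℝ).smulRight
        (mulInvariantVectorField (I := 𝓘(ℝ, EG)) (Ad g Z) (g * γ t * g⁻¹))) := by
    refine ContinuousLinearMap.ext fun r => ?_
    have hr := congrArg (fun v => r • v) key
    exact (map_smul _ _ _).trans hr
  exact Eq.mp (congrArg (fun L => HasMFDerivAt 𝓘(ℝ, ℝ) 𝓘(ℝ, EG)
    (fun t => g * γ t * g⁻¹) t L) hL) hcomp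

theorem Ad_one [LieGroup 𝓘(ℝ, EG) ∞ G] (X : LieAlg EG G) : Ad (1 : G) X = X := by
  have e : (fun h : G => 1 * h * 1⁻¹) = id := by funext b; simp
  rw [Ad, e]
  exact DFunLike.congr_fun (mfderiv_id (I := 𝓘(ℝ, EG)) (x := (1 : G))) X

theorem Ad_mul [LieGroup 𝓘(ℝ, EG) ∞ G] (g k : G) (X : LieAlg EG G) :
    Ad (g * k) X = Ad g (Ad k X) := by
  have e : (fun h : G => g * k * h * (g * k)⁻¹)
      = (fun h : G => g * h * g⁻¹) ∘ (fun h : G => k * h * k⁻¹) := by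
    funext b; simp [mul_assoc]
  have h1 := mfderiv_comp_of_eq (x := (1 : G)) (y := (1 : G)) (I := 𝓘(ℝ, EG)) (I' := 𝓘(ℝ, EG))
      (I'' := 𝓘(ℝ, EG)) (Ad_conj_aux (EG := EG) g 1) (Ad_conj_aux (EG := EG) k 1) (by simp)
  rw [← e] at h1
  exact (DFunLike.congr_fun h1 X).trans (mfderiv_base_congr _ (by simp) _)

theorem Ad_injective [LieGroup 𝓘(ℝ, EG) ∞ G] (g : G) :
    Function.Injective (Ad (EG := EG) g) := fun X Y h => by
  have h' := congrArg (Ad (EG := EG) g⁻¹) h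
  rwa [← Ad_mul, ← Ad_mul, inv_mul_cancel, Ad_one, Ad_one] at h'

end LieGroups

/-! ## `|1|`-gradings and the subgroups `G₀ ⊆ P` -/

section Gradings

variable {EG : Type*} [NormedAddCommGroup EG] [NormedSpace ℝ EG] [CompleteSpace EG]
  {G : Type*} [TopologicalSpace G] [ChartedSpace EG G] [Group G] [LieGroup 𝓘(ℝ, EG) ∞ G]

/-- The graded Lie algebra `L = ⨁ i, ℒ i` is `|1|`-graded, that is `L = ℒ (-1) ⊕ ℒ 0 ⊕ ℒ 1`, and
no simple ideal of `L` is contained in `ℒ 0`. (For a `|1|`-grading the requirement that the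
negative part is generated by `ℒ (-1)` is void.) -/
structure IsOneGrading {L : Type*} [LieRing L] [LieAlgebra ℝ L] (ℒ : ℤ → Submodule ℝ L)
    [GradedLieAlgebra ℒ] : Prop where
  eq_bot : ∀ i : ℤ, 1 < |i| → ℒ i = ⊥
  no_simple_ideal : ∀ I : LieIdeal ℝ L, LieAlgebra.IsSimple ℝ I → ¬ (I : Set L) ⊆ ℒ 0

/-- The filtration `𝔤^i = ⨁_{j ≥ i} 𝔤_j` of a graded Lie algebra. -/
def filt {L : Type*} [LieRing L] [LieAlgebra ℝ L] (ℒ : ℤ → Submodule ℝ L) (i : ℤ) :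
    Submodule ℝ L :=
  ⨆ j : ℤ, ⨆ _ : i ≤ j, ℒ j

/-- The component in `ℒ i` of an element of a graded Lie algebra. -/
def grComp {L : Type*} [LieRing L] [LieAlgebra ℝ L] (ℒ : ℤ → Submodule ℝ L)
    [GradedLieAlgebra ℒ] (i : ℤ) (X : L) : L :=
  (DirectSum.decompose ℒ X i : L)

/-- `P ⊆ G` is a Lie subgroup with Lie algebra `𝔭 = 𝔤^0` whose adjoint action preserves the
filtration of `𝔤`; thus `P` lies between the group of all elements of `G` that preserve the
filtration and the identity component of that group. The smooth structure of `P` is the one for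
which the inclusion is an immersion. -/
structure IsParabolicSubgroup {EP : Type*} [NormedAddCommGroup EP] [NormedSpace ℝ EP]
    (𝔤 : ℤ → Submodule ℝ (LieAlg EG G)) (P : Subgroup G) [ChartedSpace EP P] : Prop where
  contMDiff_val : ContMDiff 𝓘(ℝ, EP) 𝓘(ℝ, EG) ∞ (Subtype.val : P → G)
  injective_mfderiv : ∀ g : P,
    Function.Injective (mfderiv 𝓘(ℝ, EP) 𝓘(ℝ, EG) (Subtype.val : P → G) g)
  lieAlgebra_eq : range (mfderiv 𝓘(ℝ, EP) 𝓘(ℝ, EG) (Subtype.val : P → G) 1)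
    = (filt 𝔤 0 : Set (LieAlg EG G))
  Ad_mem : ∀ g ∈ P, ∀ i : ℤ, ∀ X ∈ filt 𝔤 i, Ad g X ∈ filt 𝔤 i

/-- The subgroup `G₀` of all elements of `P` whose adjoint action preserves the grading of `𝔤`. -/
def levi [FiniteDimensional ℝ EG] (𝔤 : ℤ → Submodule ℝ (LieAlg EG G)) (P : Subgroup G) :
    Subgroup P where
  carrier := {g | ∀ i : ℤ, ∀ X ∈ 𝔤 i, Ad (g : G) X ∈ 𝔤 i}
  one_mem' := fun i X hX => by
    rw [Subgroup.coe_one, Ad_one]; exact hX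
  mul_mem' := fun {a b} ha hb i X hX => by
    rw [Subgroup.coe_mul, Ad_mul]; exact ha i _ (hb i X hX)
  inv_mem' := fun {a} ha i X hX => by
    have : FiniteDimensional ℝ (LieAlg EG G) := inferInstanceAs (FiniteDimensional ℝ EG)
    let f : 𝔤 i →ₗ[ℝ] 𝔤 i := (Ad (EG := EG) (a : G)).toLinearMap.restrict (ha i)
    have hf : Function.Injective f := fun x y hxy =>
      Subtype.ext (Ad_injective (a : G) (congrArg Subtype.val hxy))
    obtain ⟨Y, hY⟩ := (LinearMap.injective_iff_surjective.1 hf) ⟨X, hX⟩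
    have hY' : Ad (a : G) (Y : LieAlg EG G) = X := congrArg Subtype.val hY
    have hi : Ad ((a⁻¹ : P) : G) X = Y := by
      rw [← hY', ← Ad_mul, ← Subgroup.coe_mul, inv_mul_cancel, Subgroup.coe_one, Ad_one]
    rw [hi]
    exact Y.2

end Gradings

/-! ## Cartan geometries of type `(G, P)` -/

/-- A Cartan geometry of type `(G, P)`: a principal `P`-bundle `proj : Q → M` with the right action
of `P` on `Q`, written `u <• h`, and a Cartan connection `ω ∈ Ω¹(Q, 𝔤)`. -/
structure CartanGeometry (EG : Type*) [NormedAddCommGroup EG] [NormedSpace ℝ EG]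
    {G : Type*} [TopologicalSpace G] [ChartedSpace EG G] [Group G]
    (EP : Type*) [NormedAddCommGroup EP] [NormedSpace ℝ EP]
    (P : Subgroup G) [ChartedSpace EP P]
    (EM : Type*) [NormedAddCommGroup EM] [NormedSpace ℝ EM]
    (M : Type*) [TopologicalSpace M] [ChartedSpace EM M]
    (EQ : Type*) [NormedAddCommGroup EQ] [NormedSpace ℝ EQ]
    (Q : Type*) [TopologicalSpace Q] [ChartedSpace EQ Q] [MulAction (P)ᵐᵒᵖ Q]
    [IsManifold 𝓘(ℝ, EQ) ∞ Q] where
  /-- the bundle projection -/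
  proj : Q → M
  contMDiff_proj : ContMDiff 𝓘(ℝ, EQ) 𝓘(ℝ, EM) ∞ proj
  proj_smul : ∀ (u : Q) (h : P), proj (u <• h) = proj u
  /-- smooth `P`-equivariant local trivializations -/
  exists_trivialization : ∀ x : M, ∃ e : Bundle.Trivialization P proj, x ∈ e.baseSet ∧
    ContMDiffOn 𝓘(ℝ, EQ) (𝓘(ℝ, EM).prod 𝓘(ℝ, EP)) ∞ e e.source ∧
    ContMDiffOn (𝓘(ℝ, EM).prod 𝓘(ℝ, EP)) 𝓘(ℝ, EQ) ∞ e.toOpenPartialHomeomorph.symm e.target ∧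
    ∀ u ∈ e.source, ∀ h : P, (e (u <• h)).2 = (e u).2 * h
  /-- the Cartan connection -/
  form : ∀ u : Q, TangentSpace 𝓘(ℝ, EQ) u →L[ℝ] LieAlg EG G
  contMDiff_form : ContMDiff (M' := EG) 𝓘(ℝ, EQ).tangent 𝓘(ℝ, EG) ∞
    (fun v : TangentBundle 𝓘(ℝ, EQ) Q => form v.proj v.snd)
  /-- `(r^h)^* ω = Ad_{h⁻¹} ∘ ω` -/
  form_smul : ∀ (h : P) (u : Q) (v : TangentSpace 𝓘(ℝ, EQ) u),
    form (u <• h) (mfderiv 𝓘(ℝ, EQ) 𝓘(ℝ, EQ) (fun u' : Q => u' <• h) u v)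
      = Ad ((h⁻¹ : P) : G) (form u v)
  /-- `ω(ζ_X(u)) = X`, where `ζ_X(u)` is the derivative at `1` of the orbit map of `u` in the
  direction `X ∈ T₁P = 𝔭`, and `𝔭 ⊆ 𝔤` through the derivative of the inclusion -/
  form_fundamental : ∀ (u : Q) (X : GroupLieAlgebra 𝓘(ℝ, EP) P),
    form u (mfderiv 𝓘(ℝ, EP) 𝓘(ℝ, EQ) (fun h : P => u <• h) 1 X)
      = mfderiv 𝓘(ℝ, EP) 𝓘(ℝ, EG) (Subtype.val : P → G) 1 X
  bijective_form : ∀ u : Q, Function.Bijective (form u)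

namespace CartanGeometry

variable {EG : Type*} [NormedAddCommGroup EG] [NormedSpace ℝ EG] [FiniteDimensional ℝ EG]
  {G : Type*} [TopologicalSpace G] [ChartedSpace EG G] [Group G] [LieGroup 𝓘(ℝ, EG) ∞ G]
  {EP : Type*} [NormedAddCommGroup EP] [NormedSpace ℝ EP]
  {P : Subgroup G} [ChartedSpace EP P]
  {EM : Type*} [NormedAddCommGroup EM] [NormedSpace ℝ EM]
  {M : Type*} [TopologicalSpace M] [ChartedSpace EM M]
  {EQ : Type*} [NormedAddCommGroup EQ] [NormedSpace ℝ EQ]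
  {Q : Type*} [TopologicalSpace Q] [ChartedSpace EQ Q] [MulAction (P)ᵐᵒᵖ Q]
  [IsManifold 𝓘(ℝ, EQ) ∞ Q]
  (B : CartanGeometry EG EP P EM M EQ Q)
  (𝔤 : ℤ → Submodule ℝ (LieAlg EG G))

/-- The constant vector field `ω⁻¹(X)` on the total space. -/
def constField (X : LieAlg EG G) (u : Q) : TangentSpace 𝓘(ℝ, EQ) u :=
  (Equiv.ofBijective _ (B.bijective_form u)).symm X

/-- The tangent vector `⟦u, X⟧ = Tp (ω⁻¹(X)(u))` at `p(u)`. -/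
def tangentVec (u : Q) (X : LieAlg EG G) : TangentSpace 𝓘(ℝ, EM) (B.proj u) :=
  mfderiv 𝓘(ℝ, EQ) 𝓘(ℝ, EM) B.proj u (B.constField X u)

/-! ### Automorphisms and symmetries -/

/-- A locally defined automorphism of the geometry: an isomorphism of `P`-bundles between the
restrictions of the bundle to two open subsets of the base, the first one being `dom`, that
preserves the Cartan connection. -/
structure LocalAut where
  toHomeo : OpenPartialHomeomorph Q Q
  dom : Set M
  isOpen_dom : IsOpen dom
  source_eq : toHomeo.source = B.proj ⁻¹' dom
  contMDiffOn : ContMDiffOn 𝓘(ℝ, EQ) 𝓘(ℝ, EQ) ∞ toHomeo toHomeo.source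
  contMDiffOn_symm : ContMDiffOn 𝓘(ℝ, EQ) 𝓘(ℝ, EQ) ∞ toHomeo.symm toHomeo.target
  map_smul : ∀ u ∈ toHomeo.source, ∀ h : P, toHomeo (u <• h) = toHomeo u <• h
  map_form : ∀ u ∈ toHomeo.source, ∀ v : TangentSpace 𝓘(ℝ, EQ) u,
    B.form (toHomeo u) (mfderiv 𝓘(ℝ, EQ) 𝓘(ℝ, EQ) toHomeo u v) = B.form u v

variable {B} in
/-- The automorphism `φ` covers the locally defined map `s` near `x`. -/
def LocalAut.Covers (φ : B.LocalAut) (s : OpenPartialHomeomorph M M) (x : M) : Prop :=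
  ∃ V : Set M, IsOpen V ∧ x ∈ V ∧ V ⊆ φ.dom ∩ s.source ∧
    ∀ u : Q, B.proj u ∈ V → B.proj (φ.toHomeo u) = s (B.proj u)

/-- `s` is a (local) symmetry with the center at `x` of a `|1|`-graded geometry (for which
`T⁻¹M = TM`): a locally defined diffeomorphism that fixes `x`, whose differential at `x` is `-id`,
and which is covered by an automorphism near `x`. -/
structure IsSymmetry (s : OpenPartialHomeomorph M M) (x : M) : Prop where
  mem_source : x ∈ s.source
  contMDiffOn : ContMDiffOn 𝓘(ℝ, EM) 𝓘(ℝ, EM) ∞ s s.source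
  contMDiffOn_symm : ContMDiffOn 𝓘(ℝ, EM) 𝓘(ℝ, EM) ∞ s.symm s.target
  map_center : s x = x
  mfderiv_center : ∀ v : TangentSpace 𝓘(ℝ, EM) x, mfderiv 𝓘(ℝ, EM) 𝓘(ℝ, EM) s x v = -v
  exists_covering : ∃ φ : B.LocalAut, φ.Covers s x

/-! ### The underlying `G₀`-bundle `Q₀ = Q / exp 𝔤₁` -/

/-- `v = u · exp Z` for some `Z ∈ 𝔤₁`: `u` and `v` lie in one orbit of the subgroup `exp 𝔤₁` of `P`. -/
def ExpRel (_ : CartanGeometry EG EP P EM M EQ Q) (𝔤 : ℤ → Submodule ℝ (LieAlg EG G))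
    (u v : Q) : Prop :=
  ∃ h : P, (∃ Z ∈ 𝔤 1, IsExp Z (h : G)) ∧ v = u <• h

/-- The total space `Q₀ = Q / exp 𝔤₁` of the underlying bundle. -/
def Q₀ : Type _ := Quot (B.ExpRel 𝔤)

/-- The projection `π : Q → Q₀`. -/
def π (u : Q) : B.Q₀ 𝔤 := Quot.mk _ u

/-- The projection `p₀ : Q₀ → M`. -/
def proj₀ : B.Q₀ 𝔤 → M :=
  Quot.lift B.proj (by rintro u v ⟨h, -, rfl⟩; exact (B.proj_smul u h).symm)

variable {𝔤}

theorem ExpRel.smul {u v : Q} (h : B.ExpRel 𝔤 u v) (g : levi 𝔤 P) :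
    B.ExpRel 𝔤 (u <• (g : P)) (v <• (g : P)) := by
  obtain ⟨k, ⟨Z, hZ, hk⟩, rfl⟩ := h
  refine ⟨(g : P)⁻¹ * k * (g : P), ⟨Ad (((g⁻¹ : levi 𝔤 P) : P) : G) Z, (g⁻¹).2 1 Z hZ, ?_⟩, ?_⟩
  · have := hk.conj (((g⁻¹ : levi 𝔤 P) : P) : G)
    simpa using this
  · simp only [← mul_smul, ← MulOpposite.op_mul]
    simp [mul_assoc]

/-- The right action of `g ∈ G₀` on `Q₀`, induced by the action of `G₀ ⊆ P` on `Q`. -/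
def act₀ (b : B.Q₀ 𝔤) (g : levi 𝔤 P) : B.Q₀ 𝔤 :=
  Quot.map (fun u : Q => u <• (g : P)) (fun _ _ h => ExpRel.smul B h g) b

variable {B}

variable (𝔤) in
open Classical in
/-- The map `φ₀ : Q₀ → Q₀` induced by `φ`, so that `φ₀ ∘ π = π ∘ φ` over the domain of `φ` (outside
of it, the value is of no relevance). -/
def LocalAut.base₀ (φ : B.LocalAut) : B.Q₀ 𝔤 → B.Q₀ 𝔤 :=
  Quot.lift (fun u => if B.proj u ∈ φ.dom then B.π 𝔤 (φ.toHomeo u) else B.π 𝔤 u) (by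
    rintro u v ⟨h, hh, rfl⟩
    have hp := B.proj_smul u h
    by_cases hu : B.proj u ∈ φ.dom
    · have hs : u ∈ φ.toHomeo.source := by rw [φ.source_eq]; exact hu
      simp only [hp, hu, if_true]
      exact Quot.sound ⟨h, hh, φ.map_smul u hs h⟩
    · simp only [hp, hu, if_false]
      exact Quot.sound ⟨h, hh, rfl⟩)

/-! ### Weyl structures -/

variable (B 𝔤) in
/-- A (local) Weyl structure over the open set `dom ⊆ M`: a smooth `G₀`-equivariant section over
`p₀⁻¹(dom)` of the projection `π : Q → Q₀`. The values outside of `p₀⁻¹(dom)` are of no relevance.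
Since `π` is a surjective submersion, smoothness of a map on `Q₀` is smoothness of its composition
with `π`. -/
structure WeylStructure where
  dom : Set M
  isOpen_dom : IsOpen dom
  toFun : B.Q₀ 𝔤 → Q
  section_eq : ∀ b : B.Q₀ 𝔤, B.proj₀ 𝔤 b ∈ dom → B.π 𝔤 (toFun b) = b
  equivariant : ∀ b : B.Q₀ 𝔤, B.proj₀ 𝔤 b ∈ dom → ∀ g : levi 𝔤 P,
    toFun (B.act₀ b g) = toFun b <• (g : P)
  smooth : ContMDiffOn 𝓘(ℝ, EQ) 𝓘(ℝ, EQ) ∞ (fun u : Q => toFun (B.π 𝔤 u)) (B.proj ⁻¹' dom)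

namespace WeylStructure

/-- `σ` and `τ` coincide over a neighborhood of `x`. -/
def EqNear (σ τ : B.WeylStructure 𝔤) (x : M) : Prop :=
  ∃ V : Set M, IsOpen V ∧ x ∈ V ∧ V ⊆ σ.dom ∩ τ.dom ∧
    ∀ b : B.Q₀ 𝔤, B.proj₀ 𝔤 b ∈ V → σ.toFun b = τ.toFun b

/-- `σ` is the normal Weyl structure `σ_u` near `p(u)`: it is defined near `p(u)` and
`σ(π(Fl₁^{ω⁻¹(X)}(u))) = Fl₁^{ω⁻¹(X)}(u)` for all `X ∈ 𝔤₋₁` near `0`, where `Fl` denotes the flow of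
a vector field. -/
def IsNormalAt (σ : B.WeylStructure 𝔤) (u : Q) : Prop :=
  B.proj u ∈ σ.dom ∧
  ∀ᶠ X : LieAlg EG G in 𝓝[(𝔤 (-1) : Set (LieAlg EG G))] 0, ∃ γ : ℝ → Q, γ 0 = u ∧
    (∃ ε > 0, IsMIntegralCurveOn γ (B.constField X) (Ioo (-ε) (1 + ε))) ∧
    B.proj (γ 1) ∈ σ.dom ∧ σ.toFun (B.π 𝔤 (γ 1)) = γ 1

/-- The pullback `φ^*σ = φ⁻¹ ∘ σ ∘ φ₀`. -/
def pullback (φ : B.LocalAut) (σ : B.WeylStructure 𝔤) (b : B.Q₀ 𝔤) : Q :=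
  φ.toHomeo.symm (σ.toFun (φ.base₀ 𝔤 b))

/-- `φ^*σ = σ` over some neighborhood of `x`. -/
def InvariantNear (σ : B.WeylStructure 𝔤) (φ : B.LocalAut) (x : M) : Prop :=
  ∃ V : Set M, IsOpen V ∧ x ∈ V ∧ V ⊆ φ.dom ∩ σ.dom ∧
    ∀ b : B.Q₀ 𝔤, B.proj₀ 𝔤 b ∈ V →
      B.proj₀ 𝔤 (φ.base₀ 𝔤 b) ∈ σ.dom ∧ σ.pullback φ b = σ.toFun b

end WeylStructure

/-! ### Weyl connections -/

variable (B 𝔤) in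
/-- The frame form `Q → 𝔤₋₁` of a vector field `η` on `M`: its value at `u` is the `X ∈ 𝔤₋₁` such that
`η(p(u)) = ⟦u, X⟧`. -/
def frameForm (η : ∀ y : M, TangentSpace 𝓘(ℝ, EM) y) (u : Q) : EG :=
  Function.invFunOn (α := LieAlg EG G) (fun X => B.tangentVec u X) (𝔤 (-1)) (η (B.proj u))

namespace WeylStructure

/-- At a point `u = σ(b)` of the image of `σ`, the vector `w = Tσ(w₀) ∈ T_u Q` is the image of a
vector `w₀ ∈ T_b Q₀` that is horizontal for the principal connection `(σ^*ω)₀` on `Q₀`. -/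
def IsHorizontal [CompleteSpace EG] [GradedLieAlgebra 𝔤] (σ : B.WeylStructure 𝔤) (u : Q)
    (w : TangentSpace 𝓘(ℝ, EQ) u) : Prop :=
  mfderiv 𝓘(ℝ, EQ) 𝓘(ℝ, EQ) (fun u' : Q => σ.toFun (B.π 𝔤 u')) u w = w ∧
  grComp 𝔤 0 (B.form u w) = 0

/-- `∇` is over `σ.dom` the Weyl connection `∇^σ` on `TM = Q₀ ×_{G₀} 𝔤₋₁`, induced by the principal
connection `(σ^*ω)₀`: along `ξ = Tp(w)`, with `w` a horizontal lift, the frame form of `∇_ξ η` is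
the derivative along `w` of the frame form of `η`. Here `∇ η y ξ` stands for `(∇_ξ η)(y)`. -/
def IsWeylConnection [CompleteSpace EG] [GradedLieAlgebra 𝔤] [IsManifold 𝓘(ℝ, EM) 1 M]
    (σ : B.WeylStructure 𝔤)
    (cov : (∀ y : M, TangentSpace 𝓘(ℝ, EM) y) →
      (∀ y : M, TangentSpace 𝓘(ℝ, EM) y →L[ℝ] TangentSpace 𝓘(ℝ, EM) y)) : Prop :=
  ∀ η : ∀ y : M, TangentSpace 𝓘(ℝ, EM) y, ∀ u : Q, B.proj u ∈ σ.dom →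
    σ.toFun (B.π 𝔤 u) = u →
    MDifferentiableAt 𝓘(ℝ, EM) 𝓘(ℝ, EM).tangent
      (fun y => (⟨y, η y⟩ : TangentBundle 𝓘(ℝ, EM) M)) (B.proj u) →
    ∀ w : TangentSpace 𝓘(ℝ, EQ) u, σ.IsHorizontal u w →
      cov η (B.proj u) (mfderiv 𝓘(ℝ, EQ) 𝓘(ℝ, EM) B.proj u w)
        = B.tangentVec u (mfderiv 𝓘(ℝ, EQ) 𝓘(ℝ, EG) (B.frameForm 𝔤 η) u w)

end WeylStructure

end CartanGeometry

/-! ## Affine connections -/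

section AffineConnections

variable {EM : Type*} [NormedAddCommGroup EM] [NormedSpace ℝ EM]
  {M : Type*} [TopologicalSpace M] [ChartedSpace EM M] [IsManifold 𝓘(ℝ, EM) ∞ M]

/-- `cov` is a smooth affine connection on the open set `U ⊆ M`; `cov η y ξ` is `(∇_ξ η)(y)`. -/
structure IsAffineConnectionOn
    (cov : (∀ y : M, TangentSpace 𝓘(ℝ, EM) y) →
      (∀ y : M, TangentSpace 𝓘(ℝ, EM) y →L[ℝ] TangentSpace 𝓘(ℝ, EM) y)) (U : Set M) : Prop where
  isOpen : IsOpen U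
  isCovariantDerivativeOn : IsCovariantDerivativeOn EM cov U
  contMDiff : ContMDiffCovariantDerivativeOn EM ∞ cov U

/-- The connection on `U` given by `cov` is invariant with respect to `s` near `x`, that is
`s^*∇ = ∇` over some neighborhood of `x`: `Ts(∇_ξ (s^*η)) = ∇_{Ts ξ} η`. -/
def InvariantConnectionNear
    (cov : (∀ y : M, TangentSpace 𝓘(ℝ, EM) y) →
      (∀ y : M, TangentSpace 𝓘(ℝ, EM) y →L[ℝ] TangentSpace 𝓘(ℝ, EM) y)) (U : Set M)
    (s : OpenPartialHomeomorph M M) (x : M) : Prop :=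
  ∃ V : Set M, IsOpen V ∧ x ∈ V ∧ V ⊆ U ∩ s.source ∧ ∀ y ∈ V, s y ∈ U ∧
    ∀ η : ∀ z : M, TangentSpace 𝓘(ℝ, EM) z,
      MDifferentiableAt 𝓘(ℝ, EM) 𝓘(ℝ, EM).tangent
        (fun z => (⟨z, η z⟩ : TangentBundle 𝓘(ℝ, EM) M)) (s y) →
      ∀ ξ : TangentSpace 𝓘(ℝ, EM) y,
        mfderiv 𝓘(ℝ, EM) 𝓘(ℝ, EM) s y
            (cov (VectorField.mpullback 𝓘(ℝ, EM) 𝓘(ℝ, EM) s η) y ξ)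
          = cov η (s y) (mfderiv 𝓘(ℝ, EM) 𝓘(ℝ, EM) s y ξ)

end AffineConnections

end

set_option linter.unusedSectionVars false

/-! Write `x` for the center and let `φ` cover the symmetry. Since `s` fixes `x`, `φ` acts on the
fibre over `x` by `φ(u₁) = u₁ h` with `h ∈ P`. Every `h ∈ P` splits as `g exp Z` with `g ∈ G₀` and
`Z ∈ 𝔤₁`, and `T_x s = -id` says that `Ad h` is `-id` on `𝔤/𝔭`, so `Ad g = -id` on `𝔤₋₁`. Because no
simple ideal lies in `𝔤₀`, elements of `𝔤₀` and of `𝔤₁` are determined by their brackets with `𝔤₋₁`;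
hence `Ad g` is `id` on `𝔤₀` and `-id` on `𝔤₁`. Replacing `u₁` by `u = u₁ exp(-Z/2)` removes the
factor `exp Z`, so that `φ(u) = u g` with `g ∈ G₀` (`exists_smul_levi_of_isSymmetry`).

Existence: `φ` preserves each field `ω⁻¹(X)`, so for small `X ∈ 𝔤₋₁` it sends `Fl₁^{ω⁻¹(X)}(u)` to
`Fl₁^{ω⁻¹(-X)}(u) g` (`IsNormalFlow.localAut_apply`). The image of `σ_u` is therefore mapped to
itself, which is invariance of `σ_u` (`IsNormalAt.invariantNear`).

Uniqueness: let `σ_v` be invariant with `v = u k`. Invariance over `x` forces `k⁻¹ g k ∈ G₀`, so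
`k⁻¹ g k` fixes the grading element `E`, the element of `𝔤₀` whose `ad` is multiplication by the
degree. As `Ad k E = E + Z` with `Z ∈ 𝔤₁`, this reads `E - Z = E + Z`. Hence `Z = 0` and `k ∈ G₀`,
and `σ_{uk} = σ_u` near `x` (`IsNormalAt.eqNear_of_invariantNear`).

For the second claim, the Weyl connection of `σ` differentiates the frame form of a vector field
along `ω⁻¹(𝔤₋₁)` at points of the image of `σ`. If `φ` preserves `ω` and this image, then `s`
preserves the connection (`InvariantNear.invariantConnectionNear`).

Two supports are built from the ground up. Analytic: the time one flow of `ω⁻¹(X)`, and with it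
`exp`, depends smoothly on `X`; this comes from the inverse function theorem on a Banach space of
curves. Algebraic: the element `E` gives the smooth splitting of `P` by the explicit formula `Z =
Ad(h⁻¹)E - E`. -/

noncomputable section

/-! ### The smooth inverse function theorem in Banach spaces. -/

section InverseFunction

variable {E F : Type*} [NormedAddCommGroup E] [NormedSpace ℝ E] [CompleteSpace E]
  [NormedAddCommGroup F] [NormedSpace ℝ F]

/-- The inverse function theorem for `C^∞` maps, with the local inverse smooth on its domain. -/
theorem exists_openPartialHomeomorph_contDiffOn_symm {f : E → F} {U : Set E} (hU : IsOpen U)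
    (hf : ContDiffOn ℝ ∞ f U) {a : E} (ha : a ∈ U) {f' : E ≃L[ℝ] F}
    (hf' : HasFDerivAt f (f' : E →L[ℝ] F) a) :
    ∃ e : OpenPartialHomeomorph E F, a ∈ e.source ∧ e.source ⊆ U ∧ (∀ y, e y = f y) ∧
      ContDiffOn ℝ ∞ e.symm e.target := by
  have hfa : ContDiffAt ℝ ∞ f a := (hf a ha).contDiffAt (hU.mem_nhds ha)
  let e₀ := hfa.toOpenPartialHomeomorph f hf' (by simp)
  have hcont : ContinuousOn (fderiv ℝ f) U := hf.continuousOn_fderiv_of_isOpen hU (by simp)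
  -- The inverse is known to be smooth only at images of points where the derivative is invertible,
  -- so the source is cut down to the open set of such points.
  have hV : IsOpen (U ∩ fderiv ℝ f ⁻¹' range ((↑) : (E ≃L[ℝ] F) → E →L[ℝ] F)) :=
    hcont.isOpen_inter_preimage hU ContinuousLinearEquiv.isOpen
  set V := U ∩ fderiv ℝ f ⁻¹' range ((↑) : (E ≃L[ℝ] F) → E →L[ℝ] F) with hVdef
  have haV : a ∈ V := ⟨ha, f', hf'.fderiv.symm⟩
  refine ⟨e₀.restrOpen V hV, ?_, ?_, fun _ => rfl, ?_⟩
  · exact ⟨hfa.mem_toOpenPartialHomeomorph_source hf' (by simp), haV⟩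
  · exact fun y hy => hy.2.1
  · intro z hz
    set e := e₀.restrOpen V hV
    have hy : e.symm z ∈ e.source := e.map_target hz
    have hyV : e.symm z ∈ V := hy.2
    obtain ⟨g, hg⟩ := hyV.2
    have hd : DifferentiableAt ℝ f (e.symm z) :=
      ((hf _ hyV.1).contDiffAt (hU.mem_nhds hyV.1)).differentiableAt (by simp)
    refine (e.contDiffAt_symm (f₀' := g) hz ?_
      ((hf _ hyV.1).contDiffAt (hU.mem_nhds hyV.1))).contDiffWithinAt
    rw [hg]
    exact hd.hasFDerivAt

end InverseFunction

/-! ### Smoothness of postcomposition on spaces of continuous curves. -/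

section CompositionOperator

universe u v

variable {K : Type*} [TopologicalSpace K] [CompactSpace K]
  {E : Type*} [NormedAddCommGroup E] [NormedSpace ℝ E]
  {F : Type*} [NormedAddCommGroup F] [NormedSpace ℝ F]

/-- Pointwise application of a continuous family of continuous linear maps. -/
def ContinuousMap.pointwiseApplyL : C(K, E →L[ℝ] F) →L[ℝ] C(K, E) →L[ℝ] C(K, F) :=
  LinearMap.mkContinuous₂
    (LinearMap.mk₂ ℝ (fun (A : C(K, E →L[ℝ] F)) (γ : C(K, E)) =>
        (⟨fun t => A t (γ t), by fun_prop⟩ : C(K, F)))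
      (fun A B γ => by ext t; rfl) (fun c A γ => by ext t; rfl)
      (fun A γ δ => by ext t; exact (A t).map_add _ _)
      (fun c A γ => by ext t; exact (A t).map_smul c (γ t))) 1
    (fun A γ => by
      rw [one_mul, ContinuousMap.norm_le _ (by positivity)]
      exact fun t => (A t).le_opNorm_of_le (γ.norm_coe_le_norm t) |>.trans
        (mul_le_mul_of_nonneg_right (A.norm_coe_le_norm t) (norm_nonneg _)))

/-- Since `K` is compact, `f' ∘ δ` is uniformly close to `f' ∘ γ` when `δ` is close to `γ`. The mean
value inequality on each segment from `γ t` to `γ t + δ t` then bounds the remainder uniformly in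
`t`. -/
theorem hasFDerivAt_postcomp {f : E → F} (hf : ContDiff ℝ 1 f) (γ : C(K, E)) :
    HasFDerivAt (fun γ : C(K, E) => (⟨f ∘ γ, hf.continuous.comp γ.continuous⟩ : C(K, F)))
      (ContinuousMap.pointwiseApplyL
        (⟨fderiv ℝ f ∘ γ, (hf.continuous_fderiv one_ne_zero).comp γ.continuous⟩ : C(K, E →L[ℝ] F)))
      γ := by
  let f' : C(E, E →L[ℝ] F) := ⟨fderiv ℝ f, hf.continuous_fderiv one_ne_zero⟩
  have hc : ContinuousAt (fun δ : C(K, E) => f'.comp δ) γ :=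
    (ContinuousMap.continuous_postcomp f').continuousAt
  rw [hasFDerivAt_iff_isLittleO_nhds_zero, Asymptotics.isLittleO_iff]
  intro c hc0
  have hmem := hc.preimage_mem_nhds (Metric.ball_mem_nhds (f'.comp γ) hc0)
  obtain ⟨r, hr, hball⟩ := Metric.mem_nhds_iff.1 hmem
  filter_upwards [Metric.ball_mem_nhds (0 : C(K, E)) hr] with δ hδ
  rw [mem_ball_zero_iff] at hδ
  rw [ContinuousMap.norm_le _ (by positivity)]
  intro t
  have hmv := Convex.norm_image_sub_le_of_norm_hasFDerivWithin_le
    (f := fun z => f z - fderiv ℝ f (γ t) z) (f' := fun z => fderiv ℝ f z - fderiv ℝ f (γ t))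
    (s := segment ℝ (γ t) (γ t + δ t)) (C := c) (x := γ t) (y := γ t + δ t)
    (fun z _ => ((hf.differentiable one_ne_zero z).hasFDerivAt.sub
      (fderiv ℝ f (γ t)).hasFDerivAt).hasFDerivWithinAt)
    (fun z hz => ?_) (convex_segment _ _) (left_mem_segment ℝ _ _) (right_mem_segment ℝ _ _)
  · have h1 : ‖δ t‖ ≤ ‖δ‖ := δ.norm_coe_le_norm t
    have h2 : (f (γ t + δ t) - fderiv ℝ f (γ t) (γ t + δ t)) - (f (γ t) - fderiv ℝ f (γ t) (γ t))
        = f (γ t + δ t) - f (γ t) - fderiv ℝ f (γ t) (δ t) := by rw [map_add]; abel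
    rw [h2, add_sub_cancel_left] at hmv
    exact hmv.trans (mul_le_mul_of_nonneg_left h1 hc0.le)
  · rw [segment_eq_image'] at hz
    obtain ⟨s, hs, rfl⟩ := hz
    have hd : dist (γ + s • δ) γ < r := by
      rw [dist_eq_norm, add_sub_cancel_left, norm_smul, Real.norm_of_nonneg hs.1]
      exact (mul_le_of_le_one_left (norm_nonneg _) hs.2).trans_lt hδ
    have := (ContinuousMap.dist_apply_le_dist (f := f'.comp (γ + s • δ)) (g := f'.comp γ) t).trans_lt
      (hball (Metric.mem_ball.2 hd))
    rw [dist_eq_norm] at this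
    simpa [f'] using this.le

/-- The derivative of postcomposition with `f` is postcomposition with `f'` followed by the fixed
linear map `pointwiseApplyL`, so induction on `n` applies. The target must vary in the induction, as
`f'` takes values in `E →L[ℝ] F`; this is why `F` lives in the larger universe. -/
theorem contDiff_postcomp_nat {E : Type u} [NormedAddCommGroup E] [NormedSpace ℝ E] (n : ℕ) :
    ∀ {F : Type (max u v)} [NormedAddCommGroup F] [NormedSpace ℝ F] {f : E → F}
      (hf : ContDiff ℝ n f),
      ContDiff ℝ n (fun γ : C(K, E) => (⟨f ∘ γ, hf.continuous.comp γ.continuous⟩ : C(K, F))) := by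
  induction n with
  | zero =>
    intro F _ _ f hf
    exact contDiff_zero.2 (ContinuousMap.continuous_postcomp ⟨f, hf.continuous⟩)
  | succ n ih =>
    intro F _ _ f hf
    have hf1 : ContDiff ℝ 1 f := hf.of_le (by norm_cast; omega)
    have hfd := fun γ => hasFDerivAt_postcomp (K := K) hf1 γ
    have hf' : ContDiff ℝ n (fderiv ℝ f) := ContDiff.fderiv_right hf (by norm_cast)
    let PA := ContinuousMap.pointwiseApplyL (K := K) (E := E) (F := F)
    have hPA : ContDiff ℝ n PA := ContinuousLinearMap.contDiff (𝕜 := ℝ) (E := C(K, E →L[ℝ] F)) (F := C(K, E) →L[ℝ] C(K, F)) PA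
    have key : ContDiff ℝ ((n : WithTop ℕ∞) + 1)
        (fun γ : C(K, E) => (⟨f ∘ γ, hf.continuous.comp γ.continuous⟩ : C(K, F))) :=
      contDiff_succ_iff_hasFDerivAt.2 ⟨_, hPA.comp (ih hf'), hfd⟩
    exact key.of_le (by norm_cast)

theorem contDiff_postcomp {E : Type u} [NormedAddCommGroup E] [NormedSpace ℝ E]
    {F : Type (max u v)} [NormedAddCommGroup F] [NormedSpace ℝ F] {f : E → F}
    (hf : ContDiff ℝ ∞ f) :
    ContDiff ℝ ∞ (fun γ : C(K, E) => (⟨f ∘ γ, hf.continuous.comp γ.continuous⟩ : C(K, F))) :=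
  contDiff_infty.2 fun n => contDiff_postcomp_nat.{u, v} n (hf.of_le (by exact_mod_cast le_top))

end CompositionOperator

/-! ### Smooth dependence of flows on parameters, in vector spaces. -/

section ParametricFlow

universe u

variable {E : Type u} [NormedAddCommGroup E] [NormedSpace ℝ E]

/-- Integration from `0`, as an operator on continuous curves. -/
def integralL (E : Type*) [NormedAddCommGroup E] [NormedSpace ℝ E] :
    C(Icc (-1 : ℝ) 2, E) →L[ℝ] C(Icc (-1 : ℝ) 2, E) :=
  LinearMap.mkContinuous
    { toFun := fun γ => ⟨fun t => ∫ s in (0 : ℝ)..t, IccExtend (by norm_num) γ s, by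
        have h : Continuous (IccExtend (by norm_num : (-1 : ℝ) ≤ 2) γ) := γ.continuous.Icc_extend'
        exact (intervalIntegral.continuous_primitive (fun a b => h.intervalIntegrable a b) 0).comp
          continuous_subtype_val⟩
      map_add' := fun γ δ => by
        ext t
        have h1 : Continuous (IccExtend (by norm_num : (-1 : ℝ) ≤ 2) γ) := γ.continuous.Icc_extend'
        have h2 : Continuous (IccExtend (by norm_num : (-1 : ℝ) ≤ 2) δ) := δ.continuous.Icc_extend'
        exact intervalIntegral.integral_add (h1.intervalIntegrable _ _) (h2.intervalIntegrable _ _)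
      map_smul' := fun c γ => by
        ext t
        exact intervalIntegral.integral_smul c (IccExtend (by norm_num : (-1 : ℝ) ≤ 2) γ) } 2
    (fun γ => by
      rw [ContinuousMap.norm_le _ (by positivity)]
      intro t
      have h := intervalIntegral.norm_integral_le_of_norm_le_const (a := (0 : ℝ)) (b := t)
        (f := IccExtend (by norm_num : (-1 : ℝ) ≤ 2) γ) (C := ‖γ‖)
        (fun s _ => γ.norm_coe_le_norm _)
      refine h.trans ?_
      rw [mul_comm]
      refine mul_le_mul_of_nonneg_right ?_ (norm_nonneg _)
      rw [sub_zero, abs_le]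
      constructor <;> linarith [t.2.1, t.2.2])

theorem integralL_apply (γ : C(Icc (-1 : ℝ) 2, E)) (t : Icc (-1 : ℝ) 2) :
    integralL E γ t = ∫ s in (0 : ℝ)..t, IccExtend (by norm_num : (-1 : ℝ) ≤ 2) γ s := rfl

theorem integralL_const [CompleteSpace E] (c : E) (t : Icc (-1 : ℝ) 2) :
    integralL E (ContinuousMap.const _ c) t = (t : ℝ) • c := by
  have h : ∫ _s in (0 : ℝ)..t, c = (t : ℝ) • c := by simp
  exact h

theorem compLeftContinuous_integralL [CompleteSpace E] {F : Type*} [NormedAddCommGroup F]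
    [NormedSpace ℝ F] [CompleteSpace F] (A : E →L[ℝ] F) (γ : C(Icc (-1 : ℝ) 2, E))
    (t : Icc (-1 : ℝ) 2) :
    A (integralL E γ t) = integralL F ((A : C(E, F)).comp γ) t := by
  have h : Continuous (IccExtend (by norm_num : (-1 : ℝ) ≤ 2) γ) := γ.continuous.Icc_extend'
  rw [integralL_apply, integralL_apply,
    ← ContinuousLinearMap.intervalIntegral_comp_comm _ (h.intervalIntegrable _ _)]
  rfl

/-- Smooth dependence on the initial value, near a zero of the field at which the derivative of the
field squares to zero. -/
theorem exists_smooth_flow [CompleteSpace E] {g : E → E} (hg : ContDiff ℝ ∞ g) {z₀ : E}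
    (hz₀ : g z₀ = 0) (hA : ∀ w, fderiv ℝ g z₀ (fderiv ℝ g z₀ w) = 0) :
    ∃ (O : Set E) (Γ : E → C(Icc (-1 : ℝ) 2, E)), IsOpen O ∧ z₀ ∈ O ∧ ContDiffOn ℝ ∞ Γ O ∧
      Γ z₀ = ContinuousMap.const _ z₀ ∧
      (∃ Γ' : E →L[ℝ] C(Icc (-1 : ℝ) 2, E), HasFDerivAt Γ Γ' z₀ ∧
        ∀ w t, Γ' w t = w + (t : ℝ) • fderiv ℝ g z₀ w) ∧
      ∀ z ∈ O, ∀ t : Icc (-1 : ℝ) 2,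
        Γ z t = z + integralL E (⟨g ∘ Γ z, hg.continuous.comp (Γ z).continuous⟩) t := by
  let C := C(Icc (-1 : ℝ) 2, E)
  let N : C → C := fun γ => ⟨g ∘ γ, hg.continuous.comp γ.continuous⟩
  have hN : ContDiff ℝ ∞ N := contDiff_postcomp.{u, u} hg
  -- The integral equation `γ = z + ∫ g ∘ γ` reads `Φ γ = const z`, so solving it smoothly in `z`
  -- means inverting `Φ` near the stationary curve.
  let Φ : C → C := fun γ => γ - integralL E (N γ)
  have hΦ : ContDiff ℝ ∞ Φ := contDiff_id.sub ((integralL E).contDiff.comp hN)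
  let γ₀ : C := ContinuousMap.const _ z₀
  let A : E →L[ℝ] E := fderiv ℝ g z₀
  let B : C →L[ℝ] C := (integralL E).comp (A.compLeftContinuous ℝ (Icc (-1 : ℝ) 2))
  have hNd : HasFDerivAt N (A.compLeftContinuous ℝ (Icc (-1 : ℝ) 2)) γ₀ := by
    have h := hasFDerivAt_postcomp (K := Icc (-1 : ℝ) 2) (hg.of_le (by simp)) γ₀
    convert h using 1
    ext γ t
    rfl
  have hΦd : HasFDerivAt Φ (ContinuousLinearMap.id ℝ C - B) γ₀ :=
    (hasFDerivAt_id γ₀).sub ((integralL E).hasFDerivAt.comp γ₀ hNd)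
  -- A fixed linear map commutes with integration, so `A² = 0` gives `B² = 0`. Thus `1 - B` has the
  -- inverse `1 + B`, whatever the length of the time interval.
  have hBB : ∀ γ, B (B γ) = 0 := by
    intro γ
    have : A.compLeftContinuous ℝ (Icc (-1 : ℝ) 2) (B γ) = 0 := by
      ext t
      change A (integralL E (A.compLeftContinuous ℝ (Icc (-1 : ℝ) 2) γ) t) = 0
      rw [compLeftContinuous_integralL]
      have h0 : ((A : C(E, E)).comp (A.compLeftContinuous ℝ (Icc (-1 : ℝ) 2) γ)) = 0 := by
        ext t; exact hA _
      rw [h0, map_zero]; rfl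
    change integralL E (A.compLeftContinuous ℝ (Icc (-1 : ℝ) 2) (B γ)) = 0
    rw [this, map_zero]
  let L : C ≃L[ℝ] C := ContinuousLinearEquiv.equivOfInverse (ContinuousLinearMap.id ℝ C - B)
    (ContinuousLinearMap.id ℝ C + B)
    (fun γ => by
      change (γ - B γ) + B (γ - B γ) = γ
      rw [map_sub, hBB]; abel)
    (fun γ => by
      change (γ + B γ) - B (γ + B γ) = γ
      rw [map_add, hBB]; abel)
  have hΦL : HasFDerivAt Φ (L : C →L[ℝ] C) γ₀ := hΦd
  obtain ⟨e, he0, -, hef, hes⟩ := exists_openPartialHomeomorph_contDiffOn_symm isOpen_univ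
    hΦ.contDiffOn (mem_univ γ₀) hΦL
  let c : E →L[ℝ] C := ContinuousLinearMap.const ℝ (Icc (-1 : ℝ) 2)
  have hΦ₀ : e γ₀ = c z₀ := by
    rw [hef]
    have h0 : N γ₀ = 0 := by ext t; exact hz₀
    change γ₀ - integralL E (N γ₀) = γ₀
    rw [h0, map_zero, sub_zero]
  have hz₀t : c z₀ ∈ e.target := hΦ₀ ▸ e.map_source he0
  have hsymm : e.symm (c z₀) = γ₀ := by rw [← hΦ₀, e.left_inv he0]
  refine ⟨c ⁻¹' e.target, fun z => e.symm (c z), e.open_target.preimage c.continuous, hz₀t,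
    hes.comp c.contDiff.contDiffOn (fun z hz => hz), hsymm,
    ⟨(L.symm : C →L[ℝ] C).comp c, ?_, ?_⟩, ?_⟩
  · refine HasFDerivAt.comp z₀ ?_ c.hasFDerivAt
    refine e.hasFDerivAt_symm hz₀t ?_
    rw [hsymm]
    exact hΦL.congr_of_eventuallyEq (Eventually.of_forall hef)
  · intro w t
    change w + integralL E (ContinuousMap.const _ (A w)) t = _
    rw [integralL_const]
  · intro z hz t
    have h : Φ (e.symm (c z)) = c z := by rw [← hef, e.right_inv hz]
    have h' := congrArg (fun γ : C => γ t) h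
    exact sub_eq_iff_eq_add.1 h'

/-- The parameter is adjoined as a coordinate with velocity zero, giving the field `(X, q) ↦ (0, f
(X, q))`. As `f (0, ·) = 0`, its derivative at `(0, q₀)` sends `(X, v)` to a vector `(0, v')`
depending only on `X`, hence has square zero as `exists_smooth_flow` requires. The same formula
gives the derivative of the time one map. -/
theorem exists_parametric_flow {W E : Type*} [NormedAddCommGroup W] [NormedSpace ℝ W]
    [FiniteDimensional ℝ W] [NormedAddCommGroup E] [NormedSpace ℝ E] [FiniteDimensional ℝ E]
    {f : W × E → E} {U : Set (W × E)} (hU : IsOpen U) {q₀ : E} (h0U : ((0 : W), q₀) ∈ U)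
    (hf : ContDiffOn ℝ ∞ f U) (hf0 : ∀ q, ((0 : W), q) ∈ U → f (0, q) = 0) :
    ∃ (O : Set W) (F : W → E), IsOpen O ∧ (0 : W) ∈ O ∧ ContDiffOn ℝ ∞ F O ∧ F 0 = q₀ ∧
      HasFDerivAt F ((fderiv ℝ f (0, q₀)).comp (ContinuousLinearMap.inl ℝ W E)) 0 ∧
      ∀ X ∈ O, ∃ γ : ℝ → E, γ 0 = q₀ ∧ γ 1 = F X ∧
        ∀ t ∈ Ioo (-1 : ℝ) 2, (X, γ t) ∈ U ∧ HasDerivAt γ (f (X, γ t)) t := by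
  have : CompleteSpace W := FiniteDimensional.complete ℝ W
  have : CompleteSpace E := FiniteDimensional.complete ℝ E
  obtain ⟨R, hR, hRU⟩ := Metric.isOpen_iff.1 hU _ h0U
  -- The cutoff makes the field global. The curves near the stationary one remain in the ball of
  -- radius `R / 3`, where `χ = 1`, so they solve the original equation.
  let χ : ContDiffBump ((0 : W), q₀) := ⟨R / 3, R / 2, by positivity, by linarith⟩
  let f₁ : W × E → E := fun z => χ z • f z
  have hf₁ : ContDiff ℝ ∞ f₁ := by
    rw [contDiff_iff_contDiffAt]
    intro z
    by_cases hz : z ∈ U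
    · exact (χ.contDiff.contDiffAt).smul ((hf z hz).contDiffAt (hU.mem_nhds hz))
    · have hz' : z ∉ Metric.closedBall ((0 : W), q₀) (R / 2) := fun h =>
        hz (hRU (Metric.closedBall_subset_ball (by linarith) h))
      have hev : f₁ =ᶠ[𝓝 z] fun _ => 0 := by
        filter_upwards [Metric.isClosed_closedBall.isOpen_compl.mem_nhds hz'] with y hy
        have : χ y = 0 := χ.zero_of_le_dist (by
          have := hy; simp only [mem_compl_iff, Metric.mem_closedBall, not_le] at this
          exact this.le)
        simp [f₁, this]
      exact contDiffAt_const.congr_of_eventuallyEq hev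
  have hff₁ : ∀ z ∈ Metric.ball ((0 : W), q₀) (R / 3), f₁ z = f z := fun z hz => by
    have : χ z = 1 := χ.one_of_mem_closedBall (Metric.ball_subset_closedBall hz)
    simp [f₁, this]
  have hbU : Metric.ball ((0 : W), q₀) (R / 3) ⊆ U :=
    (Metric.ball_subset_ball (by linarith)).trans hRU
  have hf₁0 : ∀ q, f₁ (0, q) = 0 := fun q => by
    by_cases hz : ((0 : W), q) ∈ U
    · simp [f₁, hf0 q hz]
    · have : χ (0, q) = 0 := χ.zero_of_le_dist (by
        by_contra h
        exact hz (hRU (lt_trans (not_le.1 h) (by change R / 2 < R; linarith))))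
      simp [f₁, this]
  let z₀ : W × E := (0, q₀)
  let g : W × E → W × E := fun z => (0, f₁ z)
  have hg : ContDiff ℝ ∞ g := contDiff_const.prodMk hf₁
  have hf₁d : HasFDerivAt f₁ (fderiv ℝ f₁ z₀) z₀ :=
    (hf₁.differentiable (by simp) z₀).hasFDerivAt
  have hgd : fderiv ℝ g z₀ = (0 : W × E →L[ℝ] W).prod (fderiv ℝ f₁ z₀) :=
    ((hasFDerivAt_const (0 : W) z₀).prodMk hf₁d).fderiv
  have hf₁d0 : ∀ v : E, fderiv ℝ f₁ z₀ (0, v) = 0 := fun v => by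
    have h1 := hf₁d.comp q₀ (hasFDerivAt_prodMk_right (𝕜 := ℝ) (0 : W) q₀)
    have h2 : (f₁ ∘ fun q => ((0 : W), q)) = fun _ => 0 := funext hf₁0
    rw [h2] at h1
    exact DFunLike.congr_fun (h1.unique (hasFDerivAt_const (0 : E) q₀)) v
  obtain ⟨O, Γ, hO, hz₀O, hΓ, hΓ0, ⟨Γ', hΓ', hΓ'v⟩, hΓi⟩ := exists_smooth_flow hg
    (z₀ := z₀) (Prod.ext rfl (hf₁0 q₀)) (fun w => by
      rw [hgd]; exact Prod.ext rfl (hf₁d0 _))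
  have hcont : ContinuousAt Γ z₀ := (hΓ.continuousOn.continuousAt (hO.mem_nhds hz₀O))
  have hnear : ∀ᶠ z in 𝓝 z₀, dist (Γ z) (ContinuousMap.const _ z₀) < R / 3 := by
    have := hcont.preimage_mem_nhds (Metric.ball_mem_nhds (Γ z₀) (by positivity : 0 < R / 3))
    rw [hΓ0] at this
    exact this
  obtain ⟨O₁, hO₁s, hO₁, hzO₁⟩ := mem_nhds_iff.1 hnear
  let ι : W → W × E := fun X => (X, q₀)
  have hι : ContDiff ℝ ∞ ι := contDiff_id.prodMk contDiff_const
  let one : Icc (-1 : ℝ) 2 := ⟨1, by norm_num⟩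
  let ev : C(Icc (-1 : ℝ) 2, W × E) →L[ℝ] E :=
    (ContinuousLinearMap.snd ℝ W E).comp (ContinuousMap.evalCLM ℝ one)
  refine ⟨ι ⁻¹' (O ∩ O₁), fun X => ev (Γ (ι X)), (hO.inter hO₁).preimage hι.continuous,
    ⟨hz₀O, hzO₁⟩, ?_, ?_, ?_, ?_⟩
  · exact ev.contDiff.comp_contDiffOn (hΓ.comp hι.contDiffOn fun X hX => hX.1)
  · change (Γ z₀ one).2 = q₀
    rw [hΓ0]; rfl
  · have hιd : HasFDerivAt ι (ContinuousLinearMap.inl ℝ W E) 0 :=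
      hasFDerivAt_prodMk_left (0 : W) q₀
    have h := ev.hasFDerivAt.comp (0 : W) (HasFDerivAt.comp (0 : W) (f := ι) hΓ' hιd)
    refine h.congr_fderiv ?_
    ext X
    change (Γ' (X, 0) one).2 = _
    rw [hΓ'v, hgd]
    have hfd : fderiv ℝ f₁ z₀ = fderiv ℝ f (0, q₀) := Filter.EventuallyEq.fderiv_eq (by
      filter_upwards [Metric.ball_mem_nhds z₀ (by positivity : 0 < R / 3)] with z hz
      exact hff₁ z hz)
    simp [one, hfd]
  · intro X hX
    have hXi := hΓi _ hX.1
    have hdist : ∀ t, dist (Γ (ι X) t) z₀ < R / 3 := fun t =>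
      (ContinuousMap.dist_apply_le_dist t).trans_lt (hO₁s hX.2)
    let γ : ℝ → W × E := IccExtend (by norm_num : (-1 : ℝ) ≤ 2) (Γ (ι X))
    have hγc : Continuous γ := (Γ (ι X)).continuous.Icc_extend'
    have hγt : ∀ t (ht : t ∈ Icc (-1 : ℝ) 2), γ t = ι X + ∫ s in (0 : ℝ)..t, g (γ s) := by
      intro t ht
      have h1 : γ t = Γ (ι X) ⟨t, ht⟩ := IccExtend_of_mem _ _ ht
      rw [h1, hXi]; rfl
    have hgγ : Continuous fun s => g (γ s) := hg.continuous.comp hγc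
    have hfst : ∀ t ∈ Icc (-1 : ℝ) 2, (γ t).1 = X := by
      intro t ht
      have h1 := ContinuousLinearMap.intervalIntegral_comp_comm (ContinuousLinearMap.fst ℝ W E)
        (hgγ.intervalIntegrable (μ := MeasureTheory.volume) (0 : ℝ) t)
      have h2 : ∫ s in (0 : ℝ)..t, (ContinuousLinearMap.fst ℝ W E) (g (γ s)) = 0 := by
        simp [g]
      have h3 : (∫ s in (0 : ℝ)..t, g (γ s)).1 = 0 := h1.symm.trans h2
      rw [hγt t ht, Prod.fst_add, h3, add_zero]
    have hball : ∀ t, γ t ∈ Metric.ball ((0 : W), q₀) (R / 3) := fun t => hdist _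
    refine ⟨fun t => (γ t).2, ?_, ?_, ?_⟩
    · change (γ 0).2 = q₀
      rw [hγt 0 (by norm_num)]; simp [ι]
    · have h1 : γ 1 = Γ (ι X) one := IccExtend_of_mem _ _ (by norm_num)
      change (γ 1).2 = _
      rw [h1]; rfl
    · intro t ht
      have hte : (X, (γ t).2) = γ t := Prod.ext (hfst t (Ioo_subset_Icc_self ht)).symm rfl
      refine ⟨by rw [hte]; exact hbU (hball t), ?_⟩
      rw [hte, ← hff₁ _ (hball t)]
      have hm : StronglyMeasurableAtFilter (fun s => g (γ s)) (𝓝 t) MeasureTheory.volume :=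
        hgγ.stronglyMeasurableAtFilter _ _
      have hd : HasDerivAt (fun t => ι X + ∫ s in (0 : ℝ)..t, g (γ s)) (g (γ t)) t :=
        (intervalIntegral.integral_hasDerivAt_right (hgγ.intervalIntegrable 0 t)
          (hgγ.stronglyMeasurableAtFilter _ _) hgγ.continuousAt).const_add _
      have hd' : HasDerivAt γ (g (γ t)) t := hd.congr_of_eventuallyEq (by
        filter_upwards [isOpen_Ioo.mem_nhds ht] with s hs
        exact hγt s (Ioo_subset_Icc_self hs))
      exact hd'.snd

end ParametricFlow

/-! ### Velocities, inverses and derivatives on manifolds. -/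

section ManifoldCalculus

variable {E : Type*} [NormedAddCommGroup E] [NormedSpace ℝ E]
  {Q : Type*} [TopologicalSpace Q] [ChartedSpace E Q]
  {E' : Type*} [NormedAddCommGroup E'] [NormedSpace ℝ E']
  {N : Type*} [TopologicalSpace N] [ChartedSpace E' N]
  {E'' : Type*} [NormedAddCommGroup E''] [NormedSpace ℝ E'']
  {S : Type*} [TopologicalSpace S] [ChartedSpace E'' S]

/-- The velocity of the image of a curve. -/
theorem HasMFDerivWithinAt.comp_curve {f : Q → N} {γ : ℝ → Q} {s : Set ℝ} {t : ℝ}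
    {w : TangentSpace 𝓘(ℝ, E) (γ t)}
    (hγ : HasMFDerivWithinAt 𝓘(ℝ, ℝ) 𝓘(ℝ, E) γ s t ((1 : ℝ →L[ℝ] ℝ).smulRight w))
    (hf : MDifferentiableAt 𝓘(ℝ, E) 𝓘(ℝ, E') f (γ t)) :
    HasMFDerivWithinAt 𝓘(ℝ, ℝ) 𝓘(ℝ, E') (fun t => f (γ t)) s t
      ((1 : ℝ →L[ℝ] ℝ).smulRight (mfderiv 𝓘(ℝ, E) 𝓘(ℝ, E') f (γ t) w)) := by
  have h := hf.hasMFDerivAt.comp_hasMFDerivWithinAt t hγ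
  have hL : (mfderiv 𝓘(ℝ, E) 𝓘(ℝ, E') f (γ t)).comp ((1 : ℝ →L[ℝ] ℝ).smulRight w)
      = (1 : ℝ →L[ℝ] ℝ).smulRight (mfderiv 𝓘(ℝ, E) 𝓘(ℝ, E') f (γ t) w) := by
    refine ContinuousLinearMap.ext fun r => ?_
    exact (mfderiv 𝓘(ℝ, E) 𝓘(ℝ, E') f (γ t)).map_smul r w
  exact Eq.mp (congrArg (fun L => HasMFDerivWithinAt 𝓘(ℝ, ℝ) 𝓘(ℝ, E')
    (fun t => f (γ t)) s t L) hL) h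

theorem HasMFDerivAt.comp_curve {f : Q → N} {γ : ℝ → Q} {t : ℝ}
    {w : TangentSpace 𝓘(ℝ, E) (γ t)}
    (hγ : HasMFDerivAt 𝓘(ℝ, ℝ) 𝓘(ℝ, E) γ t ((1 : ℝ →L[ℝ] ℝ).smulRight w))
    (hf : MDifferentiableAt 𝓘(ℝ, E) 𝓘(ℝ, E') f (γ t)) :
    HasMFDerivAt 𝓘(ℝ, ℝ) 𝓘(ℝ, E') (fun t => f (γ t)) t
      ((1 : ℝ →L[ℝ] ℝ).smulRight (mfderiv 𝓘(ℝ, E) 𝓘(ℝ, E') f (γ t) w)) :=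
  hasMFDerivWithinAt_univ.1 ((hasMFDerivWithinAt_univ.2 hγ).comp_curve hf)

/-- The image of an integral curve under a map that relates the vector fields. -/
theorem IsMIntegralCurveOn.map {f : Q → N} {γ : ℝ → Q} {s : Set ℝ}
    {v : ∀ q : Q, TangentSpace 𝓘(ℝ, E) q} {v' : ∀ q : N, TangentSpace 𝓘(ℝ, E') q}
    (hγ : IsMIntegralCurveOn γ v s)
    (hf : ∀ t ∈ s, MDifferentiableAt 𝓘(ℝ, E) 𝓘(ℝ, E') f (γ t))
    (hv : ∀ t ∈ s, mfderiv 𝓘(ℝ, E) 𝓘(ℝ, E') f (γ t) (v (γ t)) = v' (f (γ t))) :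
    IsMIntegralCurveOn (fun t => f (γ t)) v' s := fun t ht => by
  have h := (hγ t ht).comp_curve (hf t ht)
  rw [hv t ht] at h
  exact h

/-- In finite dimension a linear map depends linearly on its values on a basis, so smoothness can be
tested vector by vector. -/
theorem contMDiffAt_clm_of_apply [FiniteDimensional ℝ E'] {n : WithTop ℕ∞} {A : Q → E' →L[ℝ] E''}
    {x : Q} (h : ∀ v, ContMDiffAt 𝓘(ℝ, E) 𝓘(ℝ, E'') n (fun q => A q v) x) :
    ContMDiffAt 𝓘(ℝ, E) 𝓘(ℝ, E' →L[ℝ] E'') n A x := by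
  let b := Module.finBasis ℝ E'
  let L : (Fin (Module.finrank ℝ E') → E'') →L[ℝ] (E' →L[ℝ] E'') :=
    ∑ i, (ContinuousLinearMap.smulRightL ℝ E' E'' (LinearMap.toContinuousLinearMap (b.coord i))).comp
      (ContinuousLinearMap.proj i)
  have hA : A = fun q => L (fun i => A q (b i)) := by
    funext q
    ext v
    have hv : v = ∑ i, b.coord i v • b i := (b.sum_repr v).symm
    conv_lhs => rw [hv, map_sum]
    simp [L]
  rw [hA]
  exact L.contDiff.contMDiff.contMDiffAt.comp x (contMDiffAt_pi_space.2 fun i => h (b i))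

theorem ContinuousLinearMap.contMDiffAt_inverse [CompleteSpace E'] {n : WithTop ℕ∞}
    {A : Q → E' →L[ℝ] E''} {x : Q} (hA : ContMDiffAt 𝓘(ℝ, E) 𝓘(ℝ, E' →L[ℝ] E'') n A x)
    (hx : (A x).IsInvertible) :
    ContMDiffAt 𝓘(ℝ, E) 𝓘(ℝ, E'' →L[ℝ] E') n (fun q => (A q).inverse) x := by
  obtain ⟨e, he⟩ := hx
  have h := contDiffAt_map_inverse (n := n) e
  rw [he] at h
  exact h.contMDiffAt.comp x hA

/-- The derivative of a smooth map, applied to a smooth family of tangent vectors. -/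
theorem ContMDiffOn.mfderiv_apply [IsManifold 𝓘(ℝ, E) ∞ Q] [IsManifold 𝓘(ℝ, E') ∞ N]
    {f : Q → N} {U : Set Q} (hU : IsOpen U)
    (hf : ContMDiffOn 𝓘(ℝ, E) 𝓘(ℝ, E') ∞ f U) {b : S → Q}
    {w : ∀ m, TangentSpace 𝓘(ℝ, E) (b m)} {s : Set S}
    (hw : ContMDiffOn 𝓘(ℝ, E'') 𝓘(ℝ, E).tangent ∞
      (fun m => (⟨b m, w m⟩ : TangentBundle 𝓘(ℝ, E) Q)) s) (hs : MapsTo b s U) :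
    ContMDiffOn 𝓘(ℝ, E'') 𝓘(ℝ, E').tangent ∞
      (fun m => (⟨f (b m), mfderiv 𝓘(ℝ, E) 𝓘(ℝ, E') f (b m) (w m)⟩ : TangentBundle 𝓘(ℝ, E') N)) s := by
  have h := (hf.contMDiffOn_tangentMapWithin (m := ∞) (by simp) hU.uniqueMDiffOn).comp hw
    (fun m hm => hs hm)
  refine h.congr fun m hm => ?_
  simp only [Function.comp, tangentMapWithin]
  rw [mfderivWithin_of_isOpen hU (hs hm)]

theorem ContMDiffOn.mfderiv_apply_vectorSpace [IsManifold 𝓘(ℝ, E) ∞ Q]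
    {f : Q → E'} {U : Set Q} (hU : IsOpen U)
    (hf : ContMDiffOn 𝓘(ℝ, E) 𝓘(ℝ, E') ∞ f U) {b : S → Q}
    {w : ∀ m, TangentSpace 𝓘(ℝ, E) (b m)} {s : Set S}
    (hw : ContMDiffOn 𝓘(ℝ, E'') 𝓘(ℝ, E).tangent ∞
      (fun m => (⟨b m, w m⟩ : TangentBundle 𝓘(ℝ, E) Q)) s) (hs : MapsTo b s U) :
    ContMDiffOn 𝓘(ℝ, E'') 𝓘(ℝ, E') ∞
      (fun m => (mfderiv 𝓘(ℝ, E) 𝓘(ℝ, E') f (b m) (w m) : E')) s :=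
  (contMDiff_snd_tangentBundle_modelSpace E' 𝓘(ℝ, E')).comp_contMDiffOn (hf.mfderiv_apply hU hw hs)

end ManifoldCalculus

/-! ### Smooth dependence of the time one flow on a manifold. -/

section ManifoldFlow

variable {E : Type*} [NormedAddCommGroup E] [NormedSpace ℝ E] [FiniteDimensional ℝ E]
  {Q : Type*} [TopologicalSpace Q] [ChartedSpace E Q] [IsManifold 𝓘(ℝ, E) ∞ Q]
  {W : Type*} [NormedAddCommGroup W] [NormedSpace ℝ W] [FiniteDimensional ℝ W]

/-- The time one flow of a linear family of vector fields depends smoothly on the parameter, near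
the parameter `0`. -/
theorem exists_parametric_flow_manifold (v : W → ∀ q : Q, TangentSpace 𝓘(ℝ, E) q)
    (hadd : ∀ X Y q, v (X + Y) q = v X q + v Y q) (hsmul : ∀ (c : ℝ) X q, v (c • X) q = c • v X q)
    (hv : ∀ X, ContMDiff 𝓘(ℝ, E) 𝓘(ℝ, E).tangent ∞
      (fun q => (⟨q, v X q⟩ : TangentBundle 𝓘(ℝ, E) Q))) (u : Q) :
    ∃ (O : Set W) (F : W → Q), IsOpen O ∧ (0 : W) ∈ O ∧
      ContMDiffOn 𝓘(ℝ, W) 𝓘(ℝ, E) ∞ F O ∧ F 0 = u ∧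
      (∀ X, (mfderiv 𝓘(ℝ, W) 𝓘(ℝ, E) F 0 X : E) = v X u) ∧
      ∀ X ∈ O, ∃ γ : ℝ → Q, γ 0 = u ∧ γ 1 = F X ∧ IsMIntegralCurveOn γ (v X) (Ioo (-1) 2) := by
  let φ := extChartAt 𝓘(ℝ, E) u
  have hφt : IsOpen φ.target := isOpen_extChartAt_target u
  have hφs : IsOpen φ.source := isOpen_extChartAt_source u
  have hφ : ContMDiffOn 𝓘(ℝ, E) 𝓘(ℝ, E) ∞ φ φ.source := by
    rw [show φ.source = (chartAt E u).source from extChartAt_source _ _]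
    exact contMDiffOn_extChartAt
  have hφi : ContMDiffOn 𝓘(ℝ, E) 𝓘(ℝ, E) ∞ φ.symm φ.target := contMDiffOn_extChartAt_symm u
  let A₀ : E → W →ₗ[ℝ] E := fun y =>
    { toFun := fun X => mfderiv 𝓘(ℝ, E) 𝓘(ℝ, E) φ (φ.symm y) (v X (φ.symm y))
      map_add' := fun X Y => by rw [hadd]; exact map_add _ _ _
      map_smul' := fun c X => by rw [hsmul]; exact map_smul _ _ _ }
  let A : E → W →L[ℝ] E := fun y => LinearMap.toContinuousLinearMap (A₀ y)
  have hA : ContDiffOn ℝ ∞ A φ.target := by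
    rw [← contMDiffOn_iff_contDiffOn]
    intro y hy
    refine (contMDiffAt_clm_of_apply fun X => ?_).contMDiffWithinAt
    have h1 := (hφ.mfderiv_apply_vectorSpace hφs (hv X).contMDiffOn (mapsTo_id _)).comp hφi
      φ.mapsTo_symm
    exact (h1 y hy).contMDiffAt (hφt.mem_nhds hy)
  -- In the chart at `u` the family becomes linear in the parameter. It vanishes for the parameter
  -- `0`, so `exists_parametric_flow` applies.
  let f : W × E → E := fun p => A p.2 p.1
  have hf : ContDiffOn ℝ ∞ f (univ ×ˢ φ.target) :=
    (hA.comp contDiffOn_snd fun p hp => hp.2).clm_apply contDiffOn_fst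
  have huφ : φ u ∈ φ.target := mem_extChartAt_target u
  obtain ⟨O, F, hO, h0, hF, hF0, hFd, hFγ⟩ := exists_parametric_flow (isOpen_univ.prod hφt)
    (q₀ := φ u) ⟨mem_univ _, huφ⟩ hf (fun q _ => map_zero _)
  have hODE : ∀ X ∈ O, ∃ γ : ℝ → Q, γ 0 = u ∧ γ 1 = φ.symm (F X) ∧ F X ∈ φ.target ∧
      IsMIntegralCurveOn γ (v X) (Ioo (-1) 2) := by
    intro X hX
    obtain ⟨γ, hγ0, hγ1, hγ⟩ := hFγ X hX
    refine ⟨fun t => φ.symm (γ t), ?_, by simp only [hγ1], ?_, fun t ht => ?_⟩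
    · simp only [hγ0]; exact extChartAt_to_inv u
    · rw [← hγ1]; exact (hγ 1 (by norm_num)).1.2
    · obtain ⟨⟨-, hmem⟩, hd⟩ := hγ t ht
      simp only at hmem
      have hd' : HasMFDerivWithinAt 𝓘(ℝ, ℝ) 𝓘(ℝ, E) γ (Ioo (-1) 2) t
          ((1 : ℝ →L[ℝ] ℝ).smulRight (f (X, γ t))) :=
        (hasMFDerivAt_iff_hasFDerivAt.2 hd.hasFDerivAt).hasMFDerivWithinAt
      have hdi : MDifferentiableAt 𝓘(ℝ, E) 𝓘(ℝ, E) φ.symm (γ t) :=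
        ((hφi _ hmem).contMDiffAt (hφt.mem_nhds hmem)).mdifferentiableAt (by simp)
      have h := hd'.comp_curve hdi
      have hs : φ.symm (γ t) ∈ φ.source := φ.map_target hmem
      have hdφ : MDifferentiableAt 𝓘(ℝ, E) 𝓘(ℝ, E) φ (φ.symm (γ t)) :=
        ((hφ _ hs).contMDiffAt (hφs.mem_nhds hs)).mdifferentiableAt (by simp)
      have hid : mfderiv 𝓘(ℝ, E) 𝓘(ℝ, E) φ.symm (γ t) (f (X, γ t)) = v X (φ.symm (γ t)) := by
        have e : φ.symm ∘ φ =ᶠ[𝓝 (φ.symm (γ t))] id := by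
          filter_upwards [hφs.mem_nhds hs] with q hq
          exact φ.left_inv hq
        have h1 := mfderiv_comp_of_eq (x := φ.symm (γ t)) (y := γ t) hdi hdφ (φ.right_inv hmem)
        rw [e.mfderiv_eq, mfderiv_id] at h1
        have h2 : (mfderiv 𝓘(ℝ, E) 𝓘(ℝ, E) φ.symm (φ (φ.symm (γ t))) : E →L[ℝ] E) (f (X, γ t))
            = (v X (φ.symm (γ t)) : E) :=
          (DFunLike.congr_fun h1 (v X (φ.symm (γ t)))).symm
        rw [φ.right_inv hmem] at h2
        exact h2
      exact Eq.mp (congrArg (fun w => HasMFDerivWithinAt 𝓘(ℝ, ℝ) 𝓘(ℝ, E) (fun t => φ.symm (γ t)) _ t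
        ((1 : ℝ →L[ℝ] ℝ).smulRight w)) hid) h
  have hFt : ∀ X ∈ O, F X ∈ φ.target := fun X hX => by
    obtain ⟨γ, -, -, h, -⟩ := hODE X hX; exact h
  refine ⟨O, fun X => φ.symm (F X), hO, h0, hφi.comp hF.contMDiffOn hFt, ?_, ?_, ?_⟩
  · simp only [hF0]; exact extChartAt_to_inv u
  · intro X
    have hdi : MDifferentiableAt 𝓘(ℝ, E) 𝓘(ℝ, E) φ.symm (F 0) :=
      ((hφi _ (hFt 0 h0)).contMDiffAt (hφt.mem_nhds (hFt 0 h0))).mdifferentiableAt (by simp)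
    have hc := hdi.hasMFDerivAt.comp (0 : W) (hasMFDerivAt_iff_hasFDerivAt.2 hFd)
    have hfd : fderiv ℝ f (0, φ u) (X, 0) = f (X, φ u) := by
      have hda : DifferentiableAt ℝ f (0, φ u) :=
        ((hf _ ⟨mem_univ _, huφ⟩).contDiffAt ((isOpen_univ.prod hφt).mem_nhds
          ⟨mem_univ _, huφ⟩)).differentiableAt (by simp)
      have h1 := hda.hasFDerivAt.comp (0 : W) (hasFDerivAt_prodMk_left (𝕜 := ℝ) (0 : W) (φ u))
      have h2 : (f ∘ fun X => (X, φ u)) = A (φ u) := rfl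
      rw [h2] at h1
      exact DFunLike.congr_fun (h1.unique (A (φ u)).hasFDerivAt) X
    have hdφ : MDifferentiableAt 𝓘(ℝ, E) 𝓘(ℝ, E) φ u :=
      ((hφ _ (mem_extChartAt_source u)).contMDiffAt
        (hφs.mem_nhds (mem_extChartAt_source u))).mdifferentiableAt (by simp)
    have hdi' : MDifferentiableAt 𝓘(ℝ, E) 𝓘(ℝ, E) φ.symm (φ u) := hF0 ▸ hdi
    have e : φ.symm ∘ φ =ᶠ[𝓝 u] id := by
      filter_upwards [hφs.mem_nhds (mem_extChartAt_source u)] with q hq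
      exact φ.left_inv hq
    have h1 := mfderiv_comp u hdi' hdφ
    rw [e.mfderiv_eq, mfderiv_id] at h1
    have h3 := DFunLike.congr_fun h1 (v X u)
    have h4 := DFunLike.congr_fun hc.mfderiv X
    refine h4.trans ?_
    change (mfderiv 𝓘(ℝ, E) 𝓘(ℝ, E) φ.symm (F 0) : E →L[ℝ] E) (fderiv ℝ f (0, φ u) (X, 0)) = _
    rw [hfd]
    have h5 : f (X, φ u) = (mfderiv 𝓘(ℝ, E) 𝓘(ℝ, E) φ u : E →L[ℝ] E) (v X u) := by
      change (mfderiv 𝓘(ℝ, E) 𝓘(ℝ, E) φ (φ.symm (φ u)) : E →L[ℝ] E) (v X (φ.symm (φ u))) = _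
      rw [show φ.symm (φ u) = u from extChartAt_to_inv u]
    rw [h5, hF0]
    exact h3.symm
  · intro X hX
    obtain ⟨γ, h1, h2, -, h3⟩ := hODE X hX
    exact ⟨γ, h1, h2, h3⟩

end ManifoldFlow

/-! ### Algebra of `|1|`-graded semisimple Lie algebras. -/

section OneGradings

variable {L : Type*} [LieRing L] [LieAlgebra ℝ L] (ℒ : ℤ → Submodule ℝ L) [GradedLieAlgebra ℒ]

/-- The projection to the component of degree `i`, as a linear map. -/
def grCompₗ (i : ℤ) : L →ₗ[ℝ] L where
  toFun := grComp ℒ i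
  map_add' X Y := by simp [grComp]
  map_smul' c X := by
    simp only [grComp, DirectSum.decompose_smul]
    rfl

variable {ℒ}

theorem grComp_add (i : ℤ) (X Y : L) : grComp ℒ i (X + Y) = grComp ℒ i X + grComp ℒ i Y :=
  map_add (grCompₗ ℒ i) X Y

theorem grComp_neg (i : ℤ) (X : L) : grComp ℒ i (-X) = -grComp ℒ i X :=
  map_neg (grCompₗ ℒ i) X

theorem grComp_smul (i : ℤ) (c : ℝ) (X : L) : grComp ℒ i (c • X) = c • grComp ℒ i X :=
  map_smul (grCompₗ ℒ i) c X

theorem grComp_mem (i : ℤ) (X : L) : grComp ℒ i X ∈ ℒ i := SetLike.coe_mem _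

theorem grComp_of_mem {i : ℤ} {X : L} (h : X ∈ ℒ i) : grComp ℒ i X = X :=
  DirectSum.decompose_of_mem_same ℒ h

theorem grComp_of_mem_ne {i j : ℤ} {X : L} (h : X ∈ ℒ j) (hij : j ≠ i) : grComp ℒ i X = 0 :=
  DirectSum.decompose_of_mem_ne ℒ h hij

theorem lie_mem_graded {i j k : ℤ} {X Y : L} (hX : X ∈ ℒ i) (hY : Y ∈ ℒ j) (hk : i + j = k) :
    ⁅X, Y⁆ ∈ ℒ k := hk ▸ SetLike.GradedBracket.bracket_mem hX hY

namespace IsOneGrading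

variable (h : IsOneGrading ℒ)
include h

theorem eq_zero {i : ℤ} (hi : 1 < |i|) {X : L} (hX : X ∈ ℒ i) : X = 0 := by
  rw [h.eq_bot i hi] at hX
  exact hX

theorem eq_sum (X : L) : X = grComp ℒ (-1) X + grComp ℒ 0 X + grComp ℒ 1 X := by
  induction X using DirectSum.Decomposition.inductionOn ℒ with
  | zero => simp [grComp]
  | @homogeneous i m =>
    by_cases hi : 1 < |i|
    · have : (m : L) = 0 := h.eq_zero hi m.2
      rw [this]; simp [grComp]
    · have hi' : i = -1 ∨ i = 0 ∨ i = 1 := by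
        rw [not_lt, abs_le] at hi; omega
      rcases hi' with rfl | rfl | rfl
      · rw [grComp_of_mem m.2, grComp_of_mem_ne m.2 (by norm_num),
          grComp_of_mem_ne m.2 (by norm_num)]; simp
      · rw [grComp_of_mem m.2, grComp_of_mem_ne m.2 (by norm_num),
          grComp_of_mem_ne m.2 (by norm_num)]; simp
      · rw [grComp_of_mem m.2, grComp_of_mem_ne m.2 (by norm_num),
          grComp_of_mem_ne m.2 (by norm_num)]; simp
  | add m n hm hn =>
    rw [grComp_add, grComp_add, grComp_add]
    nth_rewrite 1 [hm, hn]
    abel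

omit h [GradedLieAlgebra ℒ] in
theorem mem_filt_of_mem {i j : ℤ} (hij : i ≤ j) {X : L} (hX : X ∈ ℒ j) : X ∈ filt ℒ i :=
  Submodule.mem_iSup_of_mem j (Submodule.mem_iSup_of_mem hij hX)

omit h in
theorem grComp_of_mem_filt {i j : ℤ} (hij : j < i) {X : L} (hX : X ∈ filt ℒ i) :
    grComp ℒ j X = 0 := by
  have : filt ℒ i ≤ LinearMap.ker (grCompₗ ℒ j) :=
    iSup_le fun k => iSup_le fun hk => fun Y hY =>
      LinearMap.mem_ker.2 (grComp_of_mem_ne hY (by omega))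
  exact LinearMap.mem_ker.1 (this hX)

theorem mem_filt_zero_iff {X : L} : X ∈ filt ℒ 0 ↔ grComp ℒ (-1) X = 0 := by
  refine ⟨fun hX => grComp_of_mem_filt (by norm_num) hX, fun hX => ?_⟩
  rw [h.eq_sum X, hX, zero_add]
  exact add_mem (mem_filt_of_mem le_rfl (grComp_mem _ _))
    (mem_filt_of_mem (by norm_num) (grComp_mem _ _))

theorem lie_one_one {X Y : L} (hX : X ∈ ℒ 1) (hY : Y ∈ ℒ 1) : ⁅X, Y⁆ = 0 :=
  h.eq_zero (i := 2) (by norm_num) (lie_mem_graded hX hY (by norm_num))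

variable [Module.Finite ℝ L] (hs : LieAlgebra.IsSemisimple ℝ L)
include hs

omit h in
-- All derivations are inner, so multiplication by the degree is `ad E` for some `E`. Invariance of
-- the Killing form under `ad E` gives `(i + j) κ(X, Y) = 0`.
theorem killingForm_eq_zero {i j : ℤ} (hij : i + j ≠ 0) {X Y : L} (hX : X ∈ ℒ i) (hY : Y ∈ ℒ j) :
    killingForm ℝ L X Y = 0 := by
  obtain ⟨E, hE⟩ := LieDerivation.IsKilling.exists_eq_ad
    (LieDerivation.ofGrading ℒ (Int.castAddHom ℝ))
  have hEi : ∀ {k : ℤ} {Z : L}, Z ∈ ℒ k → ⁅E, Z⁆ = (k : ℝ) • Z := fun {k Z} hZ => by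
    have := LieDerivation.ofGrading_apply_apply ℒ (Int.castAddHom ℝ) hZ
    rw [← hE] at this
    simpa using this
  have h1 := LieModule.traceForm_apply_lie_apply ℝ L L X E Y
  rw [hEi hY, ← lie_skew, hEi hX] at h1
  simp only [map_neg, map_smul, LinearMap.neg_apply, LinearMap.smul_apply, smul_eq_mul] at h1
  have h2 : ((i : ℝ) + j) * killingForm ℝ L X Y = 0 := by
    change ((i : ℝ) + j) * LieModule.traceForm ℝ L L X Y = 0
    linarith
  exact (mul_eq_zero.1 h2).resolve_left (by exact_mod_cast hij)

omit h [GradedLieAlgebra ℒ] in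
theorem eq_zero_of_killingForm {X : L} (hX : ∀ Y, killingForm ℝ L X Y = 0) : X = 0 := by
  have : X ∈ LinearMap.ker (killingForm ℝ L) := LinearMap.mem_ker.2 (LinearMap.ext hX)
  rwa [LieAlgebra.IsKilling.ker_killingForm_eq_bot, Submodule.mem_bot] at this

omit h [GradedLieAlgebra ℒ] [Module.Finite ℝ L] in
theorem eq_zero_of_central {X : L} (hX : ∀ Y : L, ⁅X, Y⁆ = 0) : X = 0 := by
  have : X ∈ LieAlgebra.center ℝ L := by
    rw [LieModule.mem_maxTrivSubmodule]
    intro Y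
    rw [← lie_skew, hX, neg_zero]
  rwa [LieAlgebra.center_eq_bot, LieSubmodule.mem_bot] at this

/-- By invariance of the Killing form, which pairs `ℒ 1` only with `ℒ (-1)`, an element of `ℒ 0`
that kills `ℒ (-1)` also kills `ℒ 1`. Such elements therefore form an ideal inside `ℒ 0`. If it were
nonzero it would contain a minimal ideal, which is simple, against `no_simple_ideal`. -/
theorem eq_zero_of_mem_zero {X : L} (hX : X ∈ ℒ 0) (hXY : ∀ Y ∈ ℒ (-1), ⁅X, Y⁆ = 0) : X = 0 := by
  have hX1 : ∀ X ∈ ℒ 0, (∀ Y ∈ ℒ (-1), ⁅X, Y⁆ = 0) → ∀ Z ∈ ℒ 1, ⁅X, Z⁆ = 0 := by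
    intro X hX hXY Z hZ
    refine eq_zero_of_killingForm hs fun Y => ?_
    have h1 : ⁅X, Z⁆ ∈ ℒ 1 := lie_mem_graded hX hZ (by norm_num)
    rw [h.eq_sum Y, map_add, map_add, killingForm_eq_zero hs (by norm_num) h1 (grComp_mem 0 Y),
      killingForm_eq_zero hs (by norm_num) h1 (grComp_mem 1 Y), ← lie_skew]
    have h2 := LieModule.traceForm_apply_lie_apply ℝ L L Z X (grComp ℒ (-1) Y)
    rw [hXY _ (grComp_mem _ _)] at h2
    change LieModule.traceForm ℝ L L (-⁅Z, X⁆) _ + 0 + 0 = 0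
    rw [map_neg, LinearMap.neg_apply, h2]
    simp
  let I : LieIdeal ℝ L :=
    { carrier := {X | X ∈ ℒ 0 ∧ ∀ Y ∈ ℒ (-1), ⁅X, Y⁆ = 0}
      add_mem' := fun {a b} ha hb => ⟨add_mem ha.1 hb.1, fun Y hY => by
        rw [add_lie, ha.2 Y hY, hb.2 Y hY, add_zero]⟩
      zero_mem' := ⟨zero_mem _, fun Y _ => zero_lie Y⟩
      smul_mem' := fun c a ha => ⟨Submodule.smul_mem _ c ha.1, fun Y hY => by
        rw [smul_lie, ha.2 Y hY, smul_zero]⟩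
      lie_mem := fun {Y X} hX => by
        have h1 : ⁅Y, X⁆ = ⁅grComp ℒ 0 Y, X⁆ := by
          nth_rewrite 1 [h.eq_sum Y]
          rw [add_lie, add_lie, ← lie_skew (grComp ℒ (-1) Y) X, hX.2 _ (grComp_mem _ _), ← lie_skew (grComp ℒ 1 Y) X,
            hX1 X hX.1 hX.2 _ (grComp_mem _ _)]
          simp
        change ⁅Y, X⁆ ∈ ℒ 0 ∧ ∀ Z ∈ ℒ (-1), ⁅⁅Y, X⁆, Z⁆ = 0
        rw [h1]
        refine ⟨lie_mem_graded (grComp_mem 0 Y) hX.1 (by norm_num), fun Z hZ => ?_⟩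
        rw [lie_lie, hX.2 Z hZ, hX.2 _ (lie_mem_graded (grComp_mem 0 Y) hZ (by norm_num))]
        simp }
  by_contra hne
  have hI : I ≠ ⊥ := fun hbot => by
    have : X ∈ I := ⟨hX, hXY⟩
    rw [hbot, LieSubmodule.mem_bot] at this
    exact hne this
  obtain ⟨J, hJ, hJI⟩ := (eq_bot_or_exists_atom_le I).resolve_left hI
  exact h.no_simple_ideal J (LieAlgebra.IsSemisimple.isSimple_of_isAtom J hJ)
    fun Y hY => (hJI hY).1

/-- The degree derivation is `ad E` for some `E`. Expanding `[E, E] = 0` in components kills the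
parts of `E` of degree `-1` and `1`. -/
theorem exists_gradingElement : ∃ E ∈ ℒ 0, ∀ (i : ℤ), ∀ X ∈ ℒ i, ⁅E, X⁆ = (i : ℝ) • X := by
  obtain ⟨E, hE⟩ := LieDerivation.IsKilling.exists_eq_ad
    (LieDerivation.ofGrading ℒ (Int.castAddHom ℝ))
  have hEi : ∀ (k : ℤ), ∀ Z ∈ ℒ k, ⁅E, Z⁆ = (k : ℝ) • Z := fun k Z hZ => by
    have := LieDerivation.ofGrading_apply_apply ℒ (Int.castAddHom ℝ) hZ
    rw [← hE] at this
    simpa using this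
  refine ⟨E, ?_, hEi⟩
  have h0 : ⁅E, E⁆ = 0 := lie_self E
  have h1 : -grComp ℒ (-1) E + grComp ℒ 1 E = 0 := by
    nth_rewrite 2 [h.eq_sum E] at h0
    rw [lie_add, lie_add, hEi _ _ (grComp_mem _ _), hEi _ _ (grComp_mem _ _),
      hEi _ _ (grComp_mem _ _)] at h0
    simpa using h0
  have hm : grComp ℒ (-1) E = 0 := by
    have := congrArg (grComp ℒ (-1)) h1
    rw [grComp_add, grComp_neg, grComp_of_mem (grComp_mem _ _),
      grComp_of_mem_ne (grComp_mem 1 E) (by norm_num)] at this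
    simpa [grComp] using this
  have hp : grComp ℒ 1 E = 0 := by rw [hm] at h1; simpa using h1
  rw [h.eq_sum E, hm, hp]
  simpa using grComp_mem 0 E

/-- The Killing form argument shows that `Z` also commutes with `ℒ 0`. It commutes with `ℒ 1`
because there is no degree `2`, so `Z` is central. -/
theorem eq_zero_of_mem_one {Z : L} (hZ : Z ∈ ℒ 1) (hZY : ∀ Y ∈ ℒ (-1), ⁅Z, Y⁆ = 0) : Z = 0 := by
  have h0 : ∀ X ∈ ℒ 0, ⁅Z, X⁆ = 0 := by
    intro X hX
    refine eq_zero_of_killingForm hs fun Y => ?_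
    have h1 : ⁅Z, X⁆ ∈ ℒ 1 := lie_mem_graded hZ hX (by norm_num)
    rw [h.eq_sum Y, map_add, map_add, killingForm_eq_zero hs (by norm_num) h1 (grComp_mem 0 Y),
      killingForm_eq_zero hs (by norm_num) h1 (grComp_mem 1 Y), ← lie_skew]
    have h2 := LieModule.traceForm_apply_lie_apply ℝ L L X Z (grComp ℒ (-1) Y)
    rw [hZY _ (grComp_mem _ _)] at h2
    change LieModule.traceForm ℝ L L (-⁅X, Z⁆) _ + 0 + 0 = 0
    rw [map_neg, LinearMap.neg_apply, h2]
    simp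
  refine eq_zero_of_central hs fun Y => ?_
  rw [h.eq_sum Y, lie_add, lie_add, hZY _ (grComp_mem _ _), h0 _ (grComp_mem _ _),
    h.lie_one_one hZ (grComp_mem _ _)]
  simp

end IsOneGrading

/-- A grading element of a `|1|`-grading. -/
structure IsGradingElement (ℒ : ℤ → Submodule ℝ L) (E : L) : Prop where
  mem : E ∈ ℒ 0
  lie_eq : ∀ (i : ℤ), ∀ X ∈ ℒ i, ⁅E, X⁆ = (i : ℝ) • X

namespace IsOneGrading

variable (h : IsOneGrading ℒ) {E : L} (hE : IsGradingElement ℒ E)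
include h hE

/-- The graded pieces are eigenspaces of `ad E`; this turns preservation of the grading into
preservation of the single element `E`. -/
theorem mem_graded_iff {i : ℤ} (hi : |i| ≤ 1) {X : L} : X ∈ ℒ i ↔ ⁅E, X⁆ = (i : ℝ) • X := by
  refine ⟨hE.lie_eq i X, fun hX => ?_⟩
  have hX' := hX
  nth_rewrite 1 [h.eq_sum X] at hX
  rw [lie_add, lie_add, hE.lie_eq _ _ (grComp_mem _ _), hE.lie_eq _ _ (grComp_mem _ _),
    hE.lie_eq _ _ (grComp_mem _ _)] at hX
  have key : ∀ j : ℤ, |j| ≤ 1 → j ≠ i → grComp ℒ j X = 0 := by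
    intro j hj hji
    have h1 := congrArg (grComp ℒ j) hX
    rw [grComp_add, grComp_add, grComp_smul, grComp_smul, grComp_smul, grComp_smul] at h1
    have hj' : j = -1 ∨ j = 0 ∨ j = 1 := by rw [abs_le] at hj; omega
    have h2 : (j : ℝ) • grComp ℒ j X = (i : ℝ) • grComp ℒ j X := by
      rw [← h1]
      rcases hj' with rfl | rfl | rfl
      · rw [grComp_of_mem (grComp_mem _ _), grComp_of_mem_ne (grComp_mem 0 X) (by norm_num),
          grComp_of_mem_ne (grComp_mem 1 X) (by norm_num)]; simp
      · rw [grComp_of_mem (grComp_mem _ _), grComp_of_mem_ne (grComp_mem (-1) X) (by norm_num),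
          grComp_of_mem_ne (grComp_mem 1 X) (by norm_num)]; simp
      · rw [grComp_of_mem (grComp_mem _ _), grComp_of_mem_ne (grComp_mem (-1) X) (by norm_num),
          grComp_of_mem_ne (grComp_mem 0 X) (by norm_num)]; simp
    rw [← sub_eq_zero, ← sub_smul, smul_eq_zero] at h2
    refine h2.resolve_left ?_
    rw [sub_eq_zero]
    exact_mod_cast hji
  have hi' : i = -1 ∨ i = 0 ∨ i = 1 := by rw [abs_le] at hi; omega
  rw [h.eq_sum X]
  rcases hi' with rfl | rfl | rfl
  · rw [key 0 (by norm_num) (by norm_num), key 1 (by norm_num) (by norm_num)]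
    simpa using grComp_mem (-1) X
  · rw [key (-1) (by norm_num) (by norm_num), key 1 (by norm_num) (by norm_num)]
    simpa using grComp_mem 0 X
  · rw [key (-1) (by norm_num) (by norm_num), key 0 (by norm_num) (by norm_num)]
    simpa using grComp_mem 1 X

variable [Module.Finite ℝ L] (hs : LieAlgebra.IsSemisimple ℝ L)
include hs

/-- An automorphism that preserves the filtration moves the grading element within its class modulo
`ℒ 1`. -/
theorem map_gradingElement_sub_mem {A : L → L} (hA : ∀ X Y, A ⁅X, Y⁆ = ⁅A X, A Y⁆)
    (hadd : ∀ X Y, A (X + Y) = A X + A Y)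
    (hsurj : Function.Surjective A)
    (hf : ∀ i, ∀ X ∈ filt ℒ i, A X ∈ filt ℒ i) : A E - E ∈ ℒ 1 := by
  have hAE : A E ∈ filt ℒ 0 := hf 0 E (mem_filt_of_mem le_rfl hE.mem)
  have hm : grComp ℒ (-1) (A E) = 0 := h.mem_filt_zero_iff.1 hAE
  have hdec := h.eq_sum (A E)
  rw [hm, zero_add] at hdec
  have hz : grComp ℒ 0 (A E) - E = 0 := by
    refine h.eq_zero_of_mem_zero hs (sub_mem (grComp_mem _ _) hE.mem) fun Y hY => ?_
    obtain ⟨X, rfl⟩ := hsurj Y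
    -- On `L/𝔭` the grading element acts by `-1`. Applying `A`, which preserves `𝔭`, shows that `A
    -- E` also acts by `-1` there, so the degree `0` part of `A E` acts on `ℒ (-1)` as `E` does.
    have h1 : ⁅E, X⁆ + X ∈ filt ℒ 0 := by
      rw [h.mem_filt_zero_iff]
      nth_rewrite 1 [h.eq_sum X]
      rw [lie_add, lie_add, hE.lie_eq _ _ (grComp_mem _ _), hE.lie_eq _ _ (grComp_mem _ _),
        hE.lie_eq _ _ (grComp_mem _ _)]
      simp only [grComp_add, grComp_smul]
      rw [grComp_of_mem (grComp_mem _ _), grComp_of_mem_ne (grComp_mem 0 X) (by norm_num),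
        grComp_of_mem_ne (grComp_mem 1 X) (by norm_num)]
      simp
    have h2 := hf 0 _ h1
    rw [hadd, hA, h.mem_filt_zero_iff, grComp_add, grComp_of_mem hY, hdec, add_lie, grComp_add,
      grComp_of_mem (lie_mem_graded (grComp_mem 0 (A E)) hY (by norm_num)),
      grComp_of_mem_ne (lie_mem_graded (grComp_mem 1 (A E)) hY (k := 0) (by norm_num))
        (by norm_num)] at h2
    rw [sub_lie, hE.lie_eq _ _ hY]
    simpa using h2
  rw [hdec, sub_eq_zero.1 hz]
  simpa using grComp_mem 1 (A E)

omit [Module.Finite ℝ L] in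
-- `A E` and `E` have the same bracket with every homogeneous element, so their difference is
-- central and vanishes.
theorem map_gradingElement_eq {A : L → L} (hA : ∀ X Y, A ⁅X, Y⁆ = ⁅A X, A Y⁆)
    (hsmul : ∀ (c : ℝ) X, A (c • X) = c • A X)
    (hf : ∀ i, ∀ X ∈ ℒ i, ∃ Y ∈ ℒ i, A Y = X) : A E = E := by
  rw [← sub_eq_zero]
  refine eq_zero_of_central hs fun X => ?_
  have key : ∀ i, ∀ X ∈ ℒ i, ⁅A E - E, X⁆ = 0 := by
    intro i X hX
    obtain ⟨Y, hY, rfl⟩ := hf i X hX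
    rw [sub_lie, ← hA, hE.lie_eq i Y hY, hE.lie_eq i _ hX, hsmul, sub_self]
  rw [h.eq_sum X, lie_add, lie_add, key _ _ (grComp_mem _ _), key _ _ (grComp_mem _ _),
    key _ _ (grComp_mem _ _)]
  simp

omit hE in
/-- A graded automorphism that is `-1` on `ℒ (-1)` is `-1` on `ℒ 1`. -/
theorem map_eq_neg_of_mem_one {A : L → L} (hA : ∀ X Y, A ⁅X, Y⁆ = ⁅A X, A Y⁆)
    (hf : ∀ i, ∀ X ∈ ℒ i, A X ∈ ℒ i) (hneg : ∀ X ∈ ℒ (-1), A X = -X) :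
    ∀ Z ∈ ℒ 1, A Z = -Z := by
  -- The signs cancel in `-[X, Y] = A [X, Y] = [A X, -Y]`, and `ℒ 0` acts faithfully on `ℒ (-1)`.
  -- The same comparison for `ℒ 1` then leaves one sign.
  have h0 : ∀ X ∈ ℒ 0, A X = X := by
    intro X hX
    rw [← sub_eq_zero]
    refine h.eq_zero_of_mem_zero hs (sub_mem (hf 0 X hX) hX) fun Y hY => ?_
    have h1 := hA X Y
    rw [hneg _ (lie_mem_graded hX hY (by norm_num)), hneg Y hY, lie_neg, neg_inj] at h1
    rw [sub_lie, h1, sub_self]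
  intro Z hZ
  rw [← add_eq_zero_iff_eq_neg]
  refine h.eq_zero_of_mem_one hs (add_mem (hf 1 Z hZ) hZ) fun Y hY => ?_
  have h1 := hA Z Y
  rw [h0 _ (lie_mem_graded hZ hY (by norm_num)), hneg Y hY, lie_neg] at h1
  rw [add_lie, h1, add_neg_cancel]

end IsOneGrading

end OneGradings

/-! ### Left invariant fields and `Ad` as an automorphism of the Lie algebra. -/

section LieGroupExp

/-- Partial derivatives of a smooth map in a fixed direction depend smoothly on the parameter. -/
theorem ContMDiff.mfderiv_partial {E₁ E₂ E₃ : Type*} [NormedAddCommGroup E₁] [NormedSpace ℝ E₁]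
    [NormedAddCommGroup E₂] [NormedSpace ℝ E₂] [NormedAddCommGroup E₃] [NormedSpace ℝ E₃]
    {N₁ : Type*} [TopologicalSpace N₁] [ChartedSpace E₁ N₁] [IsManifold 𝓘(ℝ, E₁) ∞ N₁]
    {N₂ : Type*} [TopologicalSpace N₂] [ChartedSpace E₂ N₂] [IsManifold 𝓘(ℝ, E₂) ∞ N₂]
    {N₃ : Type*} [TopologicalSpace N₃] [ChartedSpace E₃ N₃] [IsManifold 𝓘(ℝ, E₃) ∞ N₃]
    {f : N₁ × N₂ → N₃} (hf : ContMDiff (𝓘(ℝ, E₁).prod 𝓘(ℝ, E₂)) 𝓘(ℝ, E₃) ∞ f) (a : N₂)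
    (Z : TangentSpace 𝓘(ℝ, E₂) a) :
    ContMDiff 𝓘(ℝ, E₁) 𝓘(ℝ, E₃).tangent ∞ (fun n : N₁ =>
      (⟨f (n, a), mfderiv 𝓘(ℝ, E₂) 𝓘(ℝ, E₃) (fun b => f (n, b)) a Z⟩ :
        TangentBundle 𝓘(ℝ, E₃) N₃)) := by
  let F₁ : N₁ → TangentBundle 𝓘(ℝ, E₁) N₁ × TangentBundle 𝓘(ℝ, E₂) N₂ :=
    fun n => (⟨n, 0⟩, ⟨a, Z⟩)
  have h₁ : ContMDiff 𝓘(ℝ, E₁) (𝓘(ℝ, E₁).tangent.prod 𝓘(ℝ, E₂).tangent) ∞ F₁ :=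
    (Bundle.contMDiff_zeroSection ℝ (TangentSpace 𝓘(ℝ, E₁) (M := N₁))).prodMk contMDiff_const
  have h₂ := contMDiff_equivTangentBundleProd_symm (n := ∞) (I := 𝓘(ℝ, E₁)) (I' := 𝓘(ℝ, E₂))
    (M := N₁) (M' := N₂)
  have h₃ := hf.contMDiff_tangentMap (m := ∞) (by simp)
  refine ((h₃.comp h₂).comp h₁).congr fun n => ?_
  have hd : MDifferentiableAt (𝓘(ℝ, E₁).prod 𝓘(ℝ, E₂)) 𝓘(ℝ, E₃) f (n, a) :=
    hf.mdifferentiableAt (by simp)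
  have := mfderiv_prod_eq_add_apply (v := ((0, Z) : E₁ × E₂)) hd
  have h0 : mfderiv 𝓘(ℝ, E₁) 𝓘(ℝ, E₃) (fun z : N₁ => f (z, a)) n 0 = 0 := map_zero _
  simp only [Function.comp, tangentMap, F₁]
  refine congrArg (Bundle.TotalSpace.mk (f (n, a))) ?_
  refine Eq.trans ?_ this.symm
  exact (zero_add _).symm.trans (congrArg (· + _) h0.symm)

variable {EG : Type*} [NormedAddCommGroup EG] [NormedSpace ℝ EG]
  {G : Type*} [TopologicalSpace G] [ChartedSpace EG G] [Group G] [LieGroup 𝓘(ℝ, EG) ∞ G]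

/-- The field is the partial derivative at `1` of multiplication in its second variable. -/
theorem contMDiff_mulInvariantVectorField_infty (Z : LieAlg EG G) :
    ContMDiff 𝓘(ℝ, EG) 𝓘(ℝ, EG).tangent ∞ (fun g : G =>
      (⟨g, mulInvariantVectorField (I := 𝓘(ℝ, EG)) Z g⟩ : TangentBundle 𝓘(ℝ, EG) G)) := by
  have h := ContMDiff.mfderiv_partial (contMDiff_mul 𝓘(ℝ, EG) ∞ (G := G)) 1 Z
  refine h.congr fun g => ?_
  have : ∀ (a b : G), a = b → ∀ w : EG,
      (⟨a, w⟩ : TangentBundle 𝓘(ℝ, EG) G) = (⟨b, w⟩ : TangentBundle 𝓘(ℝ, EG) G) := by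
    rintro a b rfl w; rfl
  exact this _ _ (mul_one g).symm _

/-- `Ad g W` is the partial derivative of `(g, h) ↦ g h g⁻¹` at `h = 1`. All these vectors sit over
the point `1`, where the fibre coordinate of the chart at `1` is the vector itself. -/
theorem contMDiff_Ad (W : LieAlg EG G) :
    ContMDiff (M' := EG) 𝓘(ℝ, EG) 𝓘(ℝ, EG) ∞ (fun g : G => Ad g W) := by
  have hc : ContMDiff (𝓘(ℝ, EG).prod 𝓘(ℝ, EG)) 𝓘(ℝ, EG) ∞
      (fun p : G × G => p.1 * p.2 * p.1⁻¹) :=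
    (contMDiff_fst.mul contMDiff_snd).mul contMDiff_fst.inv
  have h := ContMDiff.mfderiv_partial hc 1 W
  have hmk : ∀ (a b : G), a = b → ∀ w : EG,
      (⟨a, w⟩ : TangentBundle 𝓘(ℝ, EG) G) = (⟨b, w⟩ : TangentBundle 𝓘(ℝ, EG) G) := by
    rintro a b rfl w; rfl
  have h' : ContMDiff 𝓘(ℝ, EG) 𝓘(ℝ, EG).tangent ∞
      (fun g : G => (⟨1, Ad g W⟩ : TangentBundle 𝓘(ℝ, EG) G)) :=
    h.congr fun g => hmk _ _ (by simp) _
  intro g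
  have h2 := (Bundle.contMDiffAt_totalSpace.1 (h' g)).2
  refine h2.congr_of_eventuallyEq (Eventually.of_forall fun k => ?_)
  exact (tangentCoordChange_self (I := 𝓘(ℝ, EG)) (x := (1 : G)) (z := 1)
    (v := Ad k W) (mem_extChartAt_source (1 : G))).symm

theorem mfderiv_mul_left_mulInvariantVectorField (a g : G) (Z : LieAlg EG G) :
    mfderiv 𝓘(ℝ, EG) 𝓘(ℝ, EG) (fun b : G => a * b) g
      (mulInvariantVectorField (I := 𝓘(ℝ, EG)) Z g)
      = mulInvariantVectorField (I := 𝓘(ℝ, EG)) Z (a * g) := by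
  have hl : ∀ a : G, MDifferentiable 𝓘(ℝ, EG) 𝓘(ℝ, EG) (fun b : G => a * b) := fun a =>
    (contMDiff_mul_left (I := 𝓘(ℝ, EG)) (n := ∞) (a := a)).mdifferentiable (by simp)
  have h1 := mfderiv_comp_of_eq (x := (1 : G)) (y := g) (I := 𝓘(ℝ, EG)) (I' := 𝓘(ℝ, EG))
    (I'' := 𝓘(ℝ, EG)) (hl a g) (hl g 1) (by simp)
  have e : (fun b : G => a * b) ∘ (fun b : G => g * b) = fun b : G => (a * g) * b := by
    funext b; simp [mul_assoc]
  rw [e] at h1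
  exact (mfderiv_base_congr _ (mul_one g).symm _).trans (DFunLike.congr_fun h1 Z).symm

theorem mfderiv_conj_mulInvariantVectorField (g k : G) (Z : LieAlg EG G) :
    mfderiv 𝓘(ℝ, EG) 𝓘(ℝ, EG) (fun h : G => g * h * g⁻¹) k
      (mulInvariantVectorField (I := 𝓘(ℝ, EG)) Z k)
      = mulInvariantVectorField (I := 𝓘(ℝ, EG)) (Ad g Z) (g * k * g⁻¹) := by
  have hl : ∀ a : G, MDifferentiable 𝓘(ℝ, EG) 𝓘(ℝ, EG) (fun b : G => a * b) := fun a =>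
    (contMDiff_mul_left (I := 𝓘(ℝ, EG)) (n := ∞) (a := a)).mdifferentiable (by simp)
  have e : (fun h : G => g * h * g⁻¹) ∘ (fun b : G => k * b)
      = (fun b : G => (g * k * g⁻¹) * b) ∘ (fun h : G => g * h * g⁻¹) := by
    funext b; simp [mul_assoc]
  have h1 := mfderiv_comp_of_eq (x := (1 : G)) (y := k) (I := 𝓘(ℝ, EG)) (I' := 𝓘(ℝ, EG))
    (I'' := 𝓘(ℝ, EG)) (Ad_conj_aux (EG := EG) g k) (hl k 1) (by simp)
  have h2 := mfderiv_comp_of_eq (x := (1 : G)) (y := (1 : G)) (I := 𝓘(ℝ, EG)) (I' := 𝓘(ℝ, EG))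
    (I'' := 𝓘(ℝ, EG)) (hl (g * k * g⁻¹) 1) (Ad_conj_aux (EG := EG) g 1) (by simp)
  rw [e] at h1
  have h4 := DFunLike.congr_fun (h1.symm.trans h2) Z
  exact (mfderiv_base_congr _ (mul_one k).symm _).trans
    (h4.trans (mfderiv_base_congr _ (by simp) _))

theorem Ad_inv_Ad (g : G) (X : LieAlg EG G) : Ad g⁻¹ (Ad g X) = X := by
  rw [← Ad_mul, inv_mul_cancel, Ad_one]

theorem Ad_Ad_inv (g : G) (X : LieAlg EG G) : Ad g (Ad g⁻¹ X) = X := by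
  rw [← Ad_mul, mul_inv_cancel, Ad_one]

theorem mpullback_conj_mulInvariantVectorField (g : G) (Z : LieAlg EG G) :
    VectorField.mpullback 𝓘(ℝ, EG) 𝓘(ℝ, EG) (fun h : G => g * h * g⁻¹)
      (mulInvariantVectorField (I := 𝓘(ℝ, EG)) (Ad g Z))
      = mulInvariantVectorField (I := 𝓘(ℝ, EG)) Z := by
  funext k
  rw [VectorField.mpullback_apply, ← mfderiv_conj_mulInvariantVectorField]
  have hc := fun g : G => Ad_conj_aux (EG := EG) g
  have e1 : (fun h : G => g⁻¹ * h * (g⁻¹)⁻¹) ∘ (fun h : G => g * h * g⁻¹) = id := by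
    funext h; simp [mul_assoc]
  have e2 : (fun h : G => g * h * g⁻¹) ∘ (fun h : G => g⁻¹ * h * (g⁻¹)⁻¹) = id := by
    funext h; simp [mul_assoc]
  have h1 := mfderiv_comp k (hc g⁻¹ (g * k * g⁻¹)) (hc g k)
  have h2 := mfderiv_comp_of_eq (x := g * k * g⁻¹) (y := k) (hc g k) (hc g⁻¹ (g * k * g⁻¹))
    (by simp [mul_assoc])
  rw [e1, mfderiv_id] at h1
  rw [e2, mfderiv_id] at h2
  have hk : g⁻¹ * (g * k * g⁻¹) * (g⁻¹)⁻¹ = k := by simp [mul_assoc]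
  have hinv : (mfderiv 𝓘(ℝ, EG) 𝓘(ℝ, EG) (fun h : G => g * h * g⁻¹) k : EG →L[ℝ] EG).inverse
      = (mfderiv 𝓘(ℝ, EG) 𝓘(ℝ, EG) (fun h : G => g⁻¹ * h * (g⁻¹)⁻¹) (g * k * g⁻¹) :
        EG →L[ℝ] EG) := by
    refine ContinuousLinearMap.inverse_eq ?_ ?_
    · refine ContinuousLinearMap.ext fun v => ?_
      have h3 := DFunLike.congr_fun h2 v
      exact (mfderiv_base_congr _ hk.symm _).trans h3.symm
    · exact h1.symm
  exact (DFunLike.congr_fun hinv _).trans (DFunLike.congr_fun h1 _).symm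

/-- Conjugation pulls the left invariant field of `Ad g Z` back to that of `Z`, and pullback
commutes with the bracket of vector fields. -/
theorem Ad_lie [CompleteSpace EG] (g : G) (X Y : LieAlg EG G) : Ad g ⁅X, Y⁆ = ⁅Ad g X, Ad g Y⁆ := by
  let L := mulInvariantVectorField (I := 𝓘(ℝ, EG)) (G := G)
  have hmd : ∀ (Z : LieAlg EG G) (k : G), MDifferentiableAt 𝓘(ℝ, EG) 𝓘(ℝ, EG).tangent
      (fun g => (⟨g, L Z g⟩ : TangentBundle 𝓘(ℝ, EG) G)) k := fun Z k =>
    (contMDiff_mulInvariantVectorField_infty Z).mdifferentiableAt (by simp)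
  have hc : ContMDiffAt 𝓘(ℝ, EG) 𝓘(ℝ, EG) ∞ (fun h : G => g * h * g⁻¹) 1 :=
    ((contMDiff_const.mul contMDiff_id).mul contMDiff_const).contMDiffAt
  have h1 := VectorField.mpullback_mlieBracket (n := ∞) (hmd (Ad g X) _) (hmd (Ad g Y) _) hc
    (by rw [minSmoothness_of_isRCLikeNormedField]; exact WithTop.coe_le_coe.2 le_top)
  have h2 : VectorField.mlieBracket 𝓘(ℝ, EG) (L (Ad g X)) (L (Ad g Y)) = L ⁅Ad g X, Ad g Y⁆ :=
    (mulInvariantVector_mlieBracket (Ad g X) (Ad g Y)).symm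
  have h3 : L ⁅Ad g X, Ad g Y⁆ = L (Ad g (Ad g⁻¹ ⁅Ad g X, Ad g Y⁆)) := by rw [Ad_Ad_inv]
  rw [h2, h3, mpullback_conj_mulInvariantVectorField, mpullback_conj_mulInvariantVectorField,
    mpullback_conj_mulInvariantVectorField] at h1
  have h4 : ∀ Z : LieAlg EG G, L Z 1 = Z := fun Z => by
    have e : (fun b : G => 1 * b) = id := by funext b; simp
    change mfderiv 𝓘(ℝ, EG) 𝓘(ℝ, EG) (fun b : G => 1 * b) 1 Z = Z
    rw [e]
    exact DFunLike.congr_fun (mfderiv_id (I := 𝓘(ℝ, EG)) (x := (1 : G))) Z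
  have h5 : Ad g⁻¹ ⁅Ad g X, Ad g Y⁆ = ⁅X, Y⁆ := (h4 _).symm.trans h1
  rw [← h5, Ad_Ad_inv]

end LieGroupExp

/-! ### One-parameter subgroups and the exponential map. -/

section LieGroupExpCurve

variable {EG : Type*} [NormedAddCommGroup EG] [NormedSpace ℝ EG]
  {G : Type*} [TopologicalSpace G] [ChartedSpace EG G] [Group G] [LieGroup 𝓘(ℝ, EG) ∞ G]

omit [LieGroup 𝓘(ℝ, EG) ∞ G] in
theorem mulInvariantVectorField_at_one (Z : LieAlg EG G) :
    mulInvariantVectorField (I := 𝓘(ℝ, EG)) Z (1 : G) = Z := by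
  have e : (fun b : G => 1 * b) = id := by funext b; simp
  change mfderiv 𝓘(ℝ, EG) 𝓘(ℝ, EG) (fun b : G => 1 * b) 1 Z = Z
  rw [e]
  exact DFunLike.congr_fun (mfderiv_id (I := 𝓘(ℝ, EG)) (x := (1 : G))) Z

theorem IsMIntegralCurveOn.mul_left {γ : ℝ → G} {s : Set ℝ} {Z : LieAlg EG G}
    (hγ : IsMIntegralCurveOn γ (mulInvariantVectorField (I := 𝓘(ℝ, EG)) Z) s) (a : G) :
    IsMIntegralCurveOn (fun t => a * γ t) (mulInvariantVectorField (I := 𝓘(ℝ, EG)) Z) s :=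
  hγ.map (f := fun b => a * b)
    (fun t _ => (contMDiff_mul_left (I := 𝓘(ℝ, EG)) (n := ∞) (a := a)).mdifferentiable (by simp) _)
    (fun t _ => mfderiv_mul_left_mulInvariantVectorField a (γ t) Z)

theorem contMDiff_one_mulInvariantVectorField (Z : LieAlg EG G) :
    ContMDiff 𝓘(ℝ, EG) 𝓘(ℝ, EG).tangent 1 (fun g : G =>
      (⟨g, mulInvariantVectorField (I := 𝓘(ℝ, EG)) Z g⟩ : TangentBundle 𝓘(ℝ, EG) G)) :=
  (contMDiff_mulInvariantVectorField_infty Z).of_le (by simp)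

variable [CompleteSpace EG] [T2Space G]

/-- Left translates of one local integral curve at `1` give integral curves through every point on a
time interval of the same length, and such a uniform bound implies completeness. -/
theorem exists_isMIntegralCurve_mulInvariantVectorField (Z : LieAlg EG G) (g : G) :
    ∃ γ : ℝ → G, γ 0 = g ∧ IsMIntegralCurve γ (mulInvariantVectorField (I := 𝓘(ℝ, EG)) Z) := by
  obtain ⟨γ, h0, hγ⟩ := exists_isMIntegralCurveAt_of_contMDiffAt_boundaryless (t₀ := 0)
    (contMDiff_one_mulInvariantVectorField Z (1 : G))
  obtain ⟨ε, hε, hγ⟩ := isMIntegralCurveAt_iff'.1 hγ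
  refine exists_isMIntegralCurve_of_isMIntegralCurveOn (contMDiff_one_mulInvariantVectorField Z)
    hε (fun a => ⟨fun t => a * γ t, by simp [h0], ?_⟩) g
  have := hγ.mul_left a
  rwa [Real.ball_eq_Ioo, zero_sub, zero_add] at this

/-- The one-parameter subgroup of `G` generated by `Z`. -/
def lieCurve (Z : LieAlg EG G) : ℝ → G :=
  Classical.choose (exists_isMIntegralCurve_mulInvariantVectorField Z 1)

theorem lieCurve_zero (Z : LieAlg EG G) : lieCurve Z 0 = 1 :=
  (Classical.choose_spec (exists_isMIntegralCurve_mulInvariantVectorField Z 1)).1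

theorem isMIntegralCurve_lieCurve (Z : LieAlg EG G) :
    IsMIntegralCurve (lieCurve Z) (mulInvariantVectorField (I := 𝓘(ℝ, EG)) Z) :=
  (Classical.choose_spec (exists_isMIntegralCurve_mulInvariantVectorField Z 1)).2

theorem eq_lieCurve {Z : LieAlg EG G} {γ : ℝ → G} (h0 : γ 0 = 1)
    (hγ : IsMIntegralCurve γ (mulInvariantVectorField (I := 𝓘(ℝ, EG)) Z)) : γ = lieCurve Z :=
  isMIntegralCurve_Ioo_eq_of_contMDiff_boundaryless (t₀ := 0)
    (contMDiff_one_mulInvariantVectorField Z) hγ (isMIntegralCurve_lieCurve Z)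
    (h0.trans (lieCurve_zero Z).symm)

theorem lieCurve_add (Z : LieAlg EG G) (s t : ℝ) :
    lieCurve Z (s + t) = lieCurve Z s * lieCurve Z t := by
  have h1 := (isMIntegralCurve_lieCurve Z).comp_add s
  have h2 := ((isMIntegralCurve_lieCurve Z).isMIntegralCurveOn univ).mul_left (lieCurve Z s)
  have h3 := isMIntegralCurve_Ioo_eq_of_contMDiff_boundaryless (t₀ := 0)
    (contMDiff_one_mulInvariantVectorField Z) h1 (isMIntegralCurve_iff_isMIntegralCurveOn.2 h2)
    (by simp [lieCurve_zero])
  have := congrFun h3 t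
  simpa [add_comm] using this

theorem lieCurve_smul (Z : LieAlg EG G) (c t : ℝ) : lieCurve (c • Z) t = lieCurve Z (t * c) := by
  have h := (isMIntegralCurve_lieCurve Z).comp_mul c
  rw [← mulInvariantVectorField_smul] at h
  exact (congrFun (eq_lieCurve (by simp [lieCurve_zero]) h) t).symm

/-- The exponential map of the Lie group `G`. -/
def lieExp (Z : LieAlg EG G) : G := lieCurve Z 1

theorem lieCurve_eq_lieExp (Z : LieAlg EG G) (t : ℝ) : lieCurve Z t = lieExp (t • Z) := by
  rw [lieExp, lieCurve_smul, one_mul]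

theorem isExp_iff {Z : LieAlg EG G} {g : G} : IsExp Z g ↔ g = lieExp Z := by
  constructor
  · rintro ⟨γ, h0, hγ, rfl⟩
    rw [eq_lieCurve h0 hγ, lieExp]
  · rintro rfl
    exact ⟨lieCurve Z, lieCurve_zero Z, isMIntegralCurve_lieCurve Z, rfl⟩

theorem lieExp_zero : lieExp (0 : LieAlg EG G) = 1 := by
  have := lieCurve_eq_lieExp (0 : LieAlg EG G) 0
  rw [lieCurve_zero, smul_zero] at this
  exact this.symm

theorem lieExp_add_smul (Z : LieAlg EG G) (s t : ℝ) :
    lieExp ((s + t) • Z) = lieExp (s • Z) * lieExp (t • Z) := by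
  simp only [← lieCurve_eq_lieExp, lieCurve_add]

theorem lieExp_nsmul (Z : LieAlg EG G) (n : ℕ) : lieExp ((n : ℝ) • Z) = lieExp Z ^ n := by
  induction n with
  | zero => simp [lieExp_zero]
  | succ n ih => rw [Nat.cast_succ, lieExp_add_smul, ih, one_smul, pow_succ]

theorem lieExp_Ad (g : G) (Z : LieAlg EG G) : lieExp (Ad g Z) = g * lieExp Z * g⁻¹ :=
  (isExp_iff.1 ((isExp_iff.2 rfl : IsExp Z (lieExp Z)).conj g)).symm

omit [CompleteSpace EG] [T2Space G] in
/-- A differentiable one-parameter subgroup is an integral curve of a left invariant field. -/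
theorem isMIntegralCurve_of_map_add {Z : LieAlg EG G} {γ : ℝ → G}
    (hadd : ∀ s t, γ (s + t) = γ s * γ t)
    (h : HasMFDerivAt 𝓘(ℝ, ℝ) 𝓘(ℝ, EG) γ 0 ((1 : ℝ →L[ℝ] ℝ).smulRight (Z : EG))) :
    IsMIntegralCurve γ (mulInvariantVectorField (I := 𝓘(ℝ, EG)) Z) := by
  have h0 : γ 0 = 1 := by simpa using hadd 0 0
  intro t
  have hl := ((contMDiff_mul_left (I := 𝓘(ℝ, EG)) (n := ∞) (a := γ t)).mdifferentiable (by simp)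
    (γ 0)).hasMFDerivAt
  have h1 : HasMFDerivAt 𝓘(ℝ, ℝ) 𝓘(ℝ, ℝ) (fun t' : ℝ => -t + t') t (ContinuousLinearMap.id ℝ ℝ) :=
    ((hasFDerivAt_id (𝕜 := ℝ) t).const_add (-t)).hasMFDerivAt
  have h' : HasMFDerivAt 𝓘(ℝ, ℝ) 𝓘(ℝ, EG) γ (-t + t) ((1 : ℝ →L[ℝ] ℝ).smulRight (Z : EG)) := by
    rw [neg_add_cancel]; exact h
  have h2 := h'.comp t h1
  have h3 : HasMFDerivAt 𝓘(ℝ, ℝ) 𝓘(ℝ, EG) (γ ∘ fun t' : ℝ => -t + t') t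
      ((1 : ℝ →L[ℝ] ℝ).smulRight (Z : EG)) := h2
  have hl' : MDifferentiableAt 𝓘(ℝ, EG) 𝓘(ℝ, EG) (fun b : G => γ t * b)
    ((γ ∘ fun t' : ℝ => -t + t') t) := 
    (contMDiff_mul_left (I := 𝓘(ℝ, EG)) (n := ∞) (a := γ t)).mdifferentiable (by simp) _
  have h4 := h3.comp_curve hl'
  have e : (fun b : G => γ t * b) ∘ (γ ∘ fun t' : ℝ => -t + t') = γ := by
    funext t'
    simp [← hadd]
  have e2 : (mfderiv 𝓘(ℝ, EG) 𝓘(ℝ, EG) (fun b : G => γ t * b)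
      ((γ ∘ fun t' : ℝ => -t + t') t) : EG →L[ℝ] EG) Z
      = mulInvariantVectorField (I := 𝓘(ℝ, EG)) Z (γ t) :=
    mfderiv_base_congr _ (by simp [h0]) _
  have h5 := Eq.mp (congrArg (fun w => HasMFDerivAt 𝓘(ℝ, ℝ) 𝓘(ℝ, EG)
    ((fun b : G => γ t * b) ∘ (γ ∘ fun t' : ℝ => -t + t')) t
    ((1 : ℝ →L[ℝ] ℝ).smulRight w)) e2) h4
  exact h5.congr_of_eventuallyEq (Eventually.of_forall fun t' => (congrFun e t').symm)

theorem hasMFDerivAt_lieCurve_zero (Z : LieAlg EG G) :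
    HasMFDerivAt 𝓘(ℝ, ℝ) 𝓘(ℝ, EG) (lieCurve Z) 0 ((1 : ℝ →L[ℝ] ℝ).smulRight (Z : EG)) := by
  have h := isMIntegralCurve_lieCurve Z 0
  have e : (mulInvariantVectorField (I := 𝓘(ℝ, EG)) Z (lieCurve Z 0) : EG) = Z := by
    have h2 : ∀ g : G, g = 1 → (mulInvariantVectorField (I := 𝓘(ℝ, EG)) Z g : EG) = Z := by
      rintro _ rfl; exact mulInvariantVectorField_at_one Z
    exact h2 _ (lieCurve_zero Z)
  exact Eq.mp (congrArg (fun w : EG => HasMFDerivAt 𝓘(ℝ, ℝ) 𝓘(ℝ, EG) (lieCurve Z) 0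
    ((1 : ℝ →L[ℝ] ℝ).smulRight w)) e) h

/-- Commutation makes `t ↦ exp(tZ) exp(tW)` a one-parameter subgroup; its velocity at `0` is `Z +
W`. -/
theorem lieExp_add_of_commute {Z W : LieAlg EG G}
    (h : ∀ s t : ℝ, Commute (lieExp (s • Z)) (lieExp (t • W))) :
    lieExp (Z + W) = lieExp Z * lieExp W := by
  have hprod : HasMFDerivAt 𝓘(ℝ, ℝ) (𝓘(ℝ, EG).prod 𝓘(ℝ, EG)) (fun t => (lieCurve Z t, lieCurve W t))
      0 (((1 : ℝ →L[ℝ] ℝ).smulRight (Z : EG)).prod ((1 : ℝ →L[ℝ] ℝ).smulRight (W : EG))) :=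
    (hasMFDerivAt_lieCurve_zero Z).prodMk (hasMFDerivAt_lieCurve_zero W)
  have hm : MDifferentiableAt (𝓘(ℝ, EG).prod 𝓘(ℝ, EG)) 𝓘(ℝ, EG) (fun p : G × G => p.1 * p.2)
      (lieCurve Z 0, lieCurve W 0) :=
    (contMDiff_mul 𝓘(ℝ, EG) ∞ (G := G)).mdifferentiableAt (by simp)
  have h1 := hm.hasMFDerivAt.comp (0 : ℝ) hprod
  have h2 : IsMIntegralCurve (fun t => lieCurve Z t * lieCurve W t)
      (mulInvariantVectorField (I := 𝓘(ℝ, EG)) (Z + W)) := by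
    refine isMIntegralCurve_of_map_add (fun s t => ?_) ?_
    · simp only [lieCurve_add]
      have := h t s
      simp only [← lieCurve_eq_lieExp] at this
      rw [mul_assoc, ← mul_assoc (lieCurve Z t), this.eq]
      simp only [mul_assoc]
    · have hv : (mfderiv (𝓘(ℝ, EG).prod 𝓘(ℝ, EG)) 𝓘(ℝ, EG) (fun p : G × G => p.1 * p.2)
          (lieCurve Z 0, lieCurve W 0) : EG × EG →L[ℝ] EG) (Z, W) = (Z + W : EG) := by
        have hp : ∀ a b : G, a = 1 → b = 1 → (mfderiv (𝓘(ℝ, EG).prod 𝓘(ℝ, EG)) 𝓘(ℝ, EG)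
            (fun p : G × G => p.1 * p.2) (a, b) : EG × EG →L[ℝ] EG) (Z, W) = (Z + W : EG) := by
          rintro _ _ rfl rfl
          have h3 := mfderiv_prod_eq_add_apply (v := ((Z, W) : EG × EG))
            ((contMDiff_mul 𝓘(ℝ, EG) ∞ (G := G)).mdifferentiableAt (x := ((1 : G), (1 : G)))
              (by simp))
          refine h3.trans ?_
          have e1 : (fun z : G => z * 1) = id := by funext b; simp
          have e2 : (fun z : G => 1 * z) = id := by funext b; simp
          change (mfderiv 𝓘(ℝ, EG) 𝓘(ℝ, EG) (fun z : G => z * 1) 1 : EG →L[ℝ] EG) Z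
            + (mfderiv 𝓘(ℝ, EG) 𝓘(ℝ, EG) (fun z : G => 1 * z) 1 : EG →L[ℝ] EG) W = _
          rw [e1, e2, mfderiv_id]
          rfl
        exact hp _ _ (lieCurve_zero Z) (lieCurve_zero W)
      refine Eq.mp (congrArg (fun L : ℝ →L[ℝ] EG => HasMFDerivAt 𝓘(ℝ, ℝ) 𝓘(ℝ, EG)
        (fun t => lieCurve Z t * lieCurve W t) 0 L) ?_) h1
      refine ContinuousLinearMap.ext fun (r : ℝ) => ?_
      refine Eq.trans (b := (r • (mfderiv (𝓘(ℝ, EG).prod 𝓘(ℝ, EG)) 𝓘(ℝ, EG)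
        (fun p : G × G => p.1 * p.2)
          (lieCurve Z 0, lieCurve W 0) : EG × EG →L[ℝ] EG) (Z, W) : EG)) ?_
        (congrArg (fun w : EG => r • w) hv)
      exact (mfderiv (𝓘(ℝ, EG).prod 𝓘(ℝ, EG)) 𝓘(ℝ, EG) (fun p : G × G => p.1 * p.2)
          (lieCurve Z 0, lieCurve W 0) : EG × EG →L[ℝ] EG).map_smul r (Z, W)
  have h3 := congrFun (eq_lieCurve (by simp [lieCurve_zero]) h2) 1
  exact h3.symm

end LieGroupExpCurve

/-! ### The derivative of `Ad` at the identity is the bracket. -/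

/-- The derivative of the adjoint representation of a local Lie group in terms of the bracket of
left invariant vector fields. -/
theorem fderiv_eq_lieBracket_of_mul {E : Type*} [NormedAddCommGroup E] [NormedSpace ℝ E]
    {m : E × E → E} {b : E → E} {e w : E} (z : E) (hw : b e = w) (hm : ContDiffAt ℝ 2 m (e, e))
    (hl : ∀ᶠ y in 𝓝 e, m (e, y) = y) (hr : ∀ᶠ x in 𝓝 e, m (x, e) = x)
    (hb : DifferentiableAt ℝ b e)
    (hbm : ∀ᶠ x in 𝓝 e, fderiv ℝ m (e, x) (b x, 0) = fderiv ℝ m (x, e) (0, w)) :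
    fderiv ℝ b e z = VectorField.lieBracket ℝ (fun x => fderiv ℝ m (x, e) (0, z))
      (fun x => fderiv ℝ m (x, e) (0, w)) e := by
  subst hw
  have hm1 : DifferentiableAt ℝ m (e, e) := hm.differentiableAt (by simp)
  have hD : HasFDerivAt (fderiv ℝ m) (fderiv ℝ (fderiv ℝ m) (e, e)) (e, e) :=
    ((hm.fderiv_right (m := 1) (by norm_num)).differentiableAt (by simp)).hasFDerivAt
  set D := fderiv ℝ (fderiv ℝ m) (e, e) with hDdef
  have hsymm : ∀ v w, D v w = D w v := fun v w =>
    (hm.isSymmSndFDerivAt (by simp [minSmoothness_of_isRCLikeNormedField])).eq v w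
  have hright : ∀ v : E, HasFDerivAt (fun x => fderiv ℝ m (x, e) (0, v))
      ((D.comp (ContinuousLinearMap.inl ℝ E E)).flip (0, v)) e := by
    intro v
    have h1 : HasFDerivAt (fun x : E => (x, e)) (ContinuousLinearMap.inl ℝ E E) e :=
      hasFDerivAt_prodMk_left e e
    have h2 := (HasFDerivAt.comp (g := fderiv ℝ m) (f := fun x : E => (x, e)) e hD h1).clm_apply (hasFDerivAt_const ((0, v) : E × E) e)
    simpa using h2
  have h1 : ∀ v : E, fderiv ℝ m (e, e) (v, 0) = v := by
    intro v
    have h2 := HasFDerivAt.comp (f := fun x : E => (x, e)) e hm1.hasFDerivAt (hasFDerivAt_prodMk_left e e)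
    have h3 : HasFDerivAt (fun x => m (x, e)) (ContinuousLinearMap.id ℝ E) e :=
      (hasFDerivAt_id e).congr_of_eventuallyEq hr
    exact DFunLike.congr_fun (h2.unique h3) v
  have h1' : ∀ v : E, fderiv ℝ m (e, e) (0, v) = v := by
    intro v
    have h2 := hm1.hasFDerivAt.comp e (hasFDerivAt_prodMk_right e e)
    have h3 : HasFDerivAt (fun x => m (e, x)) (ContinuousLinearMap.id ℝ E) e :=
      (hasFDerivAt_id e).congr_of_eventuallyEq hl
    exact DFunLike.congr_fun (h2.unique h3) v
  -- Write `D` for the second derivative of `m` at `(e, e)`. Differentiating `hbm` at `e` along `z`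
  -- gives `b' z + D (0, z) (b e, 0) = D (z, 0) (0, b e)`. By the symmetry of `D` the two terms with
  -- `D` differ by exactly the bracket.
  have hleft := (hD.comp e (hasFDerivAt_prodMk_right e e)).clm_apply
    (hb.hasFDerivAt.prodMk (hasFDerivAt_const (0 : E) e))
  have h4 := DFunLike.congr_fun
    ((hleft.congr_of_eventuallyEq (hbm.mono fun x hx => hx.symm)).unique (hright (b e))) z
  have h5 : fderiv ℝ b e z + D (0, z) (b e, 0) = D (z, 0) (0, b e) := by
    simpa [h1] using h4
  rw [VectorField.lieBracket_eq]
  simp only [(hright _).fderiv, h1']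
  simp only [ContinuousLinearMap.flip_apply, ContinuousLinearMap.comp_apply,
    ContinuousLinearMap.inl_apply]
  rw [hsymm (b e, 0) (0, z), ← h5, add_sub_cancel_right]

section AdDerivative

variable {EG : Type*} [NormedAddCommGroup EG] [NormedSpace ℝ EG]
  {G : Type*} [TopologicalSpace G] [ChartedSpace EG G] [Group G] [LieGroup 𝓘(ℝ, EG) ∞ G]

/-- The multiplication of `G` in the chart at `1`. -/
def chartMul (EG G : Type*) [NormedAddCommGroup EG] [NormedSpace ℝ EG]
    [TopologicalSpace G] [ChartedSpace EG G] [Group G] (p : EG × EG) : EG :=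
  extChartAt 𝓘(ℝ, EG) (1 : G)
    ((extChartAt 𝓘(ℝ, EG) (1 : G)).symm p.1 * (extChartAt 𝓘(ℝ, EG) (1 : G)).symm p.2)

local notation "φ₁" => extChartAt 𝓘(ℝ, EG) (1 : G)

theorem contDiffAt_chartMul {x y : EG} (hx : x ∈ (φ₁).target) (hy : y ∈ (φ₁).target)
    (hxy : (φ₁).symm x * (φ₁).symm y ∈ (φ₁).source) :
    ContDiffAt ℝ ∞ (chartMul EG G) (x, y) := by
  have hs : ∀ x ∈ (φ₁).target, ContMDiffAt 𝓘(ℝ, EG) 𝓘(ℝ, EG) ∞ (φ₁).symm x := fun x hx =>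
    (contMDiffOn_extChartAt_symm (1 : G)).contMDiffAt ((isOpen_extChartAt_target 1).mem_nhds hx)
  have h1 : ContMDiffAt 𝓘(ℝ, EG × EG) 𝓘(ℝ, EG) ∞
      (fun p : EG × EG => (φ₁).symm p.1 * (φ₁).symm p.2) (x, y) :=
    ((hs x hx).comp (x, y) contDiff_fst.contMDiff.contMDiffAt).mul
      ((hs y hy).comp (x, y) contDiff_snd.contMDiff.contMDiffAt)
  have h2 : ContMDiffAt 𝓘(ℝ, EG) 𝓘(ℝ, EG) ∞ (φ₁) ((φ₁).symm x * (φ₁).symm y) :=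
    contMDiffAt_extChartAt' (by simpa only [extChartAt_source] using hxy)
  exact (h2.comp (x, y) h1).contDiffAt

theorem hasMFDerivAt_extChartAt_symm_one :
    HasMFDerivAt 𝓘(ℝ, EG) 𝓘(ℝ, EG) (φ₁).symm (φ₁ 1) (ContinuousLinearMap.id ℝ EG) := by
  have h1 := (mdifferentiableWithinAt_extChartAt_symm (I := 𝓘(ℝ, EG))
    (mem_extChartAt_target (I := 𝓘(ℝ, EG)) (1 : G))).hasMFDerivWithinAt
  rw [mfderivWithin_range_extChartAt_symm] at h1
  exact h1.hasMFDerivAt (by simp)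

/-- In the chart at `1` left invariant fields are partial derivatives of `chartMul` in its second
variable, and right invariant ones in its first; this brings the group into the form required by
`fderiv_eq_lieBracket_of_mul`. -/
theorem mfderiv_extChartAt_mul_left {x : EG} (hx : x ∈ (φ₁).target) (Z : EG) :
    (mfderiv 𝓘(ℝ, EG) 𝓘(ℝ, EG) (φ₁) ((φ₁).symm x) : EG →L[ℝ] EG)
      (mulInvariantVectorField (I := 𝓘(ℝ, EG)) Z ((φ₁).symm x))
      = fderiv ℝ (chartMul EG G) (x, φ₁ 1) (0, Z) := by
  have he : (φ₁).symm (φ₁ 1) = 1 := extChartAt_to_inv (1 : G)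
  have h1 : HasMFDerivAt 𝓘(ℝ, EG) 𝓘(ℝ, EG) (fun b : G => (φ₁).symm x * b) ((φ₁).symm (φ₁ 1))
      (mfderiv 𝓘(ℝ, EG) 𝓘(ℝ, EG) (fun b : G => (φ₁).symm x * b) ((φ₁).symm (φ₁ 1))) :=
    ((contMDiff_mul_left (I := 𝓘(ℝ, EG)) (n := ∞)).mdifferentiable (by simp) _).hasMFDerivAt
  have h2 : HasMFDerivAt 𝓘(ℝ, EG) 𝓘(ℝ, EG) (φ₁) ((φ₁).symm x * (φ₁).symm (φ₁ 1))
      (mfderiv 𝓘(ℝ, EG) 𝓘(ℝ, EG) (φ₁) ((φ₁).symm x * (φ₁).symm (φ₁ 1))) := by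
    refine (mdifferentiableAt_extChartAt ?_).hasMFDerivAt
    rw [← extChartAt_source 𝓘(ℝ, EG), he, mul_one]
    exact (φ₁).map_target hx
  have h3 := (HasMFDerivAt.comp (g := (φ₁)) (f := (fun b : G => (φ₁).symm x * b) ∘ (φ₁).symm) (φ₁ 1) h2
    (HasMFDerivAt.comp (f := (φ₁).symm) (φ₁ 1) h1 hasMFDerivAt_extChartAt_symm_one)).hasFDerivAt
  have h4 : HasFDerivAt (chartMul EG G) (fderiv ℝ (chartMul EG G) (x, φ₁ 1)) (x, φ₁ 1) :=
    ((contDiffAt_chartMul hx (mem_extChartAt_target 1)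
      (by rw [he, mul_one]; exact (φ₁).map_target hx)).differentiableAt (by simp)).hasFDerivAt
  have h5 := HasFDerivAt.comp (f := fun y : EG => (x, y)) (φ₁ 1) h4 (hasFDerivAt_prodMk_right x _)
  have h6 := DFunLike.congr_fun (h5.unique h3) Z
  refine Eq.trans ?_ h6.symm
  have h7 : (mfderiv 𝓘(ℝ, EG) 𝓘(ℝ, EG) (fun b : G => (φ₁).symm x * b) ((φ₁).symm (φ₁ 1)) :
      EG →L[ℝ] EG) Z = mulInvariantVectorField (I := 𝓘(ℝ, EG)) Z ((φ₁).symm x) :=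
    mfderiv_base_congr _ he _
  have h8 : ∀ g : G, g = (φ₁).symm x → (mfderiv 𝓘(ℝ, EG) 𝓘(ℝ, EG) (φ₁) ((φ₁).symm x) : EG →L[ℝ] EG)
      = (mfderiv 𝓘(ℝ, EG) 𝓘(ℝ, EG) (φ₁) g : EG →L[ℝ] EG) := by
    rintro _ rfl; rfl
  exact (DFunLike.congr_fun (h8 ((φ₁).symm x * (φ₁).symm (φ₁ 1)) (by rw [he, mul_one])) _).trans (congrArg _ h7.symm)

theorem mfderiv_extChartAt_mul_right {x : EG} (hx : x ∈ (φ₁).target) (Z : EG) :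
    (mfderiv 𝓘(ℝ, EG) 𝓘(ℝ, EG) (φ₁) ((φ₁).symm x) : EG →L[ℝ] EG)
      ((mfderiv 𝓘(ℝ, EG) 𝓘(ℝ, EG) (fun b : G => b * (φ₁).symm x) 1 : EG →L[ℝ] EG) Z)
      = fderiv ℝ (chartMul EG G) (φ₁ 1, x) (Z, 0) := by
  have he : (φ₁).symm (φ₁ 1) = 1 := extChartAt_to_inv (1 : G)
  have h1 : HasMFDerivAt 𝓘(ℝ, EG) 𝓘(ℝ, EG) (fun b : G => b * (φ₁).symm x) ((φ₁).symm (φ₁ 1))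
      (mfderiv 𝓘(ℝ, EG) 𝓘(ℝ, EG) (fun b : G => b * (φ₁).symm x) ((φ₁).symm (φ₁ 1))) :=
    ((contMDiff_mul_right (I := 𝓘(ℝ, EG)) (n := ∞)).mdifferentiable (by simp) _).hasMFDerivAt
  have h2 : HasMFDerivAt 𝓘(ℝ, EG) 𝓘(ℝ, EG) (φ₁) ((φ₁).symm (φ₁ 1) * (φ₁).symm x)
      (mfderiv 𝓘(ℝ, EG) 𝓘(ℝ, EG) (φ₁) ((φ₁).symm (φ₁ 1) * (φ₁).symm x)) := by
    refine (mdifferentiableAt_extChartAt ?_).hasMFDerivAt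
    rw [← extChartAt_source 𝓘(ℝ, EG), he, one_mul]
    exact (φ₁).map_target hx
  have h3 := (HasMFDerivAt.comp (g := (φ₁)) (f := (fun b : G => b * (φ₁).symm x) ∘ (φ₁).symm) (φ₁ 1) h2
    (HasMFDerivAt.comp (f := (φ₁).symm) (φ₁ 1) h1 hasMFDerivAt_extChartAt_symm_one)).hasFDerivAt
  have h4 : HasFDerivAt (chartMul EG G) (fderiv ℝ (chartMul EG G) (φ₁ 1, x)) (φ₁ 1, x) :=
    ((contDiffAt_chartMul (mem_extChartAt_target 1) hx
      (by rw [he, one_mul]; exact (φ₁).map_target hx)).differentiableAt (by simp)).hasFDerivAt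
  have h5 := HasFDerivAt.comp (f := fun y : EG => (y, x)) (φ₁ 1) h4 (hasFDerivAt_prodMk_left _ x)
  have h6 := DFunLike.congr_fun (h5.unique h3) Z
  refine Eq.trans ?_ h6.symm
  have h7 : (mfderiv 𝓘(ℝ, EG) 𝓘(ℝ, EG) (fun b : G => b * (φ₁).symm x) ((φ₁).symm (φ₁ 1)) :
      EG →L[ℝ] EG) Z
      = (mfderiv 𝓘(ℝ, EG) 𝓘(ℝ, EG) (fun b : G => b * (φ₁).symm x) 1 : EG →L[ℝ] EG) Z :=
    mfderiv_base_congr _ he _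
  have h8 : ∀ g : G, g = (φ₁).symm x → (mfderiv 𝓘(ℝ, EG) 𝓘(ℝ, EG) (φ₁) ((φ₁).symm x) : EG →L[ℝ] EG)
      = (mfderiv 𝓘(ℝ, EG) 𝓘(ℝ, EG) (φ₁) g : EG →L[ℝ] EG) := by
    rintro _ rfl; rfl
  exact (DFunLike.congr_fun (h8 ((φ₁).symm (φ₁ 1) * (φ₁).symm x) (by rw [he, one_mul])) _).trans (congrArg _ h7.symm)

/-- Right translation by `g` after conjugation by `g` is left translation by `g`. In the chart this
is the relation `hbm` between the two partial derivatives of the multiplication. -/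
theorem mfderiv_mul_right_Ad (g : G) (W : LieAlg EG G) :
    (mfderiv 𝓘(ℝ, EG) 𝓘(ℝ, EG) (fun b : G => b * g) 1 : EG →L[ℝ] EG) (Ad g W)
      = mulInvariantVectorField (I := 𝓘(ℝ, EG)) W g := by
  have hr : MDifferentiable 𝓘(ℝ, EG) 𝓘(ℝ, EG) (fun b : G => b * g) :=
    (contMDiff_mul_right (I := 𝓘(ℝ, EG)) (n := ∞) (a := g)).mdifferentiable (by simp)
  have h1 := mfderiv_comp_of_eq (x := (1 : G)) (y := (1 : G)) (I := 𝓘(ℝ, EG)) (I' := 𝓘(ℝ, EG))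
    (I'' := 𝓘(ℝ, EG)) (hr 1) (Ad_conj_aux (EG := EG) g 1) (by simp)
  have e : (fun b : G => b * g) ∘ (fun h : G => g * h * g⁻¹) = fun b : G => g * b := by
    funext b; simp
  rw [e] at h1
  have h2 := (DFunLike.congr_fun h1 W).symm
  have h3 : g * 1 * g⁻¹ = 1 := by simp
  exact (mfderiv_base_congr _ h3.symm _).trans h2

theorem mfderiv_Ad_apply [CompleteSpace EG] (W Z : LieAlg EG G) :
    (mfderiv (M' := EG) 𝓘(ℝ, EG) 𝓘(ℝ, EG) (fun g : G => Ad g W) 1 : EG →L[ℝ] EG) Z = ⁅Z, W⁆ := by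
  have he : (φ₁).symm (φ₁ 1) = 1 := extChartAt_to_inv (1 : G)
  have hT : ∀ᶠ x in 𝓝 (φ₁ 1), x ∈ (φ₁).target :=
    (isOpen_extChartAt_target (1 : G)).mem_nhds (mem_extChartAt_target (1 : G))
  let b : EG → EG := fun x => (Ad ((φ₁).symm x) W : EG)
  have hbe : b (φ₁ 1) = W := by
    change (Ad ((φ₁).symm (φ₁ 1)) W : EG) = W
    rw [he]; exact Ad_one W
  have hAd : HasMFDerivAt (M' := EG) 𝓘(ℝ, EG) 𝓘(ℝ, EG) (fun g : G => Ad g W) ((φ₁).symm (φ₁ 1))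
      (mfderiv (M' := EG) 𝓘(ℝ, EG) 𝓘(ℝ, EG) (fun g : G => Ad g W) ((φ₁).symm (φ₁ 1))) :=
    ((contMDiff_Ad W).mdifferentiable (by simp) _).hasMFDerivAt
  have hb := (hAd.comp _ hasMFDerivAt_extChartAt_symm_one).hasFDerivAt
  obtain ⟨L, hL⟩ : ∃ L : EG →L[ℝ] EG, L = (mfderiv (M' := EG) 𝓘(ℝ, EG) 𝓘(ℝ, EG)
    (fun g : G => Ad g W) ((φ₁).symm (φ₁ 1)) : EG →L[ℝ] EG) := ⟨_, rfl⟩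
  have hb' : HasFDerivAt b L (φ₁ 1) := by rw [hL]; exact hb
  have key := fderiv_eq_lieBracket_of_mul (m := chartMul EG G) (b := b) (e := φ₁ 1) (w := W) Z hbe
    ((contDiffAt_chartMul (mem_extChartAt_target 1) (mem_extChartAt_target 1)
      (by rw [he, one_mul]; exact mem_extChartAt_source 1)).of_le (WithTop.coe_le_coe.2 (le_top : (2 : ℕ∞) ≤ ⊤)))
    (hT.mono fun y hy => by simp only [chartMul, he, one_mul]; exact (φ₁).right_inv hy)
    (hT.mono fun y hy => by simp only [chartMul, he, mul_one]; exact (φ₁).right_inv hy)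
    hb'.differentiableAt
    (hT.mono fun y hy => by
      refine (mfderiv_extChartAt_mul_right hy (b y)).symm.trans (Eq.trans (congrArg _ ?_)
        (mfderiv_extChartAt_mul_left hy W))
      exact mfderiv_mul_right_Ad ((φ₁).symm y) W)
  have h8 : ∀ g : G, g = 1 → (mfderiv (M' := EG) 𝓘(ℝ, EG) 𝓘(ℝ, EG) (fun g : G => Ad g W) 1 :
      EG →L[ℝ] EG) = (mfderiv (M' := EG) 𝓘(ℝ, EG) 𝓘(ℝ, EG) (fun g : G => Ad g W) g :
      EG →L[ℝ] EG) := by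
    rintro _ rfl; rfl
  refine (DFunLike.congr_fun (h8 ((φ₁).symm (φ₁ 1)) he) (Z : EG)).trans
    (Eq.trans (b := (fderiv ℝ b (φ₁ 1) : EG →L[ℝ] EG) (Z : EG)) ?_ (key.trans ?_))
  · rw [hb'.fderiv, hL]
    rfl
  rw [GroupLieAlgebra.bracket_def, ← VectorField.mlieBracketWithin_univ,
    VectorField.mlieBracketWithin_apply, mfderiv_extChartAt_self]
  refine Eq.trans ?_ (DFunLike.congr_fun (ContinuousLinearMap.inverse_id (R := ℝ) (M := EG)) _).symm
  have hV : ∀ V : LieAlg EG G, (fun x => fderiv ℝ (chartMul EG G) (x, φ₁ 1) (0, V))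
      =ᶠ[𝓝 (φ₁ 1)] VectorField.mpullbackWithin 𝓘(ℝ, EG) 𝓘(ℝ, EG) (φ₁).symm
        (mulInvariantVectorField (I := 𝓘(ℝ, EG)) V) (range 𝓘(ℝ, EG)) := by
    intro V
    filter_upwards [hT] with x hx
    refine (mfderiv_extChartAt_mul_left hx V).symm.trans ?_
    have := ContinuousLinearMap.inverse_eq
      (mfderivWithin_extChartAt_symm_comp_mfderiv_extChartAt (I := 𝓘(ℝ, EG)) hx)
      (mfderiv_extChartAt_comp_mfderivWithin_extChartAt_symm (I := 𝓘(ℝ, EG)) hx)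
    exact (DFunLike.congr_fun this _).symm
  refine (Filter.EventuallyEq.lieBracket_vectorField_eq (𝕜 := ℝ) (hV Z) (hV W)).trans ?_
  have hS : ∀ (V₁ V₂ : EG → EG) (S : Set EG) (y : EG), S = univ →
      VectorField.lieBracket ℝ V₁ V₂ y = VectorField.lieBracketWithin ℝ V₁ V₂ S y := by
    rintro V₁ V₂ _ y rfl
    rw [VectorField.lieBracketWithin_univ]
  exact hS _ _ _ _ (by simp)

end AdDerivative

/-! ### `Ad` along one-parameter subgroups, and smoothness of `exp`. -/

section LieExpAd

variable {EG : Type*} [NormedAddCommGroup EG] [NormedSpace ℝ EG] [CompleteSpace EG]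
  {G : Type*} [TopologicalSpace G] [T2Space G] [ChartedSpace EG G] [Group G]
  [LieGroup 𝓘(ℝ, EG) ∞ G]

/-- At time `0` this is `mfderiv_Ad_apply`; elsewhere it follows by factoring `Ad(exp(tZ))` out of
`Ad(exp(sZ))`. -/
theorem hasDerivAt_Ad_lieExp (Z W : LieAlg EG G) (t : ℝ) :
    HasDerivAt (F := EG) (fun t : ℝ => Ad (lieExp (t • Z)) W) 
      (Ad (lieExp (t • Z)) (⁅Z, W⁆ : LieAlg EG G)) t := by
  have hAd : MDifferentiableAt (M' := EG) 𝓘(ℝ, EG) 𝓘(ℝ, EG) (fun g : G => Ad g W)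
      (lieCurve Z 0) := (contMDiff_Ad W).mdifferentiable (by simp) _
  have h1 := ((hasMFDerivAt_lieCurve_zero Z).comp_curve hAd).hasFDerivAt
  have h2 : HasDerivAt (F := EG) (fun t : ℝ => Ad (lieCurve Z t) W)
      (⁅Z, W⁆ : LieAlg EG G) 0 := by
    refine hasDerivAt_iff_hasFDerivAt.2 ?_
    have h8 : ∀ g : G, g = 1 → (mfderiv (M' := EG) 𝓘(ℝ, EG) 𝓘(ℝ, EG) (fun g : G => Ad g W) 1 :
        EG →L[ℝ] EG) Z = (mfderiv (M' := EG) 𝓘(ℝ, EG) 𝓘(ℝ, EG) (fun g : G => Ad g W) g :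
        EG →L[ℝ] EG) Z := by
      rintro _ rfl; rfl
    have h9 := (h8 _ (lieCurve_zero Z)).symm.trans (mfderiv_Ad_apply W Z)
    exact Eq.mp (congrArg (fun w : EG => HasFDerivAt (F := EG) (fun t : ℝ => Ad (lieCurve Z t) W)
      ((1 : ℝ →L[ℝ] ℝ).smulRight w) 0) h9) h1
  have h3 : HasDerivAt (F := EG) (fun s : ℝ => Ad (lieCurve Z (-t + s)) W)
      (⁅Z, W⁆ : LieAlg EG G) t :=
    HasDerivAt.comp_const_add (-t) t (by rw [neg_add_cancel]; exact h2)
  let A : EG →L[ℝ] EG := Ad (lieCurve Z t)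
  have h4 : HasDerivAt (fun s : ℝ => A (Ad (lieCurve Z (-t + s)) W)) (A (⁅Z, W⁆ : LieAlg EG G)) t :=
    A.hasFDerivAt.comp_hasDerivAt t h3
  have h5 : (fun s : ℝ => A (Ad (lieCurve Z (-t + s)) W)) = fun s => (Ad (lieExp (s • Z)) W : EG) := by
    funext s
    change Ad (lieCurve Z t) (Ad (lieCurve Z (-t + s)) W) = Ad (lieExp (s • Z)) W
    rw [← Ad_mul, ← lieCurve_add, add_neg_cancel_left, lieCurve_eq_lieExp]
  rw [h5] at h4
  rw [← lieCurve_eq_lieExp]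
  exact h4

/-- The curve `t ↦ Ad(exp(tZ)) W` has constant velocity `V`, so it is affine. This stands in for the
exponential series of `ad Z`, which breaks off after the linear term in the cases of interest. -/
theorem Ad_lieExp_eq_add {Z W V : LieAlg EG G} (h : ∀ t : ℝ, Ad (lieExp (t • Z)) ⁅Z, W⁆ = V) :
    Ad (lieExp Z) W = W + V := by
  obtain ⟨f, hf⟩ : ∃ f : ℝ → EG, f = fun t : ℝ => (Ad (lieExp (t • Z)) W : EG) := ⟨_, rfl⟩
  obtain ⟨v, hv⟩ : ∃ v : EG, v = V := ⟨_, rfl⟩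
  have h1 : ∀ t : ℝ, HasDerivAt f v t := by
    intro t
    rw [hf, hv, ← h t]
    exact hasDerivAt_Ad_lieExp Z W t
  have h2 : ∀ t : ℝ, HasDerivAt (fun t => f t - t • v) 0 t := by
    intro t
    have := (h1 t).sub ((hasDerivAt_id t).smul_const v)
    rwa [one_smul, sub_self] at this
  have h3 := is_const_of_deriv_eq_zero (fun t => (h2 t).differentiableAt)
    (fun t => (h2 t).deriv) 1 0
  rw [one_smul, zero_smul, sub_zero, sub_eq_iff_eq_add, hf, hv] at h3
  have h4 : Ad (lieExp ((1 : ℝ) • Z)) W = Ad (lieExp ((0 : ℝ) • Z)) W + V := h3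
  rwa [one_smul, zero_smul, lieExp_zero, Ad_one] at h4

theorem Ad_lieExp_of_lie_eq_zero {Z W : LieAlg EG G} (h : ⁅Z, W⁆ = 0) : Ad (lieExp Z) W = W := by
  rw [Ad_lieExp_eq_add (V := 0) fun t => by rw [h, map_zero], add_zero]

theorem lieExp_add_of_lie_eq_zero {Z W : LieAlg EG G} (h : ⁅Z, W⁆ = 0) :
    lieExp (Z + W) = lieExp Z * lieExp W := by
  refine lieExp_add_of_commute fun s t => ?_
  have h1 : Ad (lieExp (s • Z)) (t • W) = t • W :=
    Ad_lieExp_of_lie_eq_zero (by rw [smul_lie, lie_smul, h, smul_zero, smul_zero])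
  have h2 := lieExp_Ad (lieExp (s • Z)) (t • W)
  rw [h1] at h2
  exact (eq_mul_inv_iff_mul_eq.1 h2).symm

/-- Near `0` the exponential is the time one flow of a linear family of fields, hence smooth. Around
any `Y` it is `X ↦ exp(X / (n + 1)) ^ (n + 1)` with `n` so large that `Y / (n + 1)` is in that
region. -/
theorem contMDiff_lieExp [FiniteDimensional ℝ EG] :
    ContMDiff (M := EG) 𝓘(ℝ, EG) 𝓘(ℝ, EG) ∞ (lieExp : LieAlg EG G → G) := by
  obtain ⟨O, F, hO, h0, hF, -, -, hFγ⟩ := exists_parametric_flow_manifold (W := EG) (Q := G)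
    (fun Z g => mulInvariantVectorField (I := 𝓘(ℝ, EG)) (Z : LieAlg EG G) g)
    (fun Z W g => congrFun (mulInvariantVectorField_add (I := 𝓘(ℝ, EG)) (G := G) Z W) g)
    (fun c Z g => congrFun (mulInvariantVectorField_smul (I := 𝓘(ℝ, EG)) (G := G) c Z) g)
    (fun Z => contMDiff_mulInvariantVectorField_infty Z) (1 : G)
  have hFe : ∀ Z ∈ O, (lieExp (Z : LieAlg EG G) : G) = F Z := by
    intro Z hZ
    obtain ⟨γ, hγ0, hγ1, hγ⟩ := hFγ Z hZ
    rw [← hγ1]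
    exact isMIntegralCurveOn_Ioo_eqOn_of_contMDiff_boundaryless (M := G) (t₀ := 0) (a := -1) (b := 2)
      (by norm_num) (contMDiff_one_mulInvariantVectorField Z)
      ((isMIntegralCurve_lieCurve (Z : LieAlg EG G)).isMIntegralCurveOn _) hγ
      ((lieCurve_zero _).trans hγ0.symm) (by norm_num)
  intro Y
  have htend : Tendsto (fun n : ℕ => ((n : ℝ) + 1)⁻¹ • Y) atTop (𝓝 0) := by
    have h1 : Tendsto (fun n : ℕ => ((n : ℝ) + 1)⁻¹) atTop (𝓝 0) := by
      simpa [one_div] using tendsto_one_div_add_atTop_nhds_zero_nat (𝕜 := ℝ)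
    simpa using h1.smul_const Y
  obtain ⟨n, hn⟩ := (htend.eventually (hO.mem_nhds h0)).exists
  have h1 : ContMDiffAt 𝓘(ℝ, EG) 𝓘(ℝ, EG) ∞ (fun X : EG => F (((n : ℝ) + 1)⁻¹ • X)) Y :=
    ContMDiffAt.comp (g := F) (f := fun X : EG => ((n : ℝ) + 1)⁻¹ • X) Y
      (hF.contMDiffAt (hO.mem_nhds hn)) (contDiff_const_smul _).contMDiff.contMDiffAt
  have h2 : ContMDiffAt 𝓘(ℝ, EG) 𝓘(ℝ, EG) ∞ (fun X : EG => F (((n : ℝ) + 1)⁻¹ • X) ^ (n + 1)) Y :=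
    ContMDiffAt.comp (g := fun g : G => g ^ (n + 1)) Y (contMDiff_pow (n + 1)).contMDiffAt h1
  refine h2.congr_of_eventuallyEq ?_
  have hc : ContinuousAt (fun X : EG => ((n : ℝ) + 1)⁻¹ • X) Y :=
    (continuous_const_smul _).continuousAt
  filter_upwards [hc.preimage_mem_nhds (hO.mem_nhds hn)] with X hX
  rw [← hFe _ hX]
  have h3 : lieExp (((n + 1 : ℕ) : ℝ) • (((n : ℝ) + 1)⁻¹ • (X : LieAlg EG G)))
    = (lieExp (((n : ℝ) + 1)⁻¹ • (X : LieAlg EG G)) : G) ^ (n + 1) := lieExp_nsmul _ _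
  refine Eq.trans ?_ h3
  congr 1
  push_cast
  exact (smul_inv_smul₀ (by positivity) X).symm

end LieExpAd

/-! ### The exponential map of `P` and the splitting of `P` into `G₀` and `exp 𝔤₁`. -/

namespace IsParabolicSubgroup

section Exp

variable {EG : Type*} [NormedAddCommGroup EG] [NormedSpace ℝ EG] [FiniteDimensional ℝ EG]
  [CompleteSpace EG]
  {G : Type*} [TopologicalSpace G] [T2Space G] [ChartedSpace EG G] [Group G]
  [LieGroup 𝓘(ℝ, EG) ∞ G] {𝔤 : ℤ → Submodule ℝ (LieAlg EG G)}
  {EP : Type*} [NormedAddCommGroup EP] [NormedSpace ℝ EP] [FiniteDimensional ℝ EP]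
  {P : Subgroup G} [ChartedSpace EP P] [LieGroup 𝓘(ℝ, EP) ∞ P]
  (hP : IsParabolicSubgroup (EP := EP) 𝔤 P)
include hP

omit [FiniteDimensional ℝ EG] [T2Space G] [FiniteDimensional ℝ EP] in
theorem mfderiv_val_mulInvariantVectorField (p : P) (Y : LieAlg EP P) :
    mfderiv 𝓘(ℝ, EP) 𝓘(ℝ, EG) (Subtype.val : P → G) p
      (mulInvariantVectorField (I := 𝓘(ℝ, EP)) Y p)
      = mulInvariantVectorField (I := 𝓘(ℝ, EG))
        (mfderiv 𝓘(ℝ, EP) 𝓘(ℝ, EG) (Subtype.val : P → G) 1 Y : LieAlg EG G) (p : G) := by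
  have hι : MDifferentiable 𝓘(ℝ, EP) 𝓘(ℝ, EG) (Subtype.val : P → G) :=
    hP.contMDiff_val.mdifferentiable (by simp)
  have hl : MDifferentiable 𝓘(ℝ, EP) 𝓘(ℝ, EP) (fun b : P => p * b) :=
    (contMDiff_mul_left (I := 𝓘(ℝ, EP)) (n := ∞) (a := p)).mdifferentiable (by simp)
  have hl' : MDifferentiable 𝓘(ℝ, EG) 𝓘(ℝ, EG) (fun b : G => (p : G) * b) :=
    (contMDiff_mul_left (I := 𝓘(ℝ, EG)) (n := ∞) (a := (p : G))).mdifferentiable (by simp)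
  have h1 := mfderiv_comp_of_eq (x := (1 : P)) (y := p) (I := 𝓘(ℝ, EP)) (I' := 𝓘(ℝ, EP))
    (I'' := 𝓘(ℝ, EG)) (hι p) (hl 1) (by simp)
  have h2 := mfderiv_comp_of_eq (x := (1 : P)) (y := (1 : G)) (I := 𝓘(ℝ, EP)) (I' := 𝓘(ℝ, EG))
    (I'' := 𝓘(ℝ, EG)) (hl' 1) (hι 1) (by simp)
  have e : (Subtype.val : P → G) ∘ (fun b : P => p * b)
      = (fun b : G => (p : G) * b) ∘ (Subtype.val : P → G) := by
    funext b; simp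
  rw [e] at h1
  have h3 := DFunLike.congr_fun (h1.symm.trans h2) Y
  have h8 : ∀ q : P, q = p → ∀ w : EP,
      (mfderiv 𝓘(ℝ, EP) 𝓘(ℝ, EG) (Subtype.val : P → G) p : EP →L[ℝ] EG) w
        = (mfderiv 𝓘(ℝ, EP) 𝓘(ℝ, EG) (Subtype.val : P → G) q : EP →L[ℝ] EG) w := by
    rintro _ rfl w; rfl
  exact (h8 (p * 1) (mul_one p) _).trans h3

/-- The inclusion carries one-parameter subgroups of `P` to those of `G`. Precomposing the
exponential of `P` with a linear left inverse of the derivative of the inclusion gives a smooth map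
on all of `𝔤`; its values off `𝔭` carry no meaning. -/
theorem exists_contMDiff_exp : ∃ e : EG → P, ContMDiff 𝓘(ℝ, EG) 𝓘(ℝ, EP) ∞ e ∧
    ∀ Z : LieAlg EG G, Z ∈ filt 𝔤 0 → (e Z : G) = lieExp Z := by
  have : CompleteSpace EP := FiniteDimensional.complete ℝ EP
  let ι : EP →L[ℝ] EG := mfderiv 𝓘(ℝ, EP) 𝓘(ℝ, EG) (Subtype.val : P → G) 1
  have hι : Function.Injective ι := hP.injective_mfderiv 1
  have hcurve : ∀ Y : LieAlg EP P, ((lieExp Y : P) : G) = lieExp (ι Y : LieAlg EG G) := by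
    intro Y
    have h1 := ((isMIntegralCurve_lieCurve Y).isMIntegralCurveOn univ).map
      (f := (Subtype.val : P → G)) (v' := mulInvariantVectorField (I := 𝓘(ℝ, EG)) (ι Y : LieAlg EG G))
      (fun t _ => hP.contMDiff_val.mdifferentiable (by simp) _)
      (fun t _ => mfderiv_val_mulInvariantVectorField hP _ Y)
    have h2 := eq_lieCurve (by simp [lieCurve_zero]) (isMIntegralCurve_iff_isMIntegralCurveOn.2 h1)
    exact congrFun h2 1
  obtain ⟨j, hj⟩ := LinearMap.exists_leftInverse_of_injective (ι : EP →ₗ[ℝ] EG)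
    (LinearMap.ker_eq_bot.2 hι)
  let j' : EG →L[ℝ] EP := LinearMap.toContinuousLinearMap j
  refine ⟨fun Z => lieExp (j' Z : LieAlg EP P), ?_, fun Z hZ => ?_⟩
  · exact ContMDiff.comp (g := fun Y : EP => (lieExp (Y : LieAlg EP P) : P)) contMDiff_lieExp
      j'.contDiff.contMDiff
  · refine (hcurve (j' Z : EP)).trans ?_
    have hr : Z ∈ range ι := by
      rw [show range ι = (filt 𝔤 0 : Set (LieAlg EG G)) from hP.lieAlgebra_eq]
      exact hZ
    obtain ⟨Y, rfl⟩ := hr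
    exact congrArg (fun Y : EP => (lieExp (ι Y : LieAlg EG G) : G)) (DFunLike.congr_fun hj Y)

/-- The exponential map of `P`, extended to `𝔤`. -/
def exp (Z : LieAlg EG G) : P := Classical.choose hP.exists_contMDiff_exp Z

theorem contMDiff_exp : ContMDiff (M := EG) 𝓘(ℝ, EG) 𝓘(ℝ, EP) ∞ (hP.exp : LieAlg EG G → P) :=
  (Classical.choose_spec hP.exists_contMDiff_exp).1

theorem val_exp {Z : LieAlg EG G} (hZ : Z ∈ filt 𝔤 0) : (hP.exp Z : G) = lieExp Z :=
  (Classical.choose_spec hP.exists_contMDiff_exp).2 Z hZ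

end Exp

section Levi

variable {EG : Type*} [NormedAddCommGroup EG] [NormedSpace ℝ EG] [FiniteDimensional ℝ EG]
  [CompleteSpace EG]
  {G : Type*} [TopologicalSpace G] [T2Space G] [ChartedSpace EG G] [Group G]
  [LieGroup 𝓘(ℝ, EG) ∞ G] {𝔤 : ℤ → Submodule ℝ (LieAlg EG G)} [GradedLieAlgebra 𝔤]
  {EP : Type*} [NormedAddCommGroup EP] [NormedSpace ℝ EP] [FiniteDimensional ℝ EP]
  {P : Subgroup G} [ChartedSpace EP P] [LieGroup 𝓘(ℝ, EP) ∞ P]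
  (hP : IsParabolicSubgroup (EP := EP) 𝔤 P) (h𝔤 : IsOneGrading 𝔤)
include h𝔤

omit [FiniteDimensional ℝ EG] in
theorem Ad_lieExp_of_mem_one {Z W : LieAlg EG G} (hZ : Z ∈ 𝔤 1) (hW : W ∈ 𝔤 1) :
    Ad (lieExp Z) W = W :=
  Ad_lieExp_of_lie_eq_zero (h𝔤.lie_one_one hZ hW)

omit [FiniteDimensional ℝ EG] in
-- `[Z, E] = -Z`, and `Z` commutes with `𝔤₁`, so the exponential series stops after `-Z`.
theorem Ad_lieExp_gradingElement {E Z : LieAlg EG G} (hE : IsGradingElement 𝔤 E) (hZ : Z ∈ 𝔤 1) :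
    Ad (lieExp Z) E = E - Z := by
  rw [sub_eq_add_neg]
  refine Ad_lieExp_eq_add fun t => ?_
  have h1 : ⁅Z, E⁆ = -Z := by rw [← lie_skew, hE.lie_eq 1 Z hZ, Int.cast_one, one_smul]
  rw [h1]
  exact Ad_lieExp_of_mem_one h𝔤 (Submodule.smul_mem _ t hZ) (neg_mem hZ)

include hP

theorem exp_add {Z W : LieAlg EG G} (hZ : Z ∈ 𝔤 1) (hW : W ∈ 𝔤 1) :
    hP.exp (Z + W) = hP.exp Z * hP.exp W := by
  have h1 : ∀ Z ∈ 𝔤 1, Z ∈ filt 𝔤 0 := fun Z hZ => IsOneGrading.mem_filt_of_mem (by norm_num) hZ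
  apply Subtype.ext
  rw [Subgroup.coe_mul, hP.val_exp (h1 _ hZ), hP.val_exp (h1 _ hW), hP.val_exp (h1 _ (add_mem hZ hW))]
  exact lieExp_add_of_lie_eq_zero (h𝔤.lie_one_one hZ hW)

omit hP in
omit [FiniteDimensional ℝ EG] in
theorem lie_mem_filt_zero {Z : LieAlg EG G} (hZ : Z ∈ 𝔤 1) (X : LieAlg EG G) :
    ⁅Z, X⁆ ∈ filt 𝔤 0 := by
  rw [h𝔤.eq_sum X, lie_add, lie_add]
  exact add_mem (add_mem
    (IsOneGrading.mem_filt_of_mem le_rfl (lie_mem_graded hZ (grComp_mem _ _) (by norm_num)))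
    (IsOneGrading.mem_filt_of_mem (j := 1) (by norm_num)
      (lie_mem_graded hZ (grComp_mem _ _) (by norm_num))))
    (IsOneGrading.mem_filt_of_mem (j := 2) (by norm_num)
      (lie_mem_graded hZ (grComp_mem _ _) (by norm_num)))

/-- Along `exp(tZ) ∈ P` the velocity of `Ad(exp(tZ)) X` is `Ad(exp(tZ)) [Z, X]`. It lies in `𝔭`,
because `[Z, X]` does and `Ad P` preserves `𝔭`, so the component in `𝔤₋₁` is constant. -/
theorem grComp_Ad_lieExp {Z : LieAlg EG G} (hZ : Z ∈ 𝔤 1) (X : LieAlg EG G) :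
    grComp 𝔤 (-1) (Ad (lieExp Z) X) = grComp 𝔤 (-1) X := by
  let l : EG →ₗ[ℝ] EG := (grCompₗ 𝔤 (-1) : LieAlg EG G →ₗ[ℝ] LieAlg EG G)
  let L : EG →L[ℝ] EG := LinearMap.toContinuousLinearMap l
  have hmem : ∀ t : ℝ, (lieExp (t • Z) : G) ∈ P := fun t => by
    rw [← hP.val_exp (IsOneGrading.mem_filt_of_mem (by norm_num) (Submodule.smul_mem _ t hZ))]
    exact SetLike.coe_mem _
  have h1 : ∀ t : ℝ, HasDerivAt (fun t : ℝ => L (Ad (lieExp (t • Z)) X)) 0 t := by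
    intro t
    have h2 := L.hasFDerivAt.comp_hasDerivAt t (hasDerivAt_Ad_lieExp Z X t)
    have h3' : grComp 𝔤 (-1) (Ad (lieExp (t • Z)) ⁅Z, X⁆) = 0 :=
      IsOneGrading.grComp_of_mem_filt (by norm_num)
        (hP.Ad_mem _ (hmem t) 0 _ (lie_mem_filt_zero h𝔤 hZ X))
    have h3 : L (Ad (lieExp (t • Z)) (⁅Z, X⁆ : LieAlg EG G)) = 0 := h3'
    rw [h3] at h2
    exact h2
  have h3 := is_const_of_deriv_eq_zero (fun t => (h1 t).differentiableAt)
    (fun t => (h1 t).deriv) 1 0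
  have h4 : grComp 𝔤 (-1) (Ad (lieExp ((1 : ℝ) • Z)) X)
    = grComp 𝔤 (-1) (Ad (lieExp ((0 : ℝ) • Z)) X) := h3
  rwa [one_smul, zero_smul, lieExp_zero, Ad_one] at h4

omit h𝔤 hP in
theorem mem_filt_zero_of_mem_one {Z : LieAlg EG G} (hZ : Z ∈ 𝔤 1) : Z ∈ filt 𝔤 0 :=
  IsOneGrading.mem_filt_of_mem (by norm_num) hZ

omit h𝔤 in
theorem isExp_exp {Z : LieAlg EG G} (hZ : Z ∈ 𝔤 1) : IsExp Z (hP.exp Z : G) :=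
  isExp_iff.2 (hP.val_exp (mem_filt_zero_of_mem_one hZ))

omit h𝔤 in
theorem eq_exp {Z : LieAlg EG G} (hZ : Z ∈ 𝔤 1) {h : P} (hh : IsExp Z (h : G)) : h = hP.exp Z :=
  Subtype.ext ((isExp_iff.1 hh).trans (hP.val_exp (mem_filt_zero_of_mem_one hZ)).symm)

omit h𝔤 in
theorem exp_zero : hP.exp 0 = 1 :=
  (hP.eq_exp (zero_mem _) (isExp_iff.2 (by rw [lieExp_zero, Subgroup.coe_one]))).symm

theorem exp_neg {Z : LieAlg EG G} (hZ : Z ∈ 𝔤 1) : hP.exp (-Z) = (hP.exp Z)⁻¹ := by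
  have := hP.exp_add h𝔤 hZ (neg_mem hZ)
  rw [add_neg_cancel, hP.exp_zero] at this
  exact (inv_eq_of_mul_eq_one_right this.symm).symm

omit h𝔤 in
theorem mul_exp (g : levi 𝔤 P) {Z : LieAlg EG G} (hZ : Z ∈ 𝔤 1) :
    (g : P) * hP.exp Z = hP.exp (Ad ((g : P) : G) Z) * (g : P) := by
  rw [← mul_inv_eq_iff_eq_mul]
  refine hP.eq_exp (g.2 1 Z hZ) (isExp_iff.2 ?_)
  rw [lieExp_Ad, Subgroup.coe_mul, Subgroup.coe_mul, Subgroup.coe_inv,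
    hP.val_exp (mem_filt_zero_of_mem_one hZ)]

variable (hs : LieAlgebra.IsSemisimple ℝ (LieAlg EG G)) {E : LieAlg EG G}
  (hE : IsGradingElement 𝔤 E)
include hE

theorem Ad_exp_gradingElement {Z : LieAlg EG G} (hZ : Z ∈ 𝔤 1) :
    Ad (hP.exp Z : G) E = E - Z := by
  rw [hP.val_exp (mem_filt_zero_of_mem_one hZ)]
  exact Ad_lieExp_gradingElement h𝔤 hE hZ

omit hP in
theorem mem_levi_of_Ad_eq {g : P} (hg : Ad (g : G) E = E) : g ∈ levi 𝔤 P := by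
  intro i X hX
  by_cases hi : |i| ≤ 1
  · rw [h𝔤.mem_graded_iff hE hi]
    have h1 := congrArg (Ad (EG := EG) (g : G)) (hE.lie_eq i X hX)
    rw [Ad_lie, hg] at h1
    rw [h1]
    exact (Ad (EG := EG) (g : G)).map_smul (i : ℝ) X
  · rw [h𝔤.eq_zero (not_le.1 hi) hX, map_zero]
    exact zero_mem _

include hs

omit hP in
theorem Ad_levi_gradingElement (g : levi 𝔤 P) : Ad ((g : P) : G) E = E := by
  have : Module.Finite ℝ (LieAlg EG G) := inferInstanceAs (FiniteDimensional ℝ EG)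
  refine h𝔤.map_gradingElement_eq hE hs (A := fun X => Ad ((g : P) : G) X) (fun X Y => Ad_lie _ X Y)
    (fun c X => (Ad (EG := EG) ((g : P) : G)).map_smul c X) fun i X hX =>
      ⟨_, (g⁻¹).2 i X hX, ?_⟩
  rw [Subgroup.coe_inv, Subgroup.coe_inv]
  exact Ad_Ad_inv _ _

omit h𝔤 hP hE hs in
variable (E) in
/-- The logarithm of the `exp 𝔤₁`-part of `h ∈ P`. -/
def nilLog (h : P) : LieAlg EG G := Ad ((h⁻¹ : P) : G) E - E

/-- `Ad h⁻¹` preserves the filtration, and such an automorphism moves `E` only by an element of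
`𝔤₁`. -/
theorem nilLog_mem (h : P) : nilLog E h ∈ 𝔤 1 := by
  have : Module.Finite ℝ (LieAlg EG G) := inferInstanceAs (FiniteDimensional ℝ EG)
  exact h𝔤.map_gradingElement_sub_mem hE hs (A := fun X => Ad ((h⁻¹ : P) : G) X)
    (fun X Y => Ad_lie _ X Y) (fun X Y => map_add _ X Y)
    (fun X => ⟨Ad (h : G) X, by rw [Subgroup.coe_inv]; exact Ad_inv_Ad _ _⟩)
    (fun i X hX => hP.Ad_mem _ (SetLike.coe_mem _) i X hX)

omit h𝔤 hE hs in
variable (E) in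
/-- The `G₀`-part of `h ∈ P`. -/
def leviPart (h : P) : P := h * hP.exp (-(nilLog E h))

/-- If `h = g exp Z` with `g ∈ G₀`, then `Ad h⁻¹ E = Ad(exp(-Z)) E = E + Z`, which explains the
formula for `nilLog`. Conversely `Ad(exp Z)` sends `E + Z` back to `E`, so the remaining factor
fixes `E` and lies in `G₀`. -/
theorem leviPart_mem (h : P) : hP.leviPart E h ∈ levi 𝔤 P := by
  rw [← inv_mem_iff]
  refine mem_levi_of_Ad_eq h𝔤 hE ?_
  have hZ := hP.nilLog_mem h𝔤 hs hE h
  rw [leviPart, mul_inv_rev, hP.exp_neg h𝔤 hZ, inv_inv, Subgroup.coe_mul, Ad_mul]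
  have : Ad ((h⁻¹ : P) : G) E = E + nilLog E h := by rw [nilLog, add_sub_cancel]
  rw [this, map_add, hP.Ad_exp_gradingElement h𝔤 hE hZ, hP.val_exp (mem_filt_zero_of_mem_one hZ),
    Ad_lieExp_of_mem_one h𝔤 hZ hZ, sub_add_cancel]

theorem leviPart_mul_exp_nilLog (h : P) : hP.leviPart E h * hP.exp (nilLog E h) = h := by
  have hZ := hP.nilLog_mem h𝔤 hs hE h
  rw [leviPart, hP.exp_neg h𝔤 hZ, inv_mul_cancel_right]

/-- Invariance under `exp 𝔤₁` is what lets `leviPart` descend to `Q₀`. -/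
theorem leviPart_mul_exp (h : P) {Z : LieAlg EG G} (hZ : Z ∈ 𝔤 1) :
    hP.leviPart E (h * hP.exp Z) = hP.leviPart E h := by
  have hh := hP.nilLog_mem h𝔤 hs hE h
  have h1 : nilLog E (h * hP.exp Z) = Z + nilLog E h := by
    have : Ad ((h⁻¹ : P) : G) E = E + nilLog E h := by rw [nilLog, add_sub_cancel]
    rw [nilLog, mul_inv_rev, Subgroup.coe_mul, Ad_mul, this, ← hP.exp_neg h𝔤 hZ, map_add,
      hP.Ad_exp_gradingElement h𝔤 hE (neg_mem hZ),
      hP.val_exp (mem_filt_zero_of_mem_one (neg_mem hZ)),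
      Ad_lieExp_of_mem_one h𝔤 (neg_mem hZ) hh]
    abel
  rw [leviPart, h1, neg_add, hP.exp_add h𝔤 (neg_mem hZ) (neg_mem hh), hP.exp_neg h𝔤 hZ, mul_assoc,
    mul_inv_cancel_left, leviPart]

theorem leviPart_mul (h : P) (g : levi 𝔤 P) :
    hP.leviPart E (h * (g : P)) = hP.leviPart E h * (g : P) := by
  have hh := hP.nilLog_mem h𝔤 hs hE h
  have h1 : nilLog E (h * (g : P)) = Ad (((g⁻¹ : levi 𝔤 P) : P) : G) (nilLog E h) := by
    have : Ad ((h⁻¹ : P) : G) E = E + nilLog E h := by rw [nilLog, add_sub_cancel]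
    have h2 := Ad_levi_gradingElement h𝔤 hs hE g⁻¹
    rw [nilLog, mul_inv_rev, Subgroup.coe_mul, Ad_mul, this, map_add, ← Subgroup.coe_inv, h2,
      add_sub_cancel_left]
  rw [leviPart, h1, ← map_neg, leviPart, mul_assoc, mul_assoc]
  congr 1
  have h3 := hP.mul_exp g ((g⁻¹).2 1 _ (neg_mem hh))
  rw [h3, ← Ad_mul, ← Subgroup.coe_mul, ← Subgroup.coe_mul, mul_inv_cancel, Subgroup.coe_one,
    Subgroup.coe_one, Ad_one]

theorem leviPart_levi (g : levi 𝔤 P) : hP.leviPart E (g : P) = g := by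
  have h2 := Ad_levi_gradingElement h𝔤 hs hE g⁻¹
  rw [Subgroup.coe_inv] at h2
  rw [leviPart, nilLog, h2, sub_self, neg_zero, hP.exp_zero, mul_one]

omit hE hs h𝔤 in
-- The splitting is given by `Ad`, `exp` and the fixed vector `E`, so it is visibly smooth.
theorem contMDiff_leviPart : ContMDiff 𝓘(ℝ, EP) 𝓘(ℝ, EP) ∞ (hP.leviPart E) := by
  refine contMDiff_id.mul ?_
  have h1 : ContMDiff (M' := EG) 𝓘(ℝ, EP) 𝓘(ℝ, EG) ∞ (fun h : P => Ad ((h⁻¹ : P) : G) E) :=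
    (contMDiff_Ad E).comp (hP.contMDiff_val.comp contMDiff_id.inv)
  let E' : EG := E
  have h2 : ContMDiff (M' := EG) 𝓘(ℝ, EP) 𝓘(ℝ, EG) ∞ (fun h : P => -(nilLog E h)) :=
    ContMDiff.comp (g := fun X : EG => -(X - E'))
      (contDiff_id.sub contDiff_const).neg.contMDiff h1
  exact hP.contMDiff_exp.comp h2

end Levi

end IsParabolicSubgroup

/-! ### Invertibility of bijective operators and a flexible chain rule. -/

theorem ContinuousLinearMap.isInvertible_of_bijective {E F : Type*} [NormedAddCommGroup E]
    [NormedSpace ℝ E] [CompleteSpace E] [NormedAddCommGroup F] [NormedSpace ℝ F] [CompleteSpace F]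
    {f : E →L[ℝ] F} (hf : Function.Bijective f) : f.IsInvertible :=
  ⟨ContinuousLinearEquiv.ofBijective f (LinearMap.ker_eq_bot.2 hf.1)
    (LinearMap.range_eq_top.2 hf.2), rfl⟩

section ChainRule

variable {E₁ H₁ M₁ E₂ H₂ M₂ E₃ H₃ M₃ : Type*}
  [NormedAddCommGroup E₁] [NormedSpace ℝ E₁] [TopologicalSpace H₁] {I₁ : ModelWithCorners ℝ E₁ H₁}
  [TopologicalSpace M₁] [ChartedSpace H₁ M₁]
  [NormedAddCommGroup E₂] [NormedSpace ℝ E₂] [TopologicalSpace H₂] {I₂ : ModelWithCorners ℝ E₂ H₂}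
  [TopologicalSpace M₂] [ChartedSpace H₂ M₂]
  [NormedAddCommGroup E₃] [NormedSpace ℝ E₃] [TopologicalSpace H₃] {I₃ : ModelWithCorners ℝ E₃ H₃}
  [TopologicalSpace M₃] [ChartedSpace H₃ M₃]

/-- The chain rule for a map `h` that agrees near `a` with a composition `g ∘ f`, all tangent
spaces being identified with the model spaces. -/
theorem mfderiv_apply_of_eventuallyEq_comp {f : M₁ → M₂} {g : M₂ → M₃} {h : M₁ → M₃} {a : M₁}
    {b : M₂} (hg : MDifferentiableAt I₂ I₃ g b) (hf : MDifferentiableAt I₁ I₂ f a) (hb : f a = b)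
    (hh : h =ᶠ[𝓝 a] g ∘ f) (v : E₁) :
    (mfderiv I₁ I₃ h a : E₁ →L[ℝ] E₃) v
      = (mfderiv I₂ I₃ g b : E₂ →L[ℝ] E₃) ((mfderiv I₁ I₂ f a : E₁ →L[ℝ] E₂) v) := by
  subst hb
  have h1 := mfderiv_comp a hg hf
  have h2 : (mfderiv I₁ I₃ h a : E₁ →L[ℝ] E₃) = (mfderiv I₁ I₃ (g ∘ f) a : E₁ →L[ℝ] E₃) :=
    hh.mfderiv_eq
  exact (DFunLike.congr_fun h2 v).trans (DFunLike.congr_fun h1 v)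

end ChainRule

/-! ### Constant vector fields, the principal action, and equivariance. -/

namespace CartanGeometry

variable {EG : Type*} [NormedAddCommGroup EG] [NormedSpace ℝ EG] [FiniteDimensional ℝ EG]
  [CompleteSpace EG]
  {G : Type*} [TopologicalSpace G] [T2Space G] [ChartedSpace EG G] [Group G]
  [LieGroup 𝓘(ℝ, EG) ∞ G]
  {𝔤 : ℤ → Submodule ℝ (LieAlg EG G)}
  {EP : Type*} [NormedAddCommGroup EP] [NormedSpace ℝ EP] [FiniteDimensional ℝ EP]
  {P : Subgroup G} [ChartedSpace EP P] [LieGroup 𝓘(ℝ, EP) ∞ P]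
  {EM : Type*} [NormedAddCommGroup EM] [NormedSpace ℝ EM] [FiniteDimensional ℝ EM]
  {M : Type*} [TopologicalSpace M] [T2Space M] [ChartedSpace EM M] [IsManifold 𝓘(ℝ, EM) ∞ M]
  {EQ : Type*} [NormedAddCommGroup EQ] [NormedSpace ℝ EQ] [FiniteDimensional ℝ EQ]
  {Q : Type*} [TopologicalSpace Q] [T2Space Q] [ChartedSpace EQ Q] [IsManifold 𝓘(ℝ, EQ) ∞ Q]
  [MulAction (P)ᵐᵒᵖ Q]
  (B : CartanGeometry EG EP P EM M EQ Q)

section ConstField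

theorem form_constField (u : Q) (X : LieAlg EG G) : B.form u (B.constField X u) = X :=
  (Equiv.ofBijective _ (B.bijective_form u)).apply_symm_apply X

theorem constField_form (u : Q) (w : TangentSpace 𝓘(ℝ, EQ) u) :
    B.constField (B.form u w) u = w :=
  (Equiv.ofBijective _ (B.bijective_form u)).symm_apply_apply w

theorem eq_constField {u : Q} {w : TangentSpace 𝓘(ℝ, EQ) u} {X : LieAlg EG G}
    (h : B.form u w = X) : w = B.constField X u := by
  rw [← h, constField_form]

theorem constField_add (X Y : LieAlg EG G) (u : Q) :
    B.constField (X + Y) u = B.constField X u + B.constField Y u :=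
  (B.eq_constField (by rw [map_add, form_constField, form_constField])).symm

theorem constField_smul (c : ℝ) (X : LieAlg EG G) (u : Q) :
    B.constField (c • X) u = c • B.constField X u :=
  (B.eq_constField (by rw [map_smul, form_constField])).symm

/-- In a trivialization of `TQ` the form `ω` is a smooth family of invertible linear maps, and
inversion of operators is smooth. -/
theorem contMDiff_constField (X : LieAlg EG G) : ContMDiff 𝓘(ℝ, EQ) 𝓘(ℝ, EQ).tangent ∞
    (fun u : Q => (⟨u, B.constField X u⟩ : TangentBundle 𝓘(ℝ, EQ) Q)) := by
  have : CompleteSpace EQ := FiniteDimensional.complete ℝ EQ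
  intro u₀
  rw [Bundle.contMDiffAt_section]
  set t := trivializationAt EQ (TangentSpace 𝓘(ℝ, EQ) : Q → Type _) u₀ with ht
  let A : Q → EQ →L[ℝ] EG := fun u => (B.form u).comp (t.symmL ℝ u)
  have hb : t.baseSet ∈ 𝓝 u₀ :=
    t.open_baseSet.mem_nhds (FiberBundle.mem_baseSet_trivializationAt' u₀)
  have hA : ContMDiffAt 𝓘(ℝ, EQ) 𝓘(ℝ, EQ →L[ℝ] EG) ∞ A u₀ := by
    refine contMDiffAt_clm_of_apply fun w => ?_
    have h1 : ContMDiffAt 𝓘(ℝ, EQ) 𝓘(ℝ, EQ).tangent ∞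
        (fun u : Q => t.toOpenPartialHomeomorph.symm (u, w)) u₀ := by
      have h2 := (t.contMDiffOn_symm (n := ∞) (IB := 𝓘(ℝ, EQ))).contMDiffAt (x := (u₀, w))
        (t.open_target.mem_nhds (t.mem_target.2 (mem_of_mem_nhds hb)))
      exact ContMDiffAt.comp (f := fun u : Q => (u, w)) u₀ h2
        (contMDiffAt_id.prodMk contMDiffAt_const)
    have h3 := B.contMDiff_form.contMDiffAt.comp u₀ h1
    refine h3.congr_of_eventuallyEq ?_
    filter_upwards [hb] with u hu
    have h4 : t.toOpenPartialHomeomorph.symm (u, w) = ⟨u, t.symm u w⟩ := (t.mk_symm hu w).symm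
    change B.form u (t.symmL ℝ u w) = (fun v : TangentBundle 𝓘(ℝ, EQ) Q => (B.form v.proj v.snd : EG))
      (t.toOpenPartialHomeomorph.symm (u, w))
    rw [h4, t.symmL_apply hu]
  have hbij : ∀ u ∈ t.baseSet, Function.Bijective (A u) := fun u hu =>
    (B.bijective_form u).comp ⟨Function.LeftInverse.injective fun w => t.continuousLinearMapAt_symmL hu w,
      Function.RightInverse.surjective fun w => t.symmL_continuousLinearMapAt hu w⟩
  have hAi := ContinuousLinearMap.contMDiffAt_inverse hA
    (ContinuousLinearMap.isInvertible_of_bijective (hbij _ (mem_of_mem_nhds hb)))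
  refine (hAi.clm_apply (contMDiffAt_const (M' := EG) (c := X))).congr_of_eventuallyEq ?_
  filter_upwards [hb] with u hu
  have hinv := ContinuousLinearMap.isInvertible_of_bijective (hbij u hu)
  refine Eq.trans ?_ (congrArg (A u).inverse ?_) (b := (A u).inverse (A u (t ⟨u, B.constField X u⟩).2))
  · exact (hinv.inverse_apply_self _).symm
  · change B.form u (t.symmL ℝ u (t ⟨u, B.constField X u⟩).2) = X
    rw [t.symmL_apply hu, t.symm_apply_apply_mk hu, form_constField]

end ConstField

section Action

variable {B} {e : Bundle.Trivialization P B.proj}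

theorem smul_mem_source {u : Q} (hu : u ∈ e.source) (h : P) : u <• h ∈ e.source := by
  rw [e.mem_source] at hu ⊢
  rwa [B.proj_smul]

theorem smul_eq_symm (he : ∀ u ∈ e.source, ∀ h : P, (e (u <• h)).2 = (e u).2 * h) {u : Q}
    (hu : u ∈ e.source) (h : P) :
    u <• h = e.toOpenPartialHomeomorph.symm (B.proj u, (e u).2 * h) := by
  have h1 := e.left_inv (smul_mem_source hu h)
  rw [← h1]
  congr 1
  refine Prod.ext ?_ (he u hu h)
  exact (e.coe_fst (smul_mem_source hu h)).trans (B.proj_smul u h)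

theorem smul_mul (u : Q) (k h : P) : u <• (k * h) = u <• k <• h := by
  rw [MulOpposite.op_mul, mul_smul]

theorem smul_one' (u : Q) : u <• (1 : P) = u := by
  rw [MulOpposite.op_one, one_smul]

variable (B)
include B

theorem contMDiff_smul : ContMDiff (𝓘(ℝ, EQ).prod 𝓘(ℝ, EP)) 𝓘(ℝ, EQ) ∞
    (fun p : Q × P => p.1 <• p.2) := by
  rintro ⟨u, h⟩
  obtain ⟨e, hx, hes, het, he⟩ := B.exists_trivialization (B.proj u)
  have hu : u ∈ e.source := e.mem_source.2 hx
  have h1 : ContMDiffAt (𝓘(ℝ, EQ).prod 𝓘(ℝ, EP)) (𝓘(ℝ, EM).prod 𝓘(ℝ, EP)) ∞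
      (fun p : Q × P => (B.proj p.1, (e p.1).2 * p.2)) (u, h) := by
    have h2 : ContMDiffAt (𝓘(ℝ, EQ).prod 𝓘(ℝ, EP)) (𝓘(ℝ, EM).prod 𝓘(ℝ, EP)) ∞
        (fun p : Q × P => e p.1) (u, h) :=
      ContMDiffAt.comp (u, h) (hes.contMDiffAt (e.open_source.mem_nhds hu)) contMDiffAt_fst
    exact (B.contMDiff_proj.contMDiffAt.comp (u, h) contMDiffAt_fst).prodMk
      ((contMDiffAt_snd.comp (u, h) h2).mul contMDiffAt_snd)
  have h3 : ContMDiffAt (𝓘(ℝ, EM).prod 𝓘(ℝ, EP)) 𝓘(ℝ, EQ) ∞ e.toOpenPartialHomeomorph.symm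
      (B.proj u, (e u).2 * h) :=
    het.contMDiffAt (e.open_target.mem_nhds (e.mem_target.2 hx))
  refine (ContMDiffAt.comp (u, h) h3 h1).congr_of_eventuallyEq ?_
  filter_upwards [(e.open_source.preimage continuous_fst).mem_nhds hu] with p hp
  exact smul_eq_symm he hp p.2

theorem contMDiff_smul_right (h : P) : ContMDiff 𝓘(ℝ, EQ) 𝓘(ℝ, EQ) ∞ (fun u : Q => u <• h) :=
  B.contMDiff_smul.comp (contMDiff_id.prodMk contMDiff_const)

theorem contMDiff_orbit (u : Q) : ContMDiff 𝓘(ℝ, EP) 𝓘(ℝ, EQ) ∞ (fun h : P => u <• h) :=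
  B.contMDiff_smul.comp (contMDiff_const.prodMk contMDiff_id)

theorem exists_smul_eq {u v : Q} (h : B.proj u = B.proj v) : ∃ k : P, v = u <• k := by
  obtain ⟨e, hx, -, -, he⟩ := B.exists_trivialization (B.proj u)
  have hu : u ∈ e.source := e.mem_source.2 hx
  have hv : v ∈ e.source := e.mem_source.2 (h ▸ hx)
  refine ⟨(e u).2⁻¹ * (e v).2, ?_⟩
  rw [smul_eq_symm he hu, mul_inv_cancel_left, h]
  have h1 := e.left_inv hv
  rw [← h1]
  congr 1
  rw [h1]
  exact Prod.ext (e.coe_fst hv) rfl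

theorem smul_injective {u : Q} {k h : P} (hkh : u <• k = u <• h) : k = h := by
  obtain ⟨e, hx, -, -, he⟩ := B.exists_trivialization (B.proj u)
  have hu : u ∈ e.source := e.mem_source.2 hx
  have h1 := congrArg (fun v => (e v).2) hkh
  simp only [he u hu] at h1
  exact mul_left_cancel h1

end Action

section Equivariance

theorem mfderiv_smul_constField (h : P) (u : Q) (X : LieAlg EG G) :
    mfderiv 𝓘(ℝ, EQ) 𝓘(ℝ, EQ) (fun u' : Q => u' <• h) u (B.constField X u)
      = B.constField (Ad ((h⁻¹ : P) : G) X) (u <• h) :=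
  B.eq_constField (by rw [B.form_smul, form_constField])

theorem mfderiv_localAut_constField (φ : B.LocalAut) {u : Q} (hu : u ∈ φ.toHomeo.source)
    (X : LieAlg EG G) :
    mfderiv 𝓘(ℝ, EQ) 𝓘(ℝ, EQ) φ.toHomeo u (B.constField X u) = B.constField X (φ.toHomeo u) :=
  B.eq_constField (by rw [φ.map_form u hu, form_constField])

theorem isMIntegralCurveOn_smul {γ : ℝ → Q} {s : Set ℝ} {X : LieAlg EG G}
    (hγ : IsMIntegralCurveOn γ (B.constField X) s) (h : P) :
    IsMIntegralCurveOn (fun t => γ t <• h) (B.constField (Ad ((h⁻¹ : P) : G) X)) s :=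
  hγ.map (f := fun u' : Q => u' <• h)
    (fun t _ => (B.contMDiff_smul_right h).mdifferentiable (by simp) _)
    (fun t _ => B.mfderiv_smul_constField h (γ t) X)

theorem isMIntegralCurveOn_localAut (φ : B.LocalAut) {γ : ℝ → Q} {s : Set ℝ} {X : LieAlg EG G}
    (hγ : IsMIntegralCurveOn γ (B.constField X) s) (hs : ∀ t ∈ s, γ t ∈ φ.toHomeo.source) :
    IsMIntegralCurveOn (fun t => φ.toHomeo (γ t)) (B.constField X) s :=
  hγ.map
    (fun t ht => (φ.contMDiffOn.contMDiffAt
      (φ.toHomeo.open_source.mem_nhds (hs t ht))).mdifferentiableAt (by simp))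
    (fun t ht => B.mfderiv_localAut_constField φ (hs t ht) X)

theorem eqOn_of_isMIntegralCurveOn {γ γ' : ℝ → Q} {a b : ℝ} {X : LieAlg EG G}
    (hab : (0 : ℝ) ∈ Ioo a b)
    (hγ : IsMIntegralCurveOn γ (B.constField X) (Ioo a b))
    (hγ' : IsMIntegralCurveOn γ' (B.constField X) (Ioo a b)) (h0 : γ 0 = γ' 0) :
    EqOn γ γ' (Ioo a b) :=
  isMIntegralCurveOn_Ioo_eqOn_of_contMDiff_boundaryless hab
    ((B.contMDiff_constField X).of_le (by simp)) hγ hγ' h0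

end Equivariance

end CartanGeometry

/-! ### The tangent bundle of `M` as `Q ×_P (𝔤/𝔭)`. -/

namespace CartanGeometry

variable {EG : Type*} [NormedAddCommGroup EG] [NormedSpace ℝ EG] [FiniteDimensional ℝ EG]
  [CompleteSpace EG]
  {G : Type*} [TopologicalSpace G] [T2Space G] [ChartedSpace EG G] [Group G]
  [LieGroup 𝓘(ℝ, EG) ∞ G]
  {𝔤 : ℤ → Submodule ℝ (LieAlg EG G)}
  {EP : Type*} [NormedAddCommGroup EP] [NormedSpace ℝ EP] [FiniteDimensional ℝ EP]
  {P : Subgroup G} [ChartedSpace EP P] [LieGroup 𝓘(ℝ, EP) ∞ P]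
  {EM : Type*} [NormedAddCommGroup EM] [NormedSpace ℝ EM] [FiniteDimensional ℝ EM]
  {M : Type*} [TopologicalSpace M] [T2Space M] [ChartedSpace EM M] [IsManifold 𝓘(ℝ, EM) ∞ M]
  {EQ : Type*} [NormedAddCommGroup EQ] [NormedSpace ℝ EQ] [FiniteDimensional ℝ EQ]
  {Q : Type*} [TopologicalSpace Q] [T2Space Q] [ChartedSpace EQ Q] [IsManifold 𝓘(ℝ, EQ) ∞ Q]
  [MulAction (P)ᵐᵒᵖ Q]
  (B : CartanGeometry EG EP P EM M EQ Q)

section TangentVec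

theorem mdifferentiable_proj : MDifferentiable 𝓘(ℝ, EQ) 𝓘(ℝ, EM) B.proj :=
  B.contMDiff_proj.mdifferentiable (by simp)

theorem tangentVec_add (u : Q) (X Y : LieAlg EG G) :
    B.tangentVec u (X + Y) = B.tangentVec u X + B.tangentVec u Y := by
  rw [tangentVec, constField_add]
  exact map_add _ _ _

theorem tangentVec_smul (u : Q) (c : ℝ) (X : LieAlg EG G) :
    B.tangentVec u (c • X) = c • B.tangentVec u X := by
  rw [tangentVec, constField_smul]
  exact (mfderiv 𝓘(ℝ, EQ) 𝓘(ℝ, EM) B.proj u).map_smul c _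

theorem tangentVec_neg (u : Q) (X : LieAlg EG G) : B.tangentVec u (-X) = -B.tangentVec u X := by
  rw [← neg_one_smul ℝ X, tangentVec_smul, neg_one_smul]

/-- The bundle projection does not see right translation by `h`, which carries the constant field of
`X` to that of `Ad h⁻¹ X`. -/
theorem tangentVec_smul_Ad (u : Q) (h : P) (X : LieAlg EG G) :
    (B.tangentVec (u <• h) (Ad ((h⁻¹ : P) : G) X) : EM) = B.tangentVec u X := by
  rw [tangentVec, ← B.mfderiv_smul_constField]
  exact (mfderiv_apply_of_eventuallyEq_comp (B.mdifferentiable_proj (u <• h))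
    ((B.contMDiff_smul_right h).mdifferentiable (by simp) u) rfl
    (Eventually.of_forall fun u' => (B.proj_smul u' h).symm) _).symm

theorem exists_orbit_eq_constField (hP : IsParabolicSubgroup (EP := EP) 𝔤 P) (u : Q)
    {X : LieAlg EG G} (hX : X ∈ filt 𝔤 0) : ∃ Y : LieAlg EP P,
      (mfderiv 𝓘(ℝ, EP) 𝓘(ℝ, EG) (Subtype.val : P → G) 1 Y : EG) = X ∧
      (mfderiv 𝓘(ℝ, EP) 𝓘(ℝ, EQ) (fun h : P => u <• h) 1 Y : EQ) = B.constField X u := by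
  have hr : X ∈ range (mfderiv 𝓘(ℝ, EP) 𝓘(ℝ, EG) (Subtype.val : P → G) 1) := by
    rw [hP.lieAlgebra_eq]; exact hX
  obtain ⟨Y, hY⟩ := hr
  refine ⟨Y, hY, ?_⟩
  have h1 := (B.form_fundamental u Y).trans hY
  exact B.eq_constField h1

theorem mfderiv_proj_orbit (u : Q) (Y : LieAlg EP P) :
    (mfderiv 𝓘(ℝ, EQ) 𝓘(ℝ, EM) B.proj u : EQ →L[ℝ] EM)
      (mfderiv 𝓘(ℝ, EP) 𝓘(ℝ, EQ) (fun h : P => u <• h) 1 Y : EQ) = 0 := by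
  refine (mfderiv_apply_of_eventuallyEq_comp (h := fun _ => B.proj u) (B.mdifferentiable_proj u)
    ((B.contMDiff_orbit u).mdifferentiable (by simp) 1) (smul_one' u)
    (Eventually.of_forall fun h => (B.proj_smul u h).symm) Y).symm.trans ?_
  rw [mfderiv_const]
  rfl

theorem tangentVec_eq_zero (hP : IsParabolicSubgroup (EP := EP) 𝔤 P) (u : Q)
    {X : LieAlg EG G} (hX : X ∈ filt 𝔤 0) : B.tangentVec u X = 0 := by
  obtain ⟨Y, -, hY⟩ := B.exists_orbit_eq_constField hP u hX
  exact (congrArg (mfderiv 𝓘(ℝ, EQ) 𝓘(ℝ, EM) B.proj u) hY.symm).trans (B.mfderiv_proj_orbit u Y)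

theorem exists_tangentVec_eq (u : Q) (ξ : TangentSpace 𝓘(ℝ, EM) (B.proj u)) :
    ∃ X : LieAlg EG G, B.tangentVec u X = ξ := by
  obtain ⟨e, hx, hes, het, he⟩ := B.exists_trivialization (B.proj u)
  have hu : u ∈ e.source := e.mem_source.2 hx
  let s : M → Q := fun y => e.toOpenPartialHomeomorph.symm (y, (e u).2)
  have hs : ContMDiffAt 𝓘(ℝ, EM) 𝓘(ℝ, EQ) ∞ s (B.proj u) :=
    ContMDiffAt.comp (f := fun y : M => (y, (e u).2)) (B.proj u)
      (het.contMDiffAt (e.open_target.mem_nhds (e.mem_target.2 hx)))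
      (contMDiffAt_id.prodMk contMDiffAt_const)
  have hsu : s (B.proj u) = u := by
    have h1 : (B.proj u, (e u).2) = e u := Prod.ext (e.coe_fst hu).symm rfl
    change e.toOpenPartialHomeomorph.symm (B.proj u, (e u).2) = u
    rw [h1]
    exact e.left_inv hu
  let w : TangentSpace 𝓘(ℝ, EQ) u := (mfderiv 𝓘(ℝ, EM) 𝓘(ℝ, EQ) s (B.proj u) ξ : EQ)
  refine ⟨B.form u w, ?_⟩
  rw [tangentVec, B.constField_form]
  refine (mfderiv_apply_of_eventuallyEq_comp (h := id) (B.mdifferentiable_proj u)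
    (hs.mdifferentiableAt (by simp)) hsu ?_ ξ).symm.trans ?_
  · filter_upwards [e.open_baseSet.mem_nhds hx] with y hy
    have h5 : (y, (e u).2) ∈ e.target := e.mem_target.2 hy
    exact (e.proj_symm_apply h5).symm
  · rw [mfderiv_id]
    rfl

/-- In a trivialization a vertical vector has only a component tangent to `P`; left translation by
the inverse of the fibre coordinate of `u` moves it to `T₁P`. -/
theorem exists_orbit_eq_of_mfderiv_proj_eq_zero (u : Q) (w : EQ)
    (hw : (mfderiv 𝓘(ℝ, EQ) 𝓘(ℝ, EM) B.proj u : EQ →L[ℝ] EM) w = 0) :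
    ∃ Y : LieAlg EP P, (mfderiv 𝓘(ℝ, EP) 𝓘(ℝ, EQ) (fun h : P => u <• h) 1 Y : EQ) = w := by
  obtain ⟨e, hx, hes, het, he⟩ := B.exists_trivialization (B.proj u)
  have hu : u ∈ e.source := e.mem_source.2 hx
  set k : P := (e u).2 with hk
  have heu : MDifferentiableAt 𝓘(ℝ, EQ) (𝓘(ℝ, EM).prod 𝓘(ℝ, EP)) e u :=
    (hes.contMDiffAt (e.open_source.mem_nhds hu)).mdifferentiableAt (by simp)
  have hsy : MDifferentiableAt (𝓘(ℝ, EM).prod 𝓘(ℝ, EP)) 𝓘(ℝ, EQ) e.toOpenPartialHomeomorph.symm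
      (B.proj u, k) :=
    (het.contMDiffAt (e.open_target.mem_nhds (e.mem_target.2 hx))).mdifferentiableAt (by simp)
  have heuk : e u = (B.proj u, k) := Prod.ext (e.coe_fst hu) rfl
  let p : EM × EP := mfderiv 𝓘(ℝ, EQ) (𝓘(ℝ, EM).prod 𝓘(ℝ, EP)) e u w
  have h1 : w = (mfderiv (𝓘(ℝ, EM).prod 𝓘(ℝ, EP)) 𝓘(ℝ, EQ) e.toOpenPartialHomeomorph.symm
      (B.proj u, k) : EM × EP →L[ℝ] EQ) p := by
    have h2 := mfderiv_apply_of_eventuallyEq_comp (h := id) hsy heu heuk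
      (by filter_upwards [e.open_source.mem_nhds hu] with v hv using (e.left_inv hv).symm) w
    rw [mfderiv_id] at h2
    exact h2
  have hp1 : p.1 = 0 := by
    have h4 := mfderiv_apply_of_eventuallyEq_comp (I₃ := 𝓘(ℝ, EM)) (h := B.proj)
      (g := (Prod.fst : M × P → M)) mdifferentiableAt_fst heu heuk
      (by filter_upwards [e.open_source.mem_nhds hu] with v hv using (e.coe_fst hv).symm) w
    rw [mfderiv_fst] at h4
    exact h4.symm.trans hw
  have h6 := mfderiv_prod_eq_add_apply (v := p) hsy
  have h7 : w = (mfderiv 𝓘(ℝ, EP) 𝓘(ℝ, EQ) (fun b => e.toOpenPartialHomeomorph.symm (B.proj u, b)) k :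
      EP →L[ℝ] EQ) p.2 := by
    refine h1.trans (h6.trans ?_)
    rw [hp1]
    exact (congrArg (· + _) (map_zero _)).trans (zero_add _)
  have h9 := mfderiv_apply_of_eventuallyEq_comp (a := k)
    (h := fun b => e.toOpenPartialHomeomorph.symm (B.proj u, b)) (f := fun b : P => k⁻¹ * b)
    ((B.contMDiff_orbit u).mdifferentiable (by simp) 1)
    ((contMDiff_mul_left (I := 𝓘(ℝ, EP)) (n := ∞) (a := k⁻¹)).mdifferentiable (by simp) k)
    (inv_mul_cancel k)
    (Eventually.of_forall fun b => by
      rw [Function.comp, smul_eq_symm he hu, mul_inv_cancel_left]) p.2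
  exact ⟨_, h9.symm.trans h7.symm⟩

/-- A vertical vector is fundamental, and `ω` sends fundamental vectors into `𝔭`. With
`tangentVec_eq_zero`, the kernel of `X ↦ ⟦u, X⟧` is exactly `𝔭`. -/
theorem mem_filt_of_tangentVec_eq_zero (hP : IsParabolicSubgroup (EP := EP) 𝔤 P) (u : Q)
    {X : LieAlg EG G} (hX : B.tangentVec u X = 0) : X ∈ filt 𝔤 0 := by
  obtain ⟨Y, hY⟩ := B.exists_orbit_eq_of_mfderiv_proj_eq_zero u (B.constField X u) hX
  have h1 := B.form_fundamental u Y
  have h2 : mfderiv 𝓘(ℝ, EP) 𝓘(ℝ, EG) (Subtype.val : P → G) 1 Y ∈ (filt 𝔤 0 : Set (LieAlg EG G)) := by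
    rw [← hP.lieAlgebra_eq]; exact mem_range_self Y
  have h3 : ∀ w : EQ, w = B.constField X u → (B.form u : EQ →L[ℝ] EG) w = X := by
    rintro _ rfl; exact B.form_constField u X
  have h4 : X = (mfderiv 𝓘(ℝ, EP) 𝓘(ℝ, EG) (Subtype.val : P → G) 1 Y : EG) := (h3 _ hY).symm.trans h1
  rw [h4]
  exact h2

end TangentVec

end CartanGeometry

/-! ### The bundle `Q₀` and Weyl structures built from local sections. -/

namespace CartanGeometry

variable {EG : Type*} [NormedAddCommGroup EG] [NormedSpace ℝ EG] [FiniteDimensional ℝ EG]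
  [CompleteSpace EG]
  {G : Type*} [TopologicalSpace G] [T2Space G] [ChartedSpace EG G] [Group G]
  [LieGroup 𝓘(ℝ, EG) ∞ G]
  {𝔤 : ℤ → Submodule ℝ (LieAlg EG G)}
  {EP : Type*} [NormedAddCommGroup EP] [NormedSpace ℝ EP] [FiniteDimensional ℝ EP]
  {P : Subgroup G} [ChartedSpace EP P] [LieGroup 𝓘(ℝ, EP) ∞ P]
  {EM : Type*} [NormedAddCommGroup EM] [NormedSpace ℝ EM] [FiniteDimensional ℝ EM]
  {M : Type*} [TopologicalSpace M] [T2Space M] [ChartedSpace EM M] [IsManifold 𝓘(ℝ, EM) ∞ M]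
  {EQ : Type*} [NormedAddCommGroup EQ] [NormedSpace ℝ EQ] [FiniteDimensional ℝ EQ]
  {Q : Type*} [TopologicalSpace Q] [T2Space Q] [ChartedSpace EQ Q] [IsManifold 𝓘(ℝ, EQ) ∞ Q]
  [MulAction (P)ᵐᵒᵖ Q]
  [GradedLieAlgebra 𝔤]
  (B : CartanGeometry EG EP P EM M EQ Q)
  (hP : IsParabolicSubgroup (EP := EP) 𝔤 P) (h𝔤 : IsOneGrading 𝔤)

section UnderlyingBundle

variable {B}
include hP

theorem expRel_iff {u v : Q} : B.ExpRel 𝔤 u v ↔ ∃ Z ∈ 𝔤 1, v = u <• hP.exp Z := by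
  constructor
  · rintro ⟨h, ⟨Z, hZ, hh⟩, rfl⟩
    exact ⟨Z, hZ, by rw [hP.eq_exp hZ hh]⟩
  · rintro ⟨Z, hZ, rfl⟩
    exact ⟨hP.exp Z, ⟨Z, hZ, hP.isExp_exp hZ⟩, rfl⟩

include h𝔤

/-- `exp` is additive on `𝔤₁`, so `exp 𝔤₁` is a group and `ExpRel` is already an equivalence
relation; the quotient makes no further identifications. -/
theorem π_eq_iff {u v : Q} : B.π 𝔤 u = B.π 𝔤 v ↔ ∃ Z ∈ 𝔤 1, v = u <• hP.exp Z := by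
  rw [← expRel_iff (B := B) hP]
  have heq : Equivalence (B.ExpRel 𝔤) := by
    refine ⟨fun u => ?_, fun {u v} h => ?_, fun {u v w} h k => ?_⟩
    · exact (expRel_iff hP).2 ⟨0, zero_mem _, by rw [hP.exp_zero, smul_one']⟩
    · obtain ⟨Z, hZ, rfl⟩ := (expRel_iff hP).1 h
      exact (expRel_iff hP).2 ⟨-Z, neg_mem hZ, by
        rw [← smul_mul, hP.exp_neg h𝔤 hZ, mul_inv_cancel, smul_one']⟩
    · obtain ⟨Z, hZ, rfl⟩ := (expRel_iff hP).1 h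
      obtain ⟨W, hW, rfl⟩ := (expRel_iff hP).1 k
      exact (expRel_iff hP).2 ⟨Z + W, add_mem hZ hW, by rw [hP.exp_add h𝔤 hZ hW, smul_mul]⟩
  constructor
  · intro h
    have := Quot.eqvGen_exact h
    rwa [heq.eqvGen_iff] at this
  · exact fun h => Quot.sound h

theorem π_smul_exp (u : Q) {Z : LieAlg EG G} (hZ : Z ∈ 𝔤 1) : B.π 𝔤 (u <• hP.exp Z) = B.π 𝔤 u :=
  ((π_eq_iff hP h𝔤).2 ⟨Z, hZ, rfl⟩).symm

variable (hs : LieAlgebra.IsSemisimple ℝ (LieAlg EG G)) {E : LieAlg EG G}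
  (hE : IsGradingElement 𝔤 E)
include hs hE

theorem π_smul (u : Q) (h : P) : B.π 𝔤 (u <• h) = B.π 𝔤 (u <• hP.leviPart E h) := by
  have h1 := hP.leviPart_mul_exp_nilLog h𝔤 hs hE h
  conv_lhs => rw [← h1, smul_mul]
  exact π_smul_exp hP h𝔤 _ (hP.nilLog_mem h𝔤 hs hE h)

/-- A Weyl structure is determined by its values over a local section. -/
theorem WeylStructure.apply_π_smul (σ : B.WeylStructure 𝔤) {v : Q} (hv : B.proj v ∈ σ.dom)
    (h1 : σ.toFun (B.π 𝔤 v) = v) (h : P) :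
    σ.toFun (B.π 𝔤 (v <• h)) = v <• hP.leviPart E h := by
  rw [π_smul hP h𝔤 hs hE]
  have := σ.equivariant (B.π 𝔤 v) hv ⟨hP.leviPart E h, hP.leviPart_mem h𝔤 hs hE h⟩
  rw [h1] at this
  exact this

theorem WeylStructure.eq_of_section {σ τ : B.WeylStructure 𝔤} {S : M → Q} {y : M}
    (hS : B.proj (S y) = y)
    (hσ : y ∈ σ.dom) (hτ : y ∈ τ.dom) (hσS : σ.toFun (B.π 𝔤 (S y)) = S y)
    (hτS : τ.toFun (B.π 𝔤 (S y)) = S y) {b : B.Q₀ 𝔤} (hb : B.proj₀ 𝔤 b = y) :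
    σ.toFun b = τ.toFun b := by
  obtain ⟨v, rfl⟩ : ∃ v, B.π 𝔤 v = b := Quot.exists_rep b
  obtain ⟨k, rfl⟩ := B.exists_smul_eq (u := S y) (v := v) (hS.trans hb.symm)
  rw [σ.apply_π_smul hP h𝔤 hs hE (by rwa [hS]) hσS, τ.apply_π_smul hP h𝔤 hs hE (by rwa [hS]) hτS]

/-- Writing `v = S(p(v)) k`, the Weyl structure sends `π(v)` to `S(p(v))` times the `G₀`-part of
`k`. The properties of `leviPart` make this independent of the representative, equivariant and
smooth. -/
theorem exists_weylStructure_of_section {dom : Set M} (hd : IsOpen dom) {S : M → Q}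
    (hS : ContMDiffOn 𝓘(ℝ, EM) 𝓘(ℝ, EQ) ∞ S dom) (hpS : ∀ y ∈ dom, B.proj (S y) = y) :
    ∃ σ : B.WeylStructure 𝔤, σ.dom = dom ∧ ∀ y ∈ dom, σ.toFun (B.π 𝔤 (S y)) = S y := by
  classical
  have hex : ∀ v : Q, B.proj v ∈ dom → ∃ k : P, v = S (B.proj v) <• k := fun v hv =>
    B.exists_smul_eq (hpS _ hv)
  let k : Q → P := fun v => if hv : B.proj v ∈ dom then Classical.choose (hex v hv) else 1
  have hk : ∀ v, B.proj v ∈ dom → v = S (B.proj v) <• k v := fun v hv => by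
    simp only [k, hv, dif_pos]
    exact Classical.choose_spec (hex v hv)
  have hkmul : ∀ v, B.proj v ∈ dom → ∀ h : P, k (v <• h) = k v * h := fun v hv h => by
    have h1 := hk (v <• h) (by rwa [B.proj_smul])
    rw [B.proj_smul] at h1
    refine B.smul_injective (u := S (B.proj v)) ?_
    rw [← h1, smul_mul, ← hk v hv]
  -- Outside `dom` the factor `1` keeps `f` constant on fibres, so that it still descends to `Q₀`.
  let f : Q → Q := fun v => S (B.proj v) <• (if B.proj v ∈ dom then hP.leviPart E (k v) else 1)
  have hf : ∀ v, B.proj v ∈ dom → f v = S (B.proj v) <• hP.leviPart E (k v) := fun v hv => by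
    simp only [f, hv, if_true]
  have hfe : ∀ u v, B.ExpRel 𝔤 u v → f u = f v := by
    intro u v huv
    obtain ⟨Z, hZ, rfl⟩ := (expRel_iff hP).1 huv
    simp only [f, B.proj_smul]
    by_cases hu : B.proj u ∈ dom
    · simp only [hu, if_true]
      rw [hkmul u hu, hP.leviPart_mul_exp h𝔤 hs hE _ hZ]
    · simp only [hu, if_false]
  have hpf : ∀ v, B.proj v ∈ dom →
      f v <• hP.exp (IsParabolicSubgroup.nilLog E (k v)) = v := fun v hv => by
    rw [hf v hv, ← smul_mul, hP.leviPart_mul_exp_nilLog h𝔤 hs hE, ← hk v hv]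
  have hpj : ∀ v, B.proj v ∈ dom → B.proj (f v) = B.proj v := fun v hv => by
    rw [hf v hv, B.proj_smul, hpS _ hv]
  refine ⟨⟨dom, hd, Quot.lift f hfe, ?_, ?_, ?_⟩, rfl, ?_⟩
  · rintro ⟨v⟩ hv
    have h1 := π_smul_exp hP h𝔤 (B := B) (f v) (hP.nilLog_mem h𝔤 hs hE (k v))
    rw [hpf v hv] at h1
    exact h1.symm
  · rintro ⟨v⟩ hv g
    change f (v <• (g : P)) = f v <• (g : P)
    have hv' : B.proj (v <• (g : P)) ∈ dom := by rw [B.proj_smul]; exact hv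
    rw [hf _ hv', hf _ hv, hkmul v hv, hP.leviPart_mul h𝔤 hs hE, B.proj_smul, smul_mul]
  · intro v hv
    refine ContMDiffAt.contMDiffWithinAt ?_
    change ContMDiffAt _ _ _ f v
    have hd' : IsOpen (B.proj ⁻¹' dom) := hd.preimage B.contMDiff_proj.continuous
    obtain ⟨e, hx, hes, het, he⟩ := B.exists_trivialization (B.proj v)
    have hSp : ContMDiffAt 𝓘(ℝ, EQ) 𝓘(ℝ, EQ) ∞ (fun v : Q => S (B.proj v)) v :=
      (hS.contMDiffAt (hd.mem_nhds hv)).comp v (B.contMDiff_proj v)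
    have hev : ContMDiffAt 𝓘(ℝ, EQ) 𝓘(ℝ, EP) ∞ (fun v : Q => (e v).2) v :=
      (hes.contMDiffAt (e.open_source.mem_nhds (e.mem_source.2 hx))).snd
    have heS : ContMDiffAt 𝓘(ℝ, EQ) 𝓘(ℝ, EP) ∞ (fun v : Q => (e (S (B.proj v))).2) v := by
      have h1 : S (B.proj v) ∈ e.source := e.mem_source.2 (by rw [hpS _ hv]; exact hx)
      have h2 : ContMDiffAt 𝓘(ℝ, EQ) (𝓘(ℝ, EM).prod 𝓘(ℝ, EP)) ∞ e (S (B.proj v)) :=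
        hes.contMDiffAt (e.open_source.mem_nhds h1)
      exact (h2.comp v hSp).snd
    -- The element `k` was chosen point by point; its smoothness is read from its expression as a
    -- quotient of fibre coordinates in a trivialization.
    have hl : ContMDiffAt 𝓘(ℝ, EQ) 𝓘(ℝ, EP) ∞
        (fun v : Q => hP.leviPart E ((e (S (B.proj v))).2⁻¹ * (e v).2)) v :=
      ((hP.contMDiff_leviPart (E := E)) _).comp v (heS.inv.mul hev)
    refine ((B.contMDiff_smul _).comp v (hSp.prodMk hl)).congr_of_eventuallyEq ?_
    have hb : B.proj ⁻¹' e.baseSet ∈ 𝓝 v :=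
      (e.open_baseSet.preimage B.contMDiff_proj.continuous).mem_nhds hx
    filter_upwards [hd'.mem_nhds hv, hb] with w hw hwb
    have h1 : S (B.proj w) ∈ e.source := e.mem_source.2 (by rw [hpS _ hw]; exact hwb)
    have h2 : (e w).2 = (e (S (B.proj w))).2 * k w := by
      conv_lhs => rw [hk w hw]
      exact he _ h1 _
    rw [hf w hw]
    simp only [Function.comp, h2, inv_mul_cancel_left]
  · intro y hy
    change f (S y) = S y
    have hy' : B.proj (S y) ∈ dom := by rw [hpS y hy]; exact hy
    have h1 : k (S y) = 1 := by
      refine B.smul_injective (u := S y) ?_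
      have h2 := hk (S y) hy'
      rw [hpS y hy] at h2
      rw [← h2, smul_one']
    have h2 := hP.leviPart_levi h𝔤 hs hE 1
    rw [Subgroup.coe_one] at h2
    rw [hf _ hy', h1, h2, hpS y hy, smul_one']

end UnderlyingBundle

end CartanGeometry

/-! ### Frame forms and normal coordinates. -/

namespace CartanGeometry

variable {EG : Type*} [NormedAddCommGroup EG] [NormedSpace ℝ EG] [FiniteDimensional ℝ EG]
  [CompleteSpace EG]
  {G : Type*} [TopologicalSpace G] [T2Space G] [ChartedSpace EG G] [Group G]
  [LieGroup 𝓘(ℝ, EG) ∞ G]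
  {𝔤 : ℤ → Submodule ℝ (LieAlg EG G)}
  {EP : Type*} [NormedAddCommGroup EP] [NormedSpace ℝ EP] [FiniteDimensional ℝ EP]
  {P : Subgroup G} [ChartedSpace EP P] [LieGroup 𝓘(ℝ, EP) ∞ P]
  {EM : Type*} [NormedAddCommGroup EM] [NormedSpace ℝ EM] [FiniteDimensional ℝ EM]
  {M : Type*} [TopologicalSpace M] [T2Space M] [ChartedSpace EM M] [IsManifold 𝓘(ℝ, EM) ∞ M]
  {EQ : Type*} [NormedAddCommGroup EQ] [NormedSpace ℝ EQ] [FiniteDimensional ℝ EQ]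
  {Q : Type*} [TopologicalSpace Q] [T2Space Q] [ChartedSpace EQ Q] [IsManifold 𝓘(ℝ, EQ) ∞ Q]
  [MulAction (P)ᵐᵒᵖ Q]
  [GradedLieAlgebra 𝔤]
  (B : CartanGeometry EG EP P EM M EQ Q)

section FrameForm

variable (hP : IsParabolicSubgroup (EP := EP) 𝔤 P) (h𝔤 : IsOneGrading 𝔤)
include hP h𝔤

theorem eq_of_tangentVec_eq {u : Q} {X Y : LieAlg EG G} (hX : X ∈ 𝔤 (-1)) (hY : Y ∈ 𝔤 (-1))
    (h : B.tangentVec u X = B.tangentVec u Y) : X = Y := by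
  have h1 : B.tangentVec u (X + -Y) = 0 := by
    rw [tangentVec_add, tangentVec_neg, h, add_neg_cancel]
  have h2 := IsOneGrading.grComp_of_mem_filt (show (-1 : ℤ) < 0 by norm_num)
    (B.mem_filt_of_tangentVec_eq_zero hP u h1)
  rw [grComp_of_mem (add_mem hX (neg_mem hY))] at h2
  exact add_neg_eq_zero.1 h2

theorem tangentVec_grComp (u : Q) (X : LieAlg EG G) :
    B.tangentVec u (grComp 𝔤 (-1) X) = B.tangentVec u X := by
  conv_rhs => rw [h𝔤.eq_sum X]
  rw [tangentVec_add, tangentVec_add,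
    B.tangentVec_eq_zero hP u (IsOneGrading.mem_filt_of_mem le_rfl (grComp_mem 0 X)),
    B.tangentVec_eq_zero hP u (IsOneGrading.mem_filt_of_mem zero_le_one (grComp_mem 1 X)),
    add_zero, add_zero]

theorem exists_mem_tangentVec_eq (u : Q) (ξ : TangentSpace 𝓘(ℝ, EM) (B.proj u)) :
    ∃ X ∈ 𝔤 (-1), B.tangentVec u X = ξ := by
  obtain ⟨X, rfl⟩ := B.exists_tangentVec_eq u ξ
  exact ⟨_, grComp_mem _ _, B.tangentVec_grComp hP h𝔤 u X⟩

theorem frameForm_mem (η : ∀ y : M, TangentSpace 𝓘(ℝ, EM) y) (u : Q) :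
    B.frameForm 𝔤 η u ∈ 𝔤 (-1) :=
  Function.invFunOn_mem (f := fun X => B.tangentVec u X) (B.exists_mem_tangentVec_eq hP h𝔤 u _)

theorem tangentVec_frameForm (η : ∀ y : M, TangentSpace 𝓘(ℝ, EM) y) (u : Q) :
    B.tangentVec u (B.frameForm 𝔤 η u) = η (B.proj u) :=
  Function.invFunOn_eq (f := fun X => B.tangentVec u X) (B.exists_mem_tangentVec_eq hP h𝔤 u _)

theorem eq_frameForm {η : ∀ y : M, TangentSpace 𝓘(ℝ, EM) y} {u : Q} {X : LieAlg EG G}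
    (hX : X ∈ 𝔤 (-1)) (h : B.tangentVec u X = η (B.proj u)) : X = B.frameForm 𝔤 η u :=
  B.eq_of_tangentVec_eq hP h𝔤 hX (B.frameForm_mem hP h𝔤 η u)
    (h.trans (B.tangentVec_frameForm hP h𝔤 η u).symm)

end FrameForm

/-- `F` sends each `X` of norm less than `r` to `Fl₁^{ω⁻¹(X)}(u)`. -/
structure IsNormalFlow (u : Q) (r : ℝ) (F : EG → Q) : Prop where
  pos : 0 < r
  contMDiffOn : ContMDiffOn 𝓘(ℝ, EG) 𝓘(ℝ, EQ) ∞ F (Metric.ball 0 r)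
  apply_zero : F 0 = u
  mfderiv_zero : ∀ X : LieAlg EG G,
    (mfderiv 𝓘(ℝ, EG) 𝓘(ℝ, EQ) F 0 : EG →L[ℝ] EQ) X = B.constField X u
  curve : ∀ X : EG, X ∈ Metric.ball (0 : EG) r →
    IsMIntegralCurveOn (fun t : ℝ => F (t • X)) (B.constField (X : LieAlg EG G)) (Ioo (-1 / 2) (3 / 2))

/-- The family `X ↦ ω⁻¹(X)` is linear, so the flow theorem applies. Homogeneity, that the flow of
`X` at time `t` is the flow of `tX` at time `1`, identifies the integral curves with `t ↦ F (t •
X)`. Halving the radius leaves room for `|t| < 2`. -/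
theorem exists_isNormalFlow (u : Q) : ∃ r F, B.IsNormalFlow u r F := by
  let v : EG → ∀ q : Q, TangentSpace 𝓘(ℝ, EQ) q := fun X => B.constField (X : LieAlg EG G)
  obtain ⟨O, F, hO, h0, hF, hF0, hFd, hFγ⟩ := exists_parametric_flow_manifold v
    (B.constField_add) (B.constField_smul) (B.contMDiff_constField) u
  obtain ⟨R, hR, hRO⟩ := Metric.isOpen_iff.1 hO 0 h0
  refine ⟨R / 2, F, half_pos hR, hF.mono ((Metric.ball_subset_ball (by linarith)).trans hRO), hF0,
    hFd, fun X hX => ?_⟩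
  have hXR : ‖X‖ < R / 2 := by simpa using hX
  have hball : ∀ t ∈ Ioo (-1 / 2 : ℝ) (3 / 2), t • X ∈ O := fun t ht => hRO (by
    have : |t| < 2 := abs_lt.2 ⟨by linarith [ht.1], by linarith [ht.2]⟩
    rw [mem_ball_zero_iff, norm_smul, Real.norm_eq_abs]
    nlinarith [norm_nonneg X, abs_nonneg t])
  have h1 := hball 1 (by norm_num)
  rw [one_smul] at h1
  obtain ⟨γ, hγ0, -, hγ⟩ := hFγ X h1
  have key : EqOn (fun t : ℝ => F (t • X)) γ (Ioo (-1 / 2) (3 / 2)) := fun t ht => by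
    obtain ⟨δ, hδ0, hδ1, hδ⟩ := hFγ (t • X) (hball t ht)
    -- For `a ∈ (-1/2, 5/4)` and `t ∈ (-1/2, 3/2)` the product `a t` stays in `(-1, 2)`, where `γ`
    -- is an integral curve; the interval for `a` still contains `1`.
    have h2 : IsMIntegralCurveOn (γ ∘ (· * t)) (B.constField (t • (X : LieAlg EG G)))
        (Ioo (-1 / 2) (5 / 4)) := by
      have h3 := hγ.comp_mul t
      have h4 : t • v X = B.constField (t • (X : LieAlg EG G)) :=
        funext fun q => (B.constField_smul t X q).symm
      rw [h4] at h3
      refine h3.mono fun a ha => ⟨?_, ?_⟩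
      · nlinarith [ha.1, ha.2, ht.1, ht.2]
      · nlinarith [ha.1, ha.2, ht.1, ht.2]
    have h3 := B.eqOn_of_isMIntegralCurveOn (by norm_num) h2
      (hδ.mono (Ioo_subset_Ioo (by norm_num) (by norm_num))) (by simp [hγ0, hδ0])
    have h4 := h3 (show (1 : ℝ) ∈ Ioo (-1 / 2 : ℝ) (5 / 4) by norm_num)
    simp only [Function.comp, one_mul] at h4
    exact (h4.trans hδ1).symm
  intro t ht
  have h2 := (hγ.mono (Ioo_subset_Ioo (by norm_num) (by norm_num))) t ht
  have h3 := h2.congr_of_eventuallyEq (key.eventuallyEq_of_mem self_mem_nhdsWithin) (key ht)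
  exact Eq.mp (congrArg (fun q => HasMFDerivWithinAt 𝓘(ℝ, ℝ) 𝓘(ℝ, EQ) (fun t : ℝ => F (t • X))
    (Ioo (-1 / 2) (3 / 2)) t ((1 : ℝ →L[ℝ] ℝ).smulRight (v X q : EQ))) (key ht).symm) h3

namespace IsNormalFlow

variable {B} {u : Q} {r : ℝ} {F : EG → Q} (hF : B.IsNormalFlow u r F)
include hF

theorem apply_of_curve {X : EG} (hX : X ∈ Metric.ball (0 : EG) r) {γ : ℝ → Q}
    (h0 : γ 0 = u) {ε : ℝ} (hε : 0 < ε)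
    (hγ : IsMIntegralCurveOn γ (B.constField (X : LieAlg EG G)) (Ioo (-ε) (1 + ε))) :
    γ 1 = F X := by
  have h1 := B.eqOn_of_isMIntegralCurveOn (a := -(min ε (1 / 4))) (b := 1 + min ε (1 / 4))
    ⟨by simp [hε], by positivity⟩
    (hγ.mono (Ioo_subset_Ioo (by simp) (by simp)))
    ((hF.curve X hX).mono (Ioo_subset_Ioo (by linarith [min_le_right ε (1 / 4)])
      (by linarith [min_le_right ε (1 / 4)]))) (by rw [h0, zero_smul, hF.apply_zero])
  have h2 := h1 (show (1 : ℝ) ∈ Ioo (-(min ε (1 / 4))) (1 + min ε (1 / 4)) from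
    ⟨by linarith [lt_min hε (show (0 : ℝ) < 1 / 4 by norm_num)],
      by linarith [lt_min hε (show (0 : ℝ) < 1 / 4 by norm_num)]⟩)
  simpa using h2

/-- Integral curves are unique, so any curve witnessing normality ends at `F X`. -/
theorem isNormalAt_iff {σ : B.WeylStructure 𝔤} : σ.IsNormalAt u ↔ B.proj u ∈ σ.dom ∧
    ∀ᶠ X : LieAlg EG G in 𝓝[(𝔤 (-1) : Set (LieAlg EG G))] 0,
      B.proj (F X) ∈ σ.dom ∧ σ.toFun (B.π 𝔤 (F X)) = F X := by
  have hb : ∀ᶠ X : LieAlg EG G in 𝓝[(𝔤 (-1) : Set (LieAlg EG G))] 0,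
      X ∈ Metric.ball (0 : EG) r :=
    mem_nhdsWithin_of_mem_nhds (Metric.ball_mem_nhds (0 : EG) hF.pos)
  refine and_congr_right fun _ => eventually_congr ?_
  filter_upwards [hb] with X hX
  constructor
  · rintro ⟨γ, h0, ⟨ε, hε, hγ⟩, h1, h2⟩
    rw [hF.apply_of_curve hX h0 hε hγ] at h1 h2
    exact ⟨h1, h2⟩
  · rintro ⟨h1, h2⟩
    have h3 : F ((1 : ℝ) • (X : EG)) = F X := by rw [one_smul]
    refine ⟨fun t => F (t • (X : EG)), (congrArg F (zero_smul ℝ (X : EG))).trans hF.apply_zero,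
      ⟨1 / 2, by norm_num, (hF.curve X hX).mono (Ioo_subset_Ioo (by norm_num) (by norm_num))⟩, ?_, ?_⟩
    · simp only [h3]; exact h1
    · simp only [h3]; exact h2

theorem mfderiv_proj_comp_apply (X : EG) :
    (mfderiv 𝓘(ℝ, EG) 𝓘(ℝ, EM) (fun X => B.proj (F X)) 0 : EG →L[ℝ] EM) X
      = B.tangentVec u (X : LieAlg EG G) := by
  have h1 : MDifferentiableAt 𝓘(ℝ, EG) 𝓘(ℝ, EQ) F 0 :=
    (hF.contMDiffOn.contMDiffAt (Metric.ball_mem_nhds _ hF.pos)).mdifferentiableAt (by simp)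
  refine (mfderiv_apply_of_eventuallyEq_comp (B.mdifferentiable_proj u) h1 hF.apply_zero
    (Eventually.of_forall fun _ => rfl) X).trans ?_
  exact congrArg (mfderiv 𝓘(ℝ, EQ) 𝓘(ℝ, EM) B.proj u : EQ →L[ℝ] EM) (hF.mfderiv_zero X)

/-- The flow `X ↦ Fl₁^{ω⁻¹(X)}(u)` on `𝔤₋₁` gives normal coordinates on `M` together with a local
section of the bundle. -/
theorem exists_normalSection (hP : IsParabolicSubgroup (EP := EP) 𝔤 P) (h𝔤 : IsOneGrading 𝔤) :
    ∃ (dom : Set M) (S : M → Q) (Xf : M → LieAlg EG G), IsOpen dom ∧ B.proj u ∈ dom ∧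
      ContMDiffOn 𝓘(ℝ, EM) 𝓘(ℝ, EQ) ∞ S dom ∧ (∀ y ∈ dom, B.proj (S y) = y) ∧
      Xf (B.proj u) = 0 ∧ ContinuousAt Xf (B.proj u) ∧
      (∀ y ∈ dom, Xf y ∈ 𝔤 (-1) ∧ S y = F (Xf y)) ∧
      ∀ᶠ X : LieAlg EG G in 𝓝[(𝔤 (-1) : Set (LieAlg EG G))] 0,
        B.proj (F X) ∈ dom ∧ S (B.proj (F X)) = F X := by
  have : CompleteSpace EM := FiniteDimensional.complete ℝ EM
  let V : Submodule ℝ EG := 𝔤 (-1)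
  have : CompleteSpace V := FiniteDimensional.complete ℝ V
  let x := B.proj u
  let φ := extChartAt 𝓘(ℝ, EM) x
  let f : V → EM := fun X => φ (B.proj (F X))
  have hψ : ContMDiffOn 𝓘(ℝ, EG) 𝓘(ℝ, EM) ∞ (fun X => B.proj (F X)) (Metric.ball 0 r) :=
    B.contMDiff_proj.comp_contMDiffOn hF.contMDiffOn
  let ψ : V → M := fun X => B.proj (F X)
  have hV : ContMDiff 𝓘(ℝ, V) 𝓘(ℝ, EG) ∞ (V.subtypeL) := V.subtypeL.contDiff.contMDiff
  have hψV : ContMDiffOn 𝓘(ℝ, V) 𝓘(ℝ, EM) ∞ ψ (V.subtypeL ⁻¹' Metric.ball 0 r) :=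
    hψ.comp hV.contMDiffOn (fun X hX => hX)
  have hU₁ : IsOpen (V.subtypeL ⁻¹' Metric.ball (0 : EG) r) :=
    Metric.isOpen_ball.preimage V.subtypeL.continuous
  let U : Set V := (V.subtypeL ⁻¹' Metric.ball 0 r) ∩ ψ ⁻¹' φ.source
  have hU : IsOpen U := hψV.continuousOn.isOpen_inter_preimage hU₁ (isOpen_extChartAt_source x)
  have hψ0 : ψ 0 = x := congrArg B.proj hF.apply_zero
  have h0U : (0 : V) ∈ U := ⟨by
      change ((0 : V) : EG) ∈ Metric.ball 0 r
      simpa using hF.pos, by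
      change ψ 0 ∈ φ.source
      rw [hψ0]; exact mem_extChartAt_source x⟩
  have hφ : ContMDiffOn 𝓘(ℝ, EM) 𝓘(ℝ, EM) ∞ φ φ.source := by
    rw [show φ.source = (chartAt EM x).source from extChartAt_source _ _]
    exact contMDiffOn_extChartAt
  have hf : ContDiffOn ℝ ∞ f U :=
    (hφ.comp (hψV.mono inter_subset_left) inter_subset_right).contDiffOn
  have hd : ∀ X : V, fderiv ℝ f 0 X
      = (mfderiv 𝓘(ℝ, EM) 𝓘(ℝ, EM) φ x : EM →L[ℝ] EM) (B.tangentVec u ((X : EG) : LieAlg EG G)) := by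
    intro X
    have hψd : MDifferentiableAt 𝓘(ℝ, V) 𝓘(ℝ, EM) ψ 0 :=
      (hψV.contMDiffAt (hU₁.mem_nhds h0U.1)).mdifferentiableAt (by simp)
    have hφd : MDifferentiableAt 𝓘(ℝ, EM) 𝓘(ℝ, EM) φ x :=
      mdifferentiableAt_extChartAt (mem_chart_source EM x)
    have h1 := mfderiv_apply_of_eventuallyEq_comp (h := f) hφd hψd hψ0
      (Eventually.of_forall fun _ => rfl) X
    rw [mfderiv_eq_fderiv] at h1
    refine h1.trans (congrArg (mfderiv 𝓘(ℝ, EM) 𝓘(ℝ, EM) φ x : EM →L[ℝ] EM) ?_)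
    have h2 := mfderiv_apply_of_eventuallyEq_comp (h := ψ) (b := (0 : EG))
      ((hψ.contMDiffAt (Metric.ball_mem_nhds _ hF.pos)).mdifferentiableAt (by simp))
      (hV.mdifferentiable (by simp) 0) (map_zero V.subtypeL)
      (Eventually.of_forall fun _ => rfl) X
    rw [mfderiv_eq_fderiv, V.subtypeL.fderiv] at h2
    exact h2.trans (hF.mfderiv_proj_comp_apply _)
  -- Up to a chart of `M` this derivative is `X ↦ ⟦u, X⟧` on `𝔤₋₁`, an isomorphism because `𝔤₋₁` is
  -- a complement of the kernel `𝔭`. The section is then `F` composed with the inverse of these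
  -- coordinates.
  have hbij : Function.Bijective (fderiv ℝ f 0) := by
    obtain ⟨A, hA⟩ : (mfderiv 𝓘(ℝ, EM) 𝓘(ℝ, EM) φ x).IsInvertible :=
      isInvertible_mfderiv_extChartAt (mem_extChartAt_source x)
    have hd' : ∀ X : V, fderiv ℝ f 0 X
        = (A : EM ≃L[ℝ] EM) (B.tangentVec u ((X : EG) : LieAlg EG G)) := fun X =>
      (hd X).trans (congrArg (fun T : EM →L[ℝ] EM => T (B.tangentVec u ((X : EG) : LieAlg EG G)))
        hA.symm)
    refine ⟨fun X Y hXY => ?_, fun ξ => ?_⟩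
    · rw [hd', hd'] at hXY
      exact Subtype.ext (B.eq_of_tangentVec_eq hP h𝔤 X.2 Y.2 ((A : EM ≃L[ℝ] EM).injective hXY))
    · obtain ⟨X, hX, hXξ⟩ := B.exists_mem_tangentVec_eq hP h𝔤 u ((A : EM ≃L[ℝ] EM).symm ξ)
      refine ⟨⟨X, hX⟩, (hd' _).trans ?_⟩
      exact (congrArg (A : EM ≃L[ℝ] EM) hXξ).trans ((A : EM ≃L[ℝ] EM).apply_symm_apply ξ)
  obtain ⟨f', hf'⟩ := ContinuousLinearMap.isInvertible_of_bijective hbij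
  have hfd : HasFDerivAt f (f' : V →L[ℝ] EM) 0 := by
    rw [hf']
    exact ((hf.contDiffAt (hU.mem_nhds h0U)).differentiableAt (by simp)).hasFDerivAt
  obtain ⟨e, h0e, heU, hef, hes⟩ := exists_openPartialHomeomorph_contDiffOn_symm hU hf h0U hfd
  have hdo : IsOpen (φ.source ∩ φ ⁻¹' e.target) :=
    hφ.continuousOn.isOpen_inter_preimage (isOpen_extChartAt_source x) e.open_target
  have hφx : φ x = e 0 := by rw [hef, ← hψ0]
  have hsm : ContMDiffOn 𝓘(ℝ, EM) 𝓘(ℝ, V) ∞ (fun y => e.symm (φ y)) (φ.source ∩ φ ⁻¹' e.target) :=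
    hes.contMDiffOn.comp (hφ.mono inter_subset_left) inter_subset_right
  have hsV : ContMDiffOn 𝓘(ℝ, EM) 𝓘(ℝ, EG) ∞ (fun y => (e.symm (φ y) : EG))
      (φ.source ∩ φ ⁻¹' e.target) := hV.comp_contMDiffOn hsm
  have hxd : x ∈ φ.source ∩ φ ⁻¹' e.target :=
    ⟨mem_extChartAt_source x, by rw [mem_preimage, hφx]; exact e.map_source h0e⟩
  refine ⟨φ.source ∩ φ ⁻¹' e.target, fun y => F (e.symm (φ y)), fun y => (e.symm (φ y) : EG),
    hdo, hxd, ?_, ?_, ?_, ?_, ?_, ?_⟩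
  · exact hF.contMDiffOn.comp hsV fun y hy => (heU (e.map_target hy.2)).1
  · intro y hy
    have h1 := (heU (e.map_target hy.2)).2
    refine φ.injOn h1 hy.1 ?_
    have h2 := e.right_inv hy.2
    rw [hef] at h2
    exact h2
  · change ((e.symm (φ x) : V) : EG) = 0
    rw [hφx, e.left_inv h0e]; rfl
  · exact (hsV.contMDiffAt (hdo.mem_nhds hxd)).continuousAt
  · intro y hy
    exact ⟨(e.symm (φ y)).2, rfl⟩
  · have h1 : ∀ᶠ X : V in 𝓝 (0 : V), X ∈ e.source := e.open_source.mem_nhds h0e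
    have h2 : ∀ᶠ X : EG in 𝓝[(V : Set EG)] 0, ∃ h : X ∈ V, (⟨X, h⟩ : V) ∈ e.source := by
      have h3 : 𝓝[(V : Set EG)] 0 = map ((↑) : V → EG) (𝓝 (0 : V)) :=
        nhdsWithin_eq_map_subtype_coe V.zero_mem
      rw [h3, eventually_map]
      filter_upwards [h1] with X hX
      exact ⟨X.2, hX⟩
    have h4 : ∀ X : EG, (∃ h : X ∈ V, (⟨X, h⟩ : V) ∈ e.source) →
        B.proj (F X) ∈ φ.source ∩ φ ⁻¹' e.target ∧ F (e.symm (φ (B.proj (F X)))) = F X := by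
      rintro X ⟨hX, hXe⟩
      have h5 : φ (B.proj (F X)) = e ⟨X, hX⟩ := (hef ⟨X, hX⟩).symm
      refine ⟨⟨(heU hXe).2, ?_⟩, ?_⟩
      · rw [mem_preimage, h5]; exact e.map_source hXe
      · rw [h5, e.left_inv hXe]
    exact h2.mono h4

end IsNormalFlow

end CartanGeometry

/-! ### The action over the center, and invariant normal Weyl structures. -/

namespace CartanGeometry

variable {EG : Type*} [NormedAddCommGroup EG] [NormedSpace ℝ EG] [FiniteDimensional ℝ EG]
  [CompleteSpace EG]
  {G : Type*} [TopologicalSpace G] [T2Space G] [ChartedSpace EG G] [Group G]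
  [LieGroup 𝓘(ℝ, EG) ∞ G]
  {𝔤 : ℤ → Submodule ℝ (LieAlg EG G)}
  {EP : Type*} [NormedAddCommGroup EP] [NormedSpace ℝ EP] [FiniteDimensional ℝ EP]
  {P : Subgroup G} [ChartedSpace EP P] [LieGroup 𝓘(ℝ, EP) ∞ P]
  {EM : Type*} [NormedAddCommGroup EM] [NormedSpace ℝ EM] [FiniteDimensional ℝ EM]
  {M : Type*} [TopologicalSpace M] [T2Space M] [ChartedSpace EM M] [IsManifold 𝓘(ℝ, EM) ∞ M]
  {EQ : Type*} [NormedAddCommGroup EQ] [NormedSpace ℝ EQ] [FiniteDimensional ℝ EQ]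
  {Q : Type*} [TopologicalSpace Q] [T2Space Q] [ChartedSpace EQ Q] [IsManifold 𝓘(ℝ, EQ) ∞ Q]
  [MulAction (P)ᵐᵒᵖ Q]
  [GradedLieAlgebra 𝔤]
  (B : CartanGeometry EG EP P EM M EQ Q)

section Center

omit [GradedLieAlgebra 𝔤] in
theorem exists_proj_eq (x : M) : ∃ u, B.proj u = x := by
  obtain ⟨e, hx, -⟩ := B.exists_trivialization x
  exact ⟨_, e.proj_symm_apply (x := (x, (1 : P))) (e.mem_target.2 hx)⟩

variable {B}

omit [GradedLieAlgebra 𝔤] in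
-- `φ` preserves constant fields, and `Tp ∘ Tφ = Ts ∘ Tp`.
theorem tangentVec_localAut {φ : B.LocalAut} {s : OpenPartialHomeomorph M M}
    (hsm : ContMDiffOn 𝓘(ℝ, EM) 𝓘(ℝ, EM) ∞ s s.source) {V : Set M} (hV : IsOpen V)
    (hVs : V ⊆ φ.dom ∩ s.source) (hφ : ∀ u : Q, B.proj u ∈ V → B.proj (φ.toHomeo u) = s (B.proj u))
    {u : Q} (hu : B.proj u ∈ V) (X : LieAlg EG G) :
    (B.tangentVec (φ.toHomeo u) X : EM)
      = (mfderiv 𝓘(ℝ, EM) 𝓘(ℝ, EM) s (B.proj u) : EM →L[ℝ] EM) (B.tangentVec u X) := by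
  have hus : u ∈ φ.toHomeo.source := by rw [φ.source_eq]; exact (hVs hu).1
  have hφd : MDifferentiableAt 𝓘(ℝ, EQ) 𝓘(ℝ, EQ) φ.toHomeo u :=
    (φ.contMDiffOn.contMDiffAt (φ.toHomeo.open_source.mem_nhds hus)).mdifferentiableAt (by simp)
  have hsd : MDifferentiableAt 𝓘(ℝ, EM) 𝓘(ℝ, EM) s (B.proj u) :=
    (hsm.contMDiffAt (s.open_source.mem_nhds (hVs hu).2)).mdifferentiableAt (by simp)
  rw [tangentVec, ← B.mfderiv_localAut_constField φ hus]
  have h1 := mfderiv_apply_of_eventuallyEq_comp (B.mdifferentiable_proj (φ.toHomeo u)) hφd rfl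
    (Eventually.of_forall fun _ => rfl) (B.constField X u)
  have h2 := mfderiv_apply_of_eventuallyEq_comp (h := B.proj ∘ φ.toHomeo) hsd
    (B.mdifferentiable_proj u) rfl
    (mem_of_superset ((hV.preimage B.contMDiff_proj.continuous).mem_nhds hu) hφ)
    (B.constField X u)
  exact h1.symm.trans h2

variable (hP : IsParabolicSubgroup (EP := EP) 𝔤 P) (h𝔤 : IsOneGrading 𝔤)
  (hG : LieAlgebra.IsSemisimple ℝ (LieAlg EG G))
include hP h𝔤 hG

/-- Over the center of a symmetry, the covering automorphism acts on a suitable point of the fibre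
as an element of `G₀` whose adjoint action is `-id` on `𝔤₋₁`. -/
theorem exists_smul_levi_of_isSymmetry {E : LieAlg EG G} (hE : IsGradingElement 𝔤 E) {x : M}
    {s : OpenPartialHomeomorph M M} (hs : B.IsSymmetry s x) {φ : B.LocalAut} (hφ : φ.Covers s x) :
    ∃ (u : Q) (g : levi 𝔤 P), B.proj u = x ∧ φ.toHomeo u = u <• (g : P) ∧
      (∀ X ∈ 𝔤 (-1), Ad ((g : P) : G) X = -X) ∧ ∀ Z ∈ 𝔤 1, Ad ((g : P) : G) Z = -Z := by
  have : Module.Finite ℝ (LieAlg EG G) := inferInstanceAs (FiniteDimensional ℝ EG)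
  obtain ⟨V, hV, hxV, hVs, hφV⟩ := hφ
  obtain ⟨u₁, rfl⟩ := B.exists_proj_eq x
  have h1 : B.proj u₁ = B.proj (φ.toHomeo u₁) := by rw [hφV _ hxV, hs.map_center]
  obtain ⟨h, hh⟩ := B.exists_smul_eq h1
  have hus : u₁ ∈ φ.toHomeo.source := by rw [φ.source_eq]; exact (hVs hxV).1
  let g : levi 𝔤 P := ⟨hP.leviPart E h, hP.leviPart_mem h𝔤 hG hE h⟩
  set Z := IsParabolicSubgroup.nilLog E h with hZdef
  have hZ : Z ∈ 𝔤 1 := hP.nilLog_mem h𝔤 hG hE h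
  have hgh : (g : P) * hP.exp Z = h := hP.leviPart_mul_exp_nilLog h𝔤 hG hE h
  -- Since `φ(u₁) = u₁ h`, the vector `⟦u₁, Ad h X⟧` equals `⟦φ(u₁), X⟧ = T_x s ⟦u₁, X⟧ = -⟦u₁, X⟧`.
  have hneg : ∀ X : LieAlg EG G, Ad (h : G) X + X ∈ filt 𝔤 0 := fun X => by
    refine B.mem_filt_of_tangentVec_eq_zero hP u₁ ?_
    have h2 := tangentVec_localAut hs.contMDiffOn hV hVs hφV hxV X
    have h3 := hs.mfderiv_center (B.tangentVec u₁ X)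
    have h4 := B.tangentVec_smul_Ad u₁ h (Ad (h : G) X)
    rw [Subgroup.coe_inv, Ad_inv_Ad] at h4
    have h5 : ∀ v : Q, φ.toHomeo u₁ = v →
        (B.tangentVec (φ.toHomeo u₁) X : EM) = B.tangentVec v X := by rintro _ rfl; rfl
    have h6 : (B.tangentVec u₁ (Ad (h : G) X) : EM) = -(B.tangentVec u₁ X : EM) :=
      h4.symm.trans ((h5 _ hh).symm.trans (h2.trans h3))
    rw [tangentVec_add]
    exact (congrArg (· + (B.tangentVec u₁ X : EM)) h6).trans (neg_add_cancel _)
  -- The elements `g` and `h` differ by a factor from `exp 𝔤₁`, which does not affect the component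
  -- in `𝔤₋₁`.
  have hg1 : ∀ X ∈ 𝔤 (-1), Ad ((g : P) : G) X = -X := fun X hX => by
    rw [← sub_eq_zero, sub_neg_eq_add]
    have h2 : Ad ((g : P) : G) X + X ∈ 𝔤 (-1) := add_mem (g.2 _ X hX) hX
    have h3 : grComp 𝔤 (-1) (Ad ((g : P) : G) X + X) = 0 := by
      have h4 := hneg (Ad (hP.exp (-Z) : G) X)
      have h5 : Ad (h : G) (Ad (hP.exp (-Z) : G) X) = Ad ((g : P) : G) X := by
        rw [← hgh, Subgroup.coe_mul, Ad_mul, hP.exp_neg h𝔤 hZ, Subgroup.coe_inv, Ad_Ad_inv]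
      have h6 := h𝔤.mem_filt_zero_iff.1 h4
      rw [h5, hP.val_exp (IsParabolicSubgroup.mem_filt_zero_of_mem_one (neg_mem hZ)), grComp_add,
        hP.grComp_Ad_lieExp h𝔤 (neg_mem hZ)] at h6
      rw [grComp_add, h6]
    rwa [grComp_of_mem h2] at h3
  have hg2 : ∀ Z ∈ 𝔤 1, Ad ((g : P) : G) Z = -Z :=
    h𝔤.map_eq_neg_of_mem_one hG (fun X Y => Ad_lie _ X Y) g.2 hg1
  -- As `Ad g = -id` on `𝔤₁`, one has `φ(u₁ exp W) = (u₁ exp W) g exp(Z + 2W)` for `W ∈ 𝔤₁`; hence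
  -- the choice `W = -Z/2`.
  have hW : (-(1 / 2) : ℝ) • Z ∈ 𝔤 1 := Submodule.smul_mem _ _ hZ
  refine ⟨u₁ <• hP.exp ((-(1 / 2) : ℝ) • Z), g, B.proj_smul _ _, ?_, hg1, hg2⟩
  rw [φ.map_smul _ hus, hh, ← hgh, ← smul_mul, ← smul_mul]
  congr 2
  have h2 := hP.mul_exp g (neg_mem hW)
  rw [map_neg, hg2 _ hW, neg_neg] at h2
  rw [← h2, mul_assoc, ← hP.exp_add h𝔤 hZ hW]
  congr 2
  module

end Center

theorem _root_.IsParabolicSubgroup.leviPart_levi_mul (hP : IsParabolicSubgroup (EP := EP) 𝔤 P)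
    (h𝔤 : IsOneGrading 𝔤) (hG : LieAlgebra.IsSemisimple ℝ (LieAlg EG G)) {E : LieAlg EG G}
    (hE : IsGradingElement 𝔤 E) (g : levi 𝔤 P) (k : P) :
    hP.leviPart E ((g : P) * k) = (g : P) * hP.leviPart E k := by
  conv_lhs => rw [← hP.leviPart_mul_exp_nilLog h𝔤 hG hE k, ← mul_assoc]
  rw [hP.leviPart_mul_exp h𝔤 hG hE _ (hP.nilLog_mem h𝔤 hG hE k)]
  exact hP.leviPart_levi h𝔤 hG hE (g * ⟨_, hP.leviPart_mem h𝔤 hG hE k⟩)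

section NormalCoordinates

variable {B}

omit [GradedLieAlgebra 𝔤] in
theorem LocalAut.smul_mem_source (φ : B.LocalAut) {u : Q} (hu : u ∈ φ.toHomeo.source) (k : P) :
    u <• k ∈ φ.toHomeo.source := by
  rw [φ.source_eq] at hu ⊢
  rwa [mem_preimage, B.proj_smul]

omit [GradedLieAlgebra 𝔤] in
theorem LocalAut.base₀_π (φ : B.LocalAut) {u : Q} (hu : u ∈ φ.toHomeo.source) :
    φ.base₀ 𝔤 (B.π 𝔤 u) = B.π 𝔤 (φ.toHomeo u) := by
  rw [φ.source_eq] at hu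
  exact if_pos hu

/-- Both sides are endpoints of integral curves of `ω⁻¹(X)` starting at `u g`: `φ` preserves
constant fields, and right translation by `g` turns a curve for `-X` into one for `Ad g⁻¹ (-X) = X`.
-/
theorem IsNormalFlow.localAut_apply {u : Q} {r : ℝ} {F : EG → Q} (hF : B.IsNormalFlow u r F)
    {φ : B.LocalAut} (hu : u ∈ φ.toHomeo.source) {g : P} (hg : φ.toHomeo u = u <• g)
    (hgX : ∀ X ∈ 𝔤 (-1), Ad (g : G) X = -X) :
    ∀ᶠ X : LieAlg EG G in 𝓝[(𝔤 (-1) : Set (LieAlg EG G))] 0,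
      F X ∈ φ.toHomeo.source ∧ φ.toHomeo (F X) = F (-X) <• g := by
  have hc : ContinuousAt F 0 :=
    (hF.contMDiffOn.contMDiffAt (Metric.ball_mem_nhds _ hF.pos)).continuousAt
  have h1 : F ⁻¹' φ.toHomeo.source ∈ 𝓝 (0 : EG) := 
    hc.preimage_mem_nhds (φ.toHomeo.open_source.mem_nhds (by rw [hF.apply_zero]; exact hu))
  obtain ⟨R, hR, hRF⟩ := Metric.mem_nhds_iff.1 h1
  have hA : ∀ X : LieAlg EG G, X ∈ 𝔤 (-1) → Ad ((g⁻¹ : P) : G) (-X) = X := fun X hX => by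
    rw [← hgX X hX, Subgroup.coe_inv, Ad_inv_Ad]
  have key : ∀ X : EG, X ∈ (𝔤 (-1) : Submodule ℝ EG) → ‖X‖ < min (R / 2) r →
      F X ∈ φ.toHomeo.source ∧ φ.toHomeo (F X) = F (-X) <• g := by
    intro X hX hXR
    have hXr : X ∈ Metric.ball (0 : EG) r := by simpa using hXR.trans_le (min_le_right _ _)
    have hXr' : -X ∈ Metric.ball (0 : EG) r := by simpa using hXR.trans_le (min_le_right _ _)
    have hXR' := hXR.trans_le (min_le_left _ _)
    have hball : ∀ t ∈ Ioo (-1 / 2 : ℝ) (3 / 2), F (t • X) ∈ φ.toHomeo.source := fun t ht => hRF (by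
      have : |t| < 2 := abs_lt.2 ⟨by linarith [ht.1], by linarith [ht.2]⟩
      rw [mem_ball_zero_iff, norm_smul, Real.norm_eq_abs]
      nlinarith [norm_nonneg X, abs_nonneg t])
    have h2 := B.isMIntegralCurveOn_localAut φ (hF.curve X hXr) hball
    have h3 := B.isMIntegralCurveOn_smul (hF.curve (-X) hXr') g
    have h3' : IsMIntegralCurveOn (fun t : ℝ => F (t • -X) <• g) (B.constField (X : LieAlg EG G))
        (Ioo (-1 / 2) (3 / 2)) :=
      (congrArg (fun Y : LieAlg EG G => IsMIntegralCurveOn (fun t : ℝ => F (t • -X) <• g)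
        (B.constField Y) (Ioo (-1 / 2) (3 / 2))) (hA X hX)).mp h3
    have h4 := B.eqOn_of_isMIntegralCurveOn (by norm_num) h2 h3'
      (by simp only [zero_smul, hF.apply_zero, hg])
    have h5 := h4 (show (1 : ℝ) ∈ Ioo (-1 / 2 : ℝ) (3 / 2) by norm_num)
    have h6 := hball 1 (by norm_num)
    simp only [one_smul] at h5 h6
    exact ⟨h6, h5⟩
  have hb : ∀ᶠ X : LieAlg EG G in 𝓝[(𝔤 (-1) : Set (LieAlg EG G))] 0,
      X ∈ Metric.ball (0 : EG) (min (R / 2) r) :=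
    mem_nhdsWithin_of_mem_nhds (Metric.ball_mem_nhds (0 : EG) (lt_min (half_pos hR) hF.pos))
  filter_upwards [hb, self_mem_nhdsWithin] with X hX hX1
  exact key X hX1 (mem_ball_zero_iff.1 hX)

namespace WeylStructure

theorem IsNormalAt.apply_π {σ : B.WeylStructure 𝔤} {u : Q} (h : σ.IsNormalAt u) :
    σ.toFun (B.π 𝔤 u) = u := by
  obtain ⟨r, F, hF⟩ := B.exists_isNormalFlow u
  have h1 := (hF.isNormalAt_iff.1 h).2.self_of_nhdsWithin (zero_mem (𝔤 (-1)))
  have h2 : F (0 : LieAlg EG G) = u := hF.apply_zero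
  rw [h2] at h1
  exact h1.2

/-- Translation by `k⁻¹ ∈ G₀` takes the curves from `u k` to those from `u` and permutes `𝔤₋₁`, and
`σ` is equivariant. So `σ_u` depends only on the `G₀`-orbit of `u`. -/
theorem IsNormalAt.of_smul_levi {σ : B.WeylStructure 𝔤} {u : Q} {k : levi 𝔤 P}
    (h : σ.IsNormalAt (u <• (k : P))) : σ.IsNormalAt u := by
  obtain ⟨h1, h2⟩ := h
  rw [B.proj_smul] at h1
  refine ⟨h1, ?_⟩
  have hc : Tendsto (fun X : LieAlg EG G => Ad (((k⁻¹ : levi 𝔤 P) : P) : G) X)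
      (𝓝[(𝔤 (-1) : Set (LieAlg EG G))] 0) (𝓝[(𝔤 (-1) : Set (LieAlg EG G))] 0) := by
    refine tendsto_nhdsWithin_iff.2 ⟨?_, ?_⟩
    · have h3 := (Ad (EG := EG) (((k⁻¹ : levi 𝔤 P) : P) : G)).continuous.tendsto 0
      rw [map_zero] at h3
      exact h3.mono_left nhdsWithin_le_nhds
    · filter_upwards [self_mem_nhdsWithin] with X hX
      exact (k⁻¹).2 _ X hX
  filter_upwards [hc.eventually h2] with X hX
  obtain ⟨γ, hγ0, ⟨ε, hε, hγ⟩, hγd, hγσ⟩ := hX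
  have h3 := B.isMIntegralCurveOn_smul hγ ((k⁻¹ : levi 𝔤 P) : P)
  have hA : Ad ((((k⁻¹ : levi 𝔤 P) : P)⁻¹ : P) : G) (Ad (((k⁻¹ : levi 𝔤 P) : P) : G) X) = X := by
    rw [Subgroup.coe_inv P, Ad_inv_Ad]
  rw [hA] at h3
  refine ⟨fun t => γ t <• ((k⁻¹ : levi 𝔤 P) : P), ?_, ⟨ε, hε, h3⟩, ?_, ?_⟩
  · change γ 0 <• _ = u
    rw [hγ0, ← smul_mul, Subgroup.coe_inv, mul_inv_cancel, smul_one']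
  · rw [B.proj_smul]; exact hγd
  · have h4 := σ.equivariant (B.π 𝔤 (γ 1)) hγd k⁻¹
    rw [hγσ] at h4
    exact h4

variable (hP : IsParabolicSubgroup (EP := EP) 𝔤 P) (h𝔤 : IsOneGrading 𝔤)
include hP h𝔤

/-- Near the center of normal coordinates, every point is the projection of `F X` for some small
`X ∈ 𝔤₋₁`. -/
theorem _root_.CartanGeometry.IsNormalFlow.eventually_nhds {u : Q} {r : ℝ} {F : EG → Q}
    (hF : B.IsNormalFlow u r F)
    {p : LieAlg EG G → Prop} (hp : ∀ᶠ X in 𝓝[(𝔤 (-1) : Set (LieAlg EG G))] 0, p X) :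
    ∀ᶠ y in 𝓝 (B.proj u), ∃ X ∈ 𝔤 (-1), B.proj (F X) = y ∧ p X := by
  obtain ⟨dom, S, Xf, hd, hx, -, hpS, hX0, hXc, hXf, -⟩ := hF.exists_normalSection hP h𝔤
  have h1 : Tendsto Xf (𝓝 (B.proj u)) (𝓝[(𝔤 (-1) : Set (LieAlg EG G))] 0) := by
    refine tendsto_nhdsWithin_iff.2 ⟨?_, ?_⟩
    · have h2 := hXc.tendsto
      rwa [hX0] at h2
    · filter_upwards [hd.mem_nhds hx] with y hy using (hXf y hy).1
  filter_upwards [h1.eventually hp, hd.mem_nhds hx] with y hy hyd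
  exact ⟨Xf y, (hXf y hyd).1, by rw [← (hXf y hyd).2, hpS y hyd], hy⟩

variable (hG : LieAlgebra.IsSemisimple ℝ (LieAlg EG G)) {E : LieAlg EG G}
  (hE : IsGradingElement 𝔤 E)
include hG hE

theorem exists_isNormalAt (u : Q) : ∃ σ : B.WeylStructure 𝔤, σ.IsNormalAt u := by
  obtain ⟨r, F, hF⟩ := B.exists_isNormalFlow u
  obtain ⟨dom, S, Xf, hd, hx, hS, hpS, -, -, -, hFS⟩ := hF.exists_normalSection hP h𝔤
  obtain ⟨σ, rfl, hσ⟩ := exists_weylStructure_of_section hP h𝔤 hG hE hd hS hpS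
  refine ⟨σ, hF.isNormalAt_iff.2 ⟨hx, ?_⟩⟩
  filter_upwards [hFS] with X hX
  have h1 := hσ _ hX.1
  rw [hX.2] at h1
  exact ⟨hX.1, h1⟩

theorem apply_π_eq {σ τ : B.WeylStructure 𝔤} {v : Q} (hσ : B.proj v ∈ σ.dom) (hτ : B.proj v ∈ τ.dom)
    (hσv : σ.toFun (B.π 𝔤 v) = v) (hτv : τ.toFun (B.π 𝔤 v) = v) {b : B.Q₀ 𝔤}
    (hb : B.proj₀ 𝔤 b = B.proj v) : σ.toFun b = τ.toFun b :=
  eq_of_section hP h𝔤 hG hE (S := fun _ => v) (y := B.proj v) rfl hσ hτ hσv hτv hb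

/-- Both Weyl structures pass through `F X` for small `X ∈ 𝔤₋₁`; these points lie over a full
neighborhood, and one point per fibre determines a Weyl structure. -/
theorem IsNormalAt.eqNear {σ τ : B.WeylStructure 𝔤} {u : Q} (hσ : σ.IsNormalAt u)
    (hτ : τ.IsNormalAt u) : σ.EqNear τ (B.proj u) := by
  obtain ⟨r, F, hF⟩ := B.exists_isNormalFlow u
  obtain ⟨hσx, hσF⟩ := hF.isNormalAt_iff.1 hσ
  obtain ⟨hτx, hτF⟩ := hF.isNormalAt_iff.1 hτ
  obtain ⟨V, hV, hVo, hxV⟩ := mem_nhds_iff.1 (hF.eventually_nhds hP h𝔤 (hσF.and hτF))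
  refine ⟨V, hVo, hxV, fun y hy => ?_, fun b hb => ?_⟩
  · obtain ⟨X, -, rfl, h1, h2⟩ := hV hy
    exact ⟨h1.1, h2.1⟩
  · obtain ⟨X, -, hX, h1, h2⟩ := hV hb
    exact apply_π_eq hP h𝔤 hG hE h1.1 h2.1 h1.2 h2.2 hX.symm

/-- `σ` passes through `F X` and `F (-X)`, and `φ (F X) = F (-X) g` with `g ∈ G₀`. Thus `φ` maps one
point of the image of `σ` in each fibre into the image, and equivariance covers the rest of the
fibre. -/
theorem IsNormalAt.invariantNear {σ : B.WeylStructure 𝔤} {u : Q} (hσ : σ.IsNormalAt u)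
    {φ : B.LocalAut} {s : OpenPartialHomeomorph M M}
    (hφ : φ.Covers s (B.proj u)) {g : levi 𝔤 P} (hg : φ.toHomeo u = u <• (g : P))
    (hgX : ∀ X ∈ 𝔤 (-1), Ad ((g : P) : G) X = -X) : σ.InvariantNear φ (B.proj u) := by
  obtain ⟨V, hV, hxV, hVs, hφV⟩ := hφ
  obtain ⟨r, F, hF⟩ := B.exists_isNormalFlow u
  obtain ⟨hσx, hσF⟩ := hF.isNormalAt_iff.1 hσ
  have hus : u ∈ φ.toHomeo.source := by rw [φ.source_eq]; exact (hVs hxV).1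
  have hneg : Tendsto (fun X : LieAlg EG G => -X)
      (𝓝[(𝔤 (-1) : Set (LieAlg EG G))] 0) (𝓝[(𝔤 (-1) : Set (LieAlg EG G))] 0) := by
    refine tendsto_nhdsWithin_iff.2 ⟨?_, ?_⟩
    · have h3 : Tendsto (fun X : EG => -X) (𝓝 0) (𝓝 0) := by
        simpa using (continuous_neg (G := EG)).tendsto 0
      exact h3.mono_left nhdsWithin_le_nhds
    · filter_upwards [self_mem_nhdsWithin] with X hX
      exact neg_mem hX
  have h1 := hF.eventually_nhds hP h𝔤
    ((hσF.and (hneg.eventually hσF)).and (hF.localAut_apply hus hg hgX))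
  obtain ⟨W, hW, hWo, hxW⟩ := mem_nhds_iff.1 (h1.and (hV.mem_nhds hxV))
  have key : ∀ y ∈ W, ∃ v v' : Q, B.proj v = y ∧ y ∈ σ.dom ∧ σ.toFun (B.π 𝔤 v) = v ∧
      B.proj v' ∈ σ.dom ∧ σ.toFun (B.π 𝔤 v') = v' ∧ v ∈ φ.toHomeo.source ∧
      φ.toHomeo v = v' <• (g : P) := by
    intro y hy
    obtain ⟨⟨X, -, rfl, ⟨h2, h3⟩, h4, h5⟩, -⟩ := hW hy
    exact ⟨F X, F (-X), rfl, h2.1, h2.2, h3.1, h3.2, h4, h5⟩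
  refine ⟨W, hWo, hxW, fun y hy => ?_, fun b hb => ?_⟩
  · obtain ⟨v, v', rfl, h2, -⟩ := key y hy
    exact ⟨(hVs (hW hy).2).1, h2⟩
  · obtain ⟨w, rfl⟩ : ∃ w, B.π 𝔤 w = b := Quot.exists_rep b
    obtain ⟨v, v', h2, h3, h4, h5, h6, h7, h8⟩ := key _ hb
    obtain ⟨k, rfl⟩ := B.exists_smul_eq (u := v) (v := w) h2
    have hbase : φ.base₀ 𝔤 (B.π 𝔤 (v <• k)) = B.π 𝔤 (v' <• ((g : P) * k)) := by
      rw [φ.base₀_π (φ.smul_mem_source h7 k), φ.map_smul _ h7, h8, smul_mul]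
    refine ⟨?_, ?_⟩
    · rw [hbase]
      change B.proj _ ∈ _
      rw [B.proj_smul]; exact h5
    · rw [pullback, hbase, σ.apply_π_smul hP h𝔤 hG hE h5 h6,
        σ.apply_π_smul hP h𝔤 hG hE (by rw [h2]; exact h3) h4, hP.leviPart_levi_mul h𝔤 hG hE, smul_mul, ← h8,
        ← φ.map_smul _ h7]
      exact φ.toHomeo.left_inv (φ.smul_mem_source h7 _)

/-- On the fibre over the center, `φ` acts at `v = u k` as `k⁻¹ g k`. Invariance puts this element
in `G₀`, and the sign of `Ad g` on `𝔤₁` then forces `k ∈ G₀`. -/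
theorem IsNormalAt.eqNear_of_invariantNear {σ τ : B.WeylStructure 𝔤} {u v : Q}
    (hσ : σ.IsNormalAt u) (huv : B.proj v = B.proj u)
    {φ : B.LocalAut} (hu : u ∈ φ.toHomeo.source) {g : levi 𝔤 P} (hg : φ.toHomeo u = u <• (g : P))
    (hgZ : ∀ Z ∈ 𝔤 1, Ad ((g : P) : G) Z = -Z)
    (hτ : τ.IsNormalAt v) (hτφ : τ.InvariantNear φ (B.proj u)) : τ.EqNear σ (B.proj u) := by
  obtain ⟨k, rfl⟩ := B.exists_smul_eq huv.symm
  obtain ⟨V, -, hxV, hVd, hV⟩ := hτφ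
  have hvs : u <• k ∈ φ.toHomeo.source := by
    rw [φ.source_eq, mem_preimage, B.proj_smul]; exact (hVd hxV).1
  have h1 := hV (B.π 𝔤 (u <• k)) (by change B.proj _ ∈ _; rwa [B.proj_smul])
  have hbase : φ.base₀ 𝔤 (B.π 𝔤 (u <• k)) = B.π 𝔤 (φ.toHomeo (u <• k)) :=
    φ.base₀_π hvs
  have hφv : φ.toHomeo (u <• k) = (u <• k) <• (k⁻¹ * (g : P) * k) := by
    rw [φ.map_smul _ hu, hg, ← smul_mul, ← smul_mul]
    congr 2
    group
  obtain ⟨-, h2⟩ := h1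
  have hvd : B.proj (u <• k) ∈ τ.dom := by rw [B.proj_smul]; exact (hVd hxV).2
  set h : P := k⁻¹ * (g : P) * k with hh
  have hlev : τ.toFun (B.π 𝔤 (φ.toHomeo (u <• k))) = (u <• k) <• hP.leviPart E h := by
    rw [hφv, τ.apply_π_smul hP h𝔤 hG hE hvd hτ.apply_π]
  -- Invariance at `π(v)` says that `φ⁻¹` of `v` times the `G₀`-part of `h` is `v` again; as the
  -- action is free, `h` equals its `G₀`-part.
  have hmem : h ∈ levi 𝔤 P := by
    have h3 : (u <• k) <• hP.leviPart E h = φ.toHomeo (u <• k <• (h⁻¹ * hP.leviPart E h)) := by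
      rw [φ.map_smul _ hvs, hφv, ← smul_mul, ← smul_mul, ← smul_mul, mul_inv_cancel_left]
    rw [pullback, hbase, hlev, h3, φ.toHomeo.left_inv (φ.smul_mem_source hvs _), hτ.apply_π] at h2
    have h4 : h⁻¹ * hP.leviPart E h = 1 :=
      B.smul_injective (u := u <• k) (by rw [h2, smul_one'])
    have h5 := hP.leviPart_mem h𝔤 hG hE h
    rwa [← inv_mul_eq_one.1 h4] at h5
  -- With `Ad k E = E + Z`, the fact that `k⁻¹ g k` fixes `E` becomes `Ad g (E + Z) = E + Z`, that
  -- is `E - Z = E + Z`.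
  have hAk : Ad (k : G) E = E := by
    have h3 := hP.nilLog_mem h𝔤 hG hE k⁻¹
    set Z := IsParabolicSubgroup.nilLog E k⁻¹ with hZ
    have h4 : Ad (k : G) E = E + Z := by
      rw [hZ, IsParabolicSubgroup.nilLog, inv_inv, add_sub_cancel]
    have h5 : Ad ((k⁻¹ : P) : G) (Ad ((g : P) : G) (Ad (k : G) E)) = E := by
      rw [← Ad_mul, ← Ad_mul]
      exact IsParabolicSubgroup.Ad_levi_gradingElement h𝔤 hG hE ⟨h, hmem⟩
    have h6 := congrArg (Ad (EG := EG) (k : G)) h5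
    rw [Subgroup.coe_inv, Ad_Ad_inv, h4, map_add,
      IsParabolicSubgroup.Ad_levi_gradingElement h𝔤 hG hE g, hgZ Z h3] at h6
    have h7 : -Z = Z := add_left_cancel h6
    have h8 : (2 : ℝ) • Z = 0 := by
      rw [two_smul]; nth_rewrite 1 [← h7]; exact neg_add_cancel Z
    have h9 : Z = 0 := by
      rcases smul_eq_zero.1 h8 with h | h
      · norm_num at h
      · exact h
    rw [h4, h9, add_zero]
  have hτu : τ.IsNormalAt u :=
    IsNormalAt.of_smul_levi (k := ⟨k, IsParabolicSubgroup.mem_levi_of_Ad_eq h𝔤 hE hAk⟩) hτ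
  exact hτu.eqNear hP h𝔤 hG hE hσ

end WeylStructure

end NormalCoordinates

/-- An automorphism covering a symmetry fixes exactly one normal Weyl structure near the center. -/
theorem exists_invariant_normal_weylStructure (hP : IsParabolicSubgroup (EP := EP) 𝔤 P)
    (h𝔤 : IsOneGrading 𝔤) (hG : LieAlgebra.IsSemisimple ℝ (LieAlg EG G)) {x : M}
    {s : OpenPartialHomeomorph M M} (hs : B.IsSymmetry s x) {φ : B.LocalAut} (hφ : φ.Covers s x) :
    ∃ σ : B.WeylStructure 𝔤,
      ((∃ u : Q, B.proj u = x ∧ σ.IsNormalAt u) ∧ σ.InvariantNear φ x) ∧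
      ∀ τ : B.WeylStructure 𝔤,
        (∃ u : Q, B.proj u = x ∧ τ.IsNormalAt u) ∧ τ.InvariantNear φ x → τ.EqNear σ x := by
  have : Module.Finite ℝ (LieAlg EG G) := inferInstanceAs (FiniteDimensional ℝ EG)
  obtain ⟨E, hE0, hEl⟩ := h𝔤.exists_gradingElement hG
  have hE : IsGradingElement 𝔤 E := ⟨hE0, hEl⟩
  obtain ⟨u, g, rfl, hg, hgX, hgZ⟩ := exists_smul_levi_of_isSymmetry hP h𝔤 hG hE hs hφ
  obtain ⟨σ, hσ⟩ := WeylStructure.exists_isNormalAt (B := B) hP h𝔤 hG hE u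
  have hus : u ∈ φ.toHomeo.source := by
    obtain ⟨V, _, hxV, hVs, _⟩ := hφ
    rw [φ.source_eq]; exact (hVs hxV).1
  refine ⟨σ, ⟨⟨u, rfl, hσ⟩, hσ.invariantNear hP h𝔤 hG hE hφ hg hgX⟩, ?_⟩
  rintro τ ⟨⟨v, hv, hτ⟩, hτφ⟩
  exact hσ.eqNear_of_invariantNear hP h𝔤 hG hE hv hus hg hgZ hτ hτφ

end CartanGeometry

/-! ### Regularity of frame forms in tangent bundle charts. -/

namespace CartanGeometry

variable {EG : Type*} [NormedAddCommGroup EG] [NormedSpace ℝ EG] [FiniteDimensional ℝ EG]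
  [CompleteSpace EG]
  {G : Type*} [TopologicalSpace G] [T2Space G] [ChartedSpace EG G] [Group G]
  [LieGroup 𝓘(ℝ, EG) ∞ G]
  {𝔤 : ℤ → Submodule ℝ (LieAlg EG G)}
  {EP : Type*} [NormedAddCommGroup EP] [NormedSpace ℝ EP] [FiniteDimensional ℝ EP]
  {P : Subgroup G} [ChartedSpace EP P] [LieGroup 𝓘(ℝ, EP) ∞ P]
  {EM : Type*} [NormedAddCommGroup EM] [NormedSpace ℝ EM] [FiniteDimensional ℝ EM]
  {M : Type*} [TopologicalSpace M] [T2Space M] [ChartedSpace EM M] [IsManifold 𝓘(ℝ, EM) ∞ M]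
  {EQ : Type*} [NormedAddCommGroup EQ] [NormedSpace ℝ EQ] [FiniteDimensional ℝ EQ]
  {Q : Type*} [TopologicalSpace Q] [T2Space Q] [ChartedSpace EQ Q] [IsManifold 𝓘(ℝ, EQ) ∞ Q]
  [MulAction (P)ᵐᵒᵖ Q]
  [GradedLieAlgebra 𝔤]
  (B : CartanGeometry EG EP P EM M EQ Q)

section FrameCoordinates

/-- The constant vector fields at `u`, as a linear map. -/
def constFieldL (u : Q) : EG →L[ℝ] EQ :=
  LinearMap.toContinuousLinearMap
    { toFun := fun X => B.constField (X : LieAlg EG G) u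
      map_add' := fun X Y => B.constField_add X Y u
      map_smul' := fun c X => B.constField_smul c X u }

/-- The map `X ↦ ⟦u, X⟧`, as a linear map. -/
def tangentVecL (u : Q) : EG →L[ℝ] EM :=
  (mfderiv 𝓘(ℝ, EQ) 𝓘(ℝ, EM) B.proj u : EQ →L[ℝ] EM).comp (B.constFieldL u)

variable (𝔤) in
/-- The degree `-1` part of the Lie algebra as a subspace of the model space. -/
def negPart : Submodule ℝ EG := 𝔤 (-1)

/-- The frame `X ↦ ⟦u, X⟧` of the tangent space, in the tangent bundle chart at `y₀`. -/
def frameCoord (y₀ : M) (u : Q) : EG →L[ℝ] EM :=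
  ((trivializationAt EM (TangentSpace 𝓘(ℝ, EM) : M → Type _) y₀).continuousLinearMapAt ℝ (B.proj u) :
    EM →L[ℝ] EM).comp (B.tangentVecL u)

omit [GradedLieAlgebra 𝔤] in
theorem frameCoord_apply {y₀ : M} {u : Q}
    (hu : B.proj u ∈ (trivializationAt EM (TangentSpace 𝓘(ℝ, EM) : M → Type _) y₀).baseSet) (X : EG) :
    B.frameCoord y₀ u X = (trivializationAt EM (TangentSpace 𝓘(ℝ, EM) : M → Type _) y₀
      (⟨B.proj u, B.tangentVec u (X : LieAlg EG G)⟩ : TangentBundle 𝓘(ℝ, EM) M)).2 :=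
  congrFun (Bundle.Trivialization.coe_linearMapAt_of_mem (R := ℝ)
    (trivializationAt EM (TangentSpace 𝓘(ℝ, EM) : M → Type _) y₀) hu) _

omit [GradedLieAlgebra 𝔤] in
theorem contMDiff_tangentVec (X : LieAlg EG G) : ContMDiff 𝓘(ℝ, EQ) 𝓘(ℝ, EM).tangent ∞
    (fun u : Q => (⟨B.proj u, B.tangentVec u X⟩ : TangentBundle 𝓘(ℝ, EM) M)) := by
  rw [← contMDiffOn_univ]
  exact B.contMDiff_proj.contMDiffOn.mfderiv_apply isOpen_univ
    (B.contMDiff_constField X).contMDiffOn (mapsTo_id _)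

omit [GradedLieAlgebra 𝔤] in
theorem eventually_mem_baseSet (u₀ : Q) : ∀ᶠ u in 𝓝 u₀,
    B.proj u ∈ (trivializationAt EM (TangentSpace 𝓘(ℝ, EM) : M → Type _) (B.proj u₀)).baseSet :=
  B.contMDiff_proj.continuous.continuousAt.preimage_mem_nhds
    ((trivializationAt EM (TangentSpace 𝓘(ℝ, EM) : M → Type _) (B.proj u₀)).open_baseSet.mem_nhds
      (FiberBundle.mem_baseSet_trivializationAt' _))

omit [GradedLieAlgebra 𝔤] in
theorem contMDiffAt_frameCoord (u₀ : Q) :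
    ContMDiffAt 𝓘(ℝ, EQ) 𝓘(ℝ, EG →L[ℝ] EM) ∞ (B.frameCoord (B.proj u₀)) u₀ := by
  refine contMDiffAt_clm_of_apply fun X => ?_
  have h1 := (Bundle.contMDiffAt_totalSpace.1 (B.contMDiff_tangentVec X u₀)).2
  refine h1.congr_of_eventuallyEq ?_
  filter_upwards [B.eventually_mem_baseSet u₀] with u hu
  exact B.frameCoord_apply hu X

variable (hP : IsParabolicSubgroup (EP := EP) 𝔤 P) (h𝔤 : IsOneGrading 𝔤)
include hP h𝔤

theorem isInvertible_tangentVecL (u : Q) :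
    ((B.tangentVecL u).comp (negPart 𝔤).subtypeL).IsInvertible := by
  have : CompleteSpace EM := FiniteDimensional.complete ℝ EM
  have : CompleteSpace (negPart 𝔤) := FiniteDimensional.complete ℝ _
  refine ContinuousLinearMap.isInvertible_of_bijective ⟨fun X Y h => ?_, fun ξ => ?_⟩
  · exact Subtype.ext (B.eq_of_tangentVec_eq hP h𝔤 X.2 Y.2 h)
  · obtain ⟨X, hX, hXξ⟩ := B.exists_mem_tangentVec_eq hP h𝔤 u ξ
    exact ⟨⟨X, hX⟩, hXξ⟩

theorem isInvertible_frameCoord {y₀ : M} {u : Q}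
    (hu : B.proj u ∈ (trivializationAt EM (TangentSpace 𝓘(ℝ, EM) : M → Type _) y₀).baseSet) :
    ((B.frameCoord y₀ u).comp (negPart 𝔤).subtypeL).IsInvertible := by
  have h1 : ((trivializationAt EM (TangentSpace 𝓘(ℝ, EM) : M → Type _) y₀).continuousLinearMapAt ℝ
      (B.proj u) : EM →L[ℝ] EM).IsInvertible := by
    refine ⟨((trivializationAt EM (TangentSpace 𝓘(ℝ, EM) : M → Type _) y₀).continuousLinearEquivAt ℝ
      _ hu : EM ≃L[ℝ] EM), ?_⟩
    exact (Bundle.Trivialization.coe_continuousLinearEquivAt_eq' _ hu)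
  exact h1.comp (B.isInvertible_tangentVecL hP h𝔤 u)

/-- The frame form is defined by a pointwise choice. This formula exhibits it as the inverse of a
smooth family of isomorphisms applied to the coordinates of `η`, so it inherits the regularity of
`η`. -/
theorem frameForm_eq (η : ∀ y : M, TangentSpace 𝓘(ℝ, EM) y) (u₀ : Q) :
    B.frameForm 𝔤 η =ᶠ[𝓝 u₀] fun u => (negPart 𝔤).subtypeL
      (((B.frameCoord (B.proj u₀) u).comp (negPart 𝔤).subtypeL).inverse
        (trivializationAt EM (TangentSpace 𝓘(ℝ, EM) : M → Type _) (B.proj u₀)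
          (⟨B.proj u, η (B.proj u)⟩ : TangentBundle 𝓘(ℝ, EM) M)).2) := by
  filter_upwards [B.eventually_mem_baseSet u₀] with u hu
  have h1 : (⟨B.frameForm 𝔤 η u, B.frameForm_mem hP h𝔤 η u⟩ : negPart 𝔤)
      = ((B.frameCoord (B.proj u₀) u).comp (negPart 𝔤).subtypeL).inverse
        (trivializationAt EM (TangentSpace 𝓘(ℝ, EM) : M → Type _) (B.proj u₀)
          (⟨B.proj u, η (B.proj u)⟩ : TangentBundle 𝓘(ℝ, EM) M)).2 := by
    symm
    rw [(B.isInvertible_frameCoord hP h𝔤 hu).inverse_apply_eq]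
    rw [← B.tangentVec_frameForm hP h𝔤 η u]
    exact (B.frameCoord_apply hu _).symm
  exact congrArg (negPart 𝔤).subtypeL h1

theorem contMDiffAt_frameForm {η : ∀ y : M, TangentSpace 𝓘(ℝ, EM) y} {u : Q}
    (hη : ContMDiffAt 𝓘(ℝ, EM) 𝓘(ℝ, EM).tangent ∞
      (fun y => (⟨y, η y⟩ : TangentBundle 𝓘(ℝ, EM) M)) (B.proj u)) :
    ContMDiffAt 𝓘(ℝ, EQ) 𝓘(ℝ, EG) ∞ (B.frameForm 𝔤 η) u := by
  have : CompleteSpace (negPart 𝔤) := FiniteDimensional.complete ℝ _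
  refine ContMDiffAt.congr_of_eventuallyEq ?_ (B.frameForm_eq hP h𝔤 η u)
  refine (negPart 𝔤).subtypeL.contDiff.contMDiff.contMDiffAt.comp u ?_
  refine ContMDiffAt.clm_apply (ContinuousLinearMap.contMDiffAt_inverse
    ((B.contMDiffAt_frameCoord u).clm_comp contMDiffAt_const)
    (B.isInvertible_frameCoord hP h𝔤 (FiberBundle.mem_baseSet_trivializationAt' _))) ?_
  have h1 : ContMDiffAt 𝓘(ℝ, EM) 𝓘(ℝ, EM) ∞ (fun y =>
      (trivializationAt EM (TangentSpace 𝓘(ℝ, EM) : M → Type _) (B.proj u)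
        (⟨y, η y⟩ : TangentBundle 𝓘(ℝ, EM) M)).2) (B.proj u) := (Bundle.contMDiffAt_section _).1 hη
  exact h1.comp u (B.contMDiff_proj u)

theorem mdifferentiableAt_frameForm {η : ∀ y : M, TangentSpace 𝓘(ℝ, EM) y} {u : Q}
    (hη : MDifferentiableAt 𝓘(ℝ, EM) 𝓘(ℝ, EM).tangent
      (fun y => (⟨y, η y⟩ : TangentBundle 𝓘(ℝ, EM) M)) (B.proj u)) :
    MDifferentiableAt 𝓘(ℝ, EQ) 𝓘(ℝ, EG) (B.frameForm 𝔤 η) u := by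
  have : CompleteSpace (negPart 𝔤) := FiniteDimensional.complete ℝ _
  refine MDifferentiableAt.congr_of_eventuallyEq ?_ (B.frameForm_eq hP h𝔤 η u)
  refine ((negPart 𝔤).subtypeL.contDiff.contMDiff.mdifferentiable (n := ∞) (by simp) _).comp u ?_
  refine MDifferentiableAt.clm_apply (ContMDiffAt.mdifferentiableAt
    (ContinuousLinearMap.contMDiffAt_inverse
    ((B.contMDiffAt_frameCoord u).clm_comp contMDiffAt_const)
    (B.isInvertible_frameCoord hP h𝔤 (FiberBundle.mem_baseSet_trivializationAt' _))) (by simp)) ?_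
  have h1 : MDifferentiableAt 𝓘(ℝ, EM) 𝓘(ℝ, EM) (fun y =>
      (trivializationAt EM (TangentSpace 𝓘(ℝ, EM) : M → Type _) (B.proj u)
        (⟨y, η y⟩ : TangentBundle 𝓘(ℝ, EM) M)).2) (B.proj u) := (mdifferentiableAt_section _ _).1 hη
  exact h1.comp u (B.mdifferentiable_proj u)

end FrameCoordinates

end CartanGeometry

/-! ### The covariant derivative determined by a point of `Q`. -/

namespace CartanGeometry

variable {EG : Type*} [NormedAddCommGroup EG] [NormedSpace ℝ EG] [FiniteDimensional ℝ EG]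
  [CompleteSpace EG]
  {G : Type*} [TopologicalSpace G] [T2Space G] [ChartedSpace EG G] [Group G]
  [LieGroup 𝓘(ℝ, EG) ∞ G]
  {𝔤 : ℤ → Submodule ℝ (LieAlg EG G)}
  {EP : Type*} [NormedAddCommGroup EP] [NormedSpace ℝ EP] [FiniteDimensional ℝ EP]
  {P : Subgroup G} [ChartedSpace EP P] [LieGroup 𝓘(ℝ, EP) ∞ P]
  {EM : Type*} [NormedAddCommGroup EM] [NormedSpace ℝ EM] [FiniteDimensional ℝ EM]
  {M : Type*} [TopologicalSpace M] [T2Space M] [ChartedSpace EM M] [IsManifold 𝓘(ℝ, EM) ∞ M]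
  {EQ : Type*} [NormedAddCommGroup EQ] [NormedSpace ℝ EQ] [FiniteDimensional ℝ EQ]
  {Q : Type*} [TopologicalSpace Q] [T2Space Q] [ChartedSpace EQ Q] [IsManifold 𝓘(ℝ, EQ) ∞ Q]
  [MulAction (P)ᵐᵒᵖ Q]
  [GradedLieAlgebra 𝔤]
  (B : CartanGeometry EG EP P EM M EQ Q)

section PointwiseDerivative

variable (𝔤) in
/-- The covariant derivative of `η` at `p(u)` for which the frame vector fields that are constant
along `ω⁻¹(𝔤₋₁)` at `u` are parallel. -/
def covAt (η : ∀ y : M, TangentSpace 𝓘(ℝ, EM) y) (u : Q) : EM →L[ℝ] EM :=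
  (B.tangentVecL u).comp <|
    (mfderiv 𝓘(ℝ, EQ) 𝓘(ℝ, EG) (B.frameForm 𝔤 η) u : EQ →L[ℝ] EG).comp <|
      (B.constFieldL u).comp <| (negPart 𝔤).subtypeL.comp
        ((B.tangentVecL u).comp (negPart 𝔤).subtypeL).inverse

variable (hP : IsParabolicSubgroup (EP := EP) 𝔤 P) (h𝔤 : IsOneGrading 𝔤)
include hP h𝔤

theorem covAt_tangentVec (η : ∀ y : M, TangentSpace 𝓘(ℝ, EM) y) (u : Q) {X : LieAlg EG G}
    (hX : X ∈ 𝔤 (-1)) : B.covAt 𝔤 η u (B.tangentVec u X)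
      = B.tangentVec u (mfderiv 𝓘(ℝ, EQ) 𝓘(ℝ, EG) (B.frameForm 𝔤 η) u (B.constField X u)) := by
  have h1 : ((B.tangentVecL u).comp (negPart 𝔤).subtypeL).inverse (B.tangentVecL u (X : EG))
      = (⟨X, hX⟩ : negPart 𝔤) := (B.isInvertible_tangentVecL hP h𝔤 u).inverse_apply_eq.2 rfl
  let D : EQ →L[ℝ] EG := mfderiv 𝓘(ℝ, EQ) 𝓘(ℝ, EG) (B.frameForm 𝔤 η) u
  exact congrArg (fun Y : negPart 𝔤 => B.tangentVecL u (D (B.constFieldL u (Y : EG)))) h1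

theorem covAt_ext {A : EM →L[ℝ] EM} {η : ∀ y : M, TangentSpace 𝓘(ℝ, EM) y} {u : Q}
    (h : ∀ X ∈ 𝔤 (-1), A (B.tangentVec u X)
      = B.tangentVec u (mfderiv 𝓘(ℝ, EQ) 𝓘(ℝ, EG) (B.frameForm 𝔤 η) u (B.constField X u))) :
    B.covAt 𝔤 η u = A := by
  refine ContinuousLinearMap.ext fun ξ => ?_
  obtain ⟨X, hX, hXξ⟩ := B.exists_mem_tangentVec_eq hP h𝔤 u ξ
  have h1 : (B.tangentVec u X : EM) = ξ := hXξ
  rw [← h1]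
  exact (B.covAt_tangentVec hP h𝔤 η u hX).trans (h X hX).symm

theorem frameForm_smul_levi (η : ∀ y : M, TangentSpace 𝓘(ℝ, EM) y) (u : Q) (g : levi 𝔤 P) :
    B.frameForm 𝔤 η (u <• (g : P)) = Ad ((((g : P)⁻¹ : P)) : G) (B.frameForm 𝔤 η u) := by
  have h0 : ∀ y, y = B.proj u → (η y : EM) = η (B.proj u) := by rintro _ rfl; rfl
  refine (B.eq_frameForm hP h𝔤 ((g⁻¹).2 _ _ (B.frameForm_mem hP h𝔤 η u)) ?_).symm
  refine (B.tangentVec_smul_Ad u (g : P) (B.frameForm 𝔤 η u)).trans ?_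
  exact (B.tangentVec_frameForm hP h𝔤 η u : _ = (η (B.proj u) : EM)).trans
    (h0 _ (B.proj_smul u (g : P))).symm

/-- `Ad(exp Z)` acts trivially on `𝔤/𝔭`, so the points `u` and `u exp Z` define the same frame. -/
theorem frameForm_smul_exp (η : ∀ y : M, TangentSpace 𝓘(ℝ, EM) y) (u : Q) {Z : LieAlg EG G}
    (hZ : Z ∈ 𝔤 1) : B.frameForm 𝔤 η (u <• hP.exp Z) = B.frameForm 𝔤 η u := by
  have h0 : ∀ y, y = B.proj u → (η y : EM) = η (B.proj u) := by rintro _ rfl; rfl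
  refine (B.eq_frameForm hP h𝔤 (B.frameForm_mem hP h𝔤 η u) ?_).symm
  have key : ∀ f : LieAlg EG G, (B.tangentVec (u <• hP.exp Z) f : EM) = B.tangentVec u f := by
    intro f
    have h1 := B.tangentVec_smul_Ad u (hP.exp Z) (Ad (hP.exp Z : G) f)
    rw [Subgroup.coe_inv, Ad_inv_Ad] at h1
    rw [h1, ← B.tangentVec_grComp hP h𝔤 u (Ad _ f),
      hP.val_exp (IsParabolicSubgroup.mem_filt_zero_of_mem_one hZ),
      hP.grComp_Ad_lieExp h𝔤 hZ, B.tangentVec_grComp hP h𝔤 u]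
  exact (key _).trans ((B.tangentVec_frameForm hP h𝔤 η u : _ = (η (B.proj u) : EM)).trans
    (h0 _ (B.proj_smul u _)).symm)

/-- The constant field of `Z` at `u` is the velocity of `t ↦ u exp(tZ)`, and the frame form is
constant along this curve. -/
theorem mfderiv_frameForm_constField_eq_zero {η : ∀ y : M, TangentSpace 𝓘(ℝ, EM) y} {u : Q}
    (hη : MDifferentiableAt 𝓘(ℝ, EQ) 𝓘(ℝ, EG) (B.frameForm 𝔤 η) u) {Z : LieAlg EG G}
    (hZ : Z ∈ 𝔤 1) :
    (mfderiv 𝓘(ℝ, EQ) 𝓘(ℝ, EG) (B.frameForm 𝔤 η) u : EQ →L[ℝ] EG) (B.constField Z u) = 0 := by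
  let k : ℝ → P := fun t => hP.exp (t • Z)
  have hk0 : k 0 = 1 := by
    simp only [k, zero_smul]
    exact hP.exp_zero
  have hk : MDifferentiableAt 𝓘(ℝ, ℝ) 𝓘(ℝ, EP) k 0 := by
    let Z' : EG := Z
    have h0 : ContMDiff 𝓘(ℝ, EG) 𝓘(ℝ, EP) ∞ (fun X : EG => hP.exp (X : LieAlg EG G)) :=
      hP.contMDiff_exp
    have h1 : ContMDiff 𝓘(ℝ, ℝ) 𝓘(ℝ, EG) ∞ (fun t : ℝ => t • Z') :=
      (contDiff_id.smul contDiff_const).contMDiff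
    exact (h0.comp h1).mdifferentiable (by simp) 0
  have ho : MDifferentiableAt 𝓘(ℝ, EP) 𝓘(ℝ, EQ) (fun h : P => u <• h) 1 :=
    (B.contMDiff_orbit u).mdifferentiable (by simp) 1
  let Y : EP := (mfderiv 𝓘(ℝ, ℝ) 𝓘(ℝ, EP) k 0 : ℝ →L[ℝ] EP) 1
  have hY : (mfderiv 𝓘(ℝ, EP) 𝓘(ℝ, EG) (Subtype.val : P → G) 1 : EP →L[ℝ] EG) Y = Z := by
    have h1 := mfderiv_apply_of_eventuallyEq_comp (h := fun t : ℝ => (k t : G))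
      (hP.contMDiff_val.mdifferentiable (by simp) 1) hk hk0 (Eventually.of_forall fun _ => rfl) 1
    have h2 : (fun t : ℝ => (k t : G)) = lieCurve Z := by
      funext t
      rw [lieCurve_eq_lieExp]
      exact hP.val_exp (IsParabolicSubgroup.mem_filt_zero_of_mem_one (Submodule.smul_mem _ _ hZ))
    rw [h2, (hasMFDerivAt_lieCurve_zero Z).mfderiv] at h1
    exact h1.symm.trans (one_smul ℝ (Z : EG))
  have hYo : (mfderiv 𝓘(ℝ, EP) 𝓘(ℝ, EQ) (fun h : P => u <• h) 1 : EP →L[ℝ] EQ) Y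
      = B.constField Z u := by
    have h1 := (B.form_fundamental u Y).trans hY
    have h3 : ∀ (v : Q) (w : EQ), v = u → (B.form v : EQ →L[ℝ] EG) w = Z → w = B.constField Z u := by
      rintro _ w rfl hw; exact B.eq_constField hw
    exact h3 u _ rfl h1
  have h1 := mfderiv_apply_of_eventuallyEq_comp (h := fun t : ℝ => u <• k t) ho hk hk0
    (Eventually.of_forall fun _ => rfl) 1
  have hu0 : u <• k 0 = u := by rw [hk0, smul_one']
  have hok : MDifferentiableAt 𝓘(ℝ, ℝ) 𝓘(ℝ, EQ) (fun t : ℝ => u <• k t) 0 :=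
    ((B.contMDiff_orbit u).mdifferentiable (by simp) _).comp 0 hk
  have h2 := mfderiv_apply_of_eventuallyEq_comp (h := fun _ : ℝ => B.frameForm 𝔤 η u)
    hη hok hu0 (Eventually.of_forall fun t =>
      (B.frameForm_smul_exp hP h𝔤 η u (Submodule.smul_mem _ t hZ)).symm) 1
  rw [mfderiv_const] at h2
  have h3 := h1.trans hYo
  exact (congrArg (mfderiv 𝓘(ℝ, EQ) 𝓘(ℝ, EG) (B.frameForm 𝔤 η) u : EQ →L[ℝ] EG) h3).symm.trans
    h2.symm

/-- Right translation by `g` changes frame, frame form and constant field each by `Ad g⁻¹`, and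
these changes cancel. The derivative thus depends only on the `G₀`-orbit of `u`. -/
theorem covAt_smul_levi {η : ∀ y : M, TangentSpace 𝓘(ℝ, EM) y} {u : Q}
    (hη : MDifferentiableAt 𝓘(ℝ, EM) 𝓘(ℝ, EM).tangent
      (fun y => (⟨y, η y⟩ : TangentBundle 𝓘(ℝ, EM) M)) (B.proj u)) (g : levi 𝔤 P) :
    B.covAt 𝔤 η (u <• (g : P)) = B.covAt 𝔤 η u := by
  symm
  refine B.covAt_ext hP h𝔤 fun X hX => ?_
  have hf := B.mdifferentiableAt_frameForm hP h𝔤 hη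
  have hf' : MDifferentiableAt 𝓘(ℝ, EQ) 𝓘(ℝ, EG) (B.frameForm 𝔤 η) (u <• (g : P)) :=
    B.mdifferentiableAt_frameForm hP h𝔤 (by rw [B.proj_smul]; exact hη)
  have hX' : Ad (((g : P)⁻¹ : P) : G) X ∈ 𝔤 (-1) := (g⁻¹).2 _ _ hX
  have h1 := B.covAt_tangentVec hP h𝔤 η (u <• (g : P)) hX'
  let L : EG →L[ℝ] EG := Ad (EG := EG) (((g : P)⁻¹ : P) : G)
  have h2 := mfderiv_apply_of_eventuallyEq_comp (h := fun u : Q => L (B.frameForm 𝔤 η u)) hf'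
    ((B.contMDiff_smul_right (g : P)).mdifferentiable (by simp) u) rfl
    (Eventually.of_forall fun u => (B.frameForm_smul_levi hP h𝔤 η u g).symm) (B.constField X u)
  have h3 := mfderiv_apply_of_eventuallyEq_comp (h := fun u : Q => L (B.frameForm 𝔤 η u))
    (L.contDiff.contMDiff.mdifferentiable (n := ∞) (by simp) (B.frameForm 𝔤 η u)) hf rfl
    (Eventually.of_forall fun u => rfl) (B.constField X u)
  rw [mfderiv_eq_fderiv, L.fderiv] at h3
  let D : EQ →L[ℝ] EG := mfderiv 𝓘(ℝ, EQ) 𝓘(ℝ, EG) (B.frameForm 𝔤 η) (u <• (g : P))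
  have h4 : D (B.constField (Ad (((g : P)⁻¹ : P) : G) X) (u <• (g : P)))
      = L ((mfderiv 𝓘(ℝ, EQ) 𝓘(ℝ, EG) (B.frameForm 𝔤 η) u : EQ →L[ℝ] EG) (B.constField X u)) :=
    (congrArg D (B.mfderiv_smul_constField (g : P) u X)).symm.trans (h2.symm.trans h3)
  refine (congrArg (B.covAt 𝔤 η (u <• (g : P))) (B.tangentVec_smul_Ad u (g : P) X)).symm.trans
    (h1.trans ((congrArg (B.tangentVecL (u <• (g : P))) h4).trans ?_))
  exact B.tangentVec_smul_Ad u (g : P) _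

theorem frameForm_add (η η' : ∀ y : M, TangentSpace 𝓘(ℝ, EM) y) :
    B.frameForm 𝔤 (η + η') = B.frameForm 𝔤 η + B.frameForm 𝔤 η' := by
  funext u
  refine (B.eq_frameForm hP h𝔤 (add_mem (B.frameForm_mem hP h𝔤 η u)
    (B.frameForm_mem hP h𝔤 η' u)) ?_).symm
  exact (B.tangentVec_add u _ _).trans (congrArg₂ (· + ·) (B.tangentVec_frameForm hP h𝔤 η u)
    (B.tangentVec_frameForm hP h𝔤 η' u))

theorem frameForm_smul (f : M → ℝ) (η : ∀ y : M, TangentSpace 𝓘(ℝ, EM) y) :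
    B.frameForm 𝔤 (f • η) = fun u => f (B.proj u) • B.frameForm 𝔤 η u := by
  funext u
  refine (B.eq_frameForm hP h𝔤 (Submodule.smul_mem _ (f (B.proj u))
    (B.frameForm_mem hP h𝔤 η u)) ?_).symm
  exact (B.tangentVec_smul u _ _).trans
    (congrArg (f (B.proj u) • ·) (B.tangentVec_frameForm hP h𝔤 η u))

theorem covAt_add {η η' : ∀ y : M, TangentSpace 𝓘(ℝ, EM) y} {u : Q}
    (hη : MDifferentiableAt 𝓘(ℝ, EQ) 𝓘(ℝ, EG) (B.frameForm 𝔤 η) u)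
    (hη' : MDifferentiableAt 𝓘(ℝ, EQ) 𝓘(ℝ, EG) (B.frameForm 𝔤 η') u) :
    B.covAt 𝔤 (η + η') u = B.covAt 𝔤 η u + B.covAt 𝔤 η' u := by
  refine B.covAt_ext hP h𝔤 fun X hX => ?_
  have h1 := B.covAt_tangentVec hP h𝔤 η u hX
  have h2 := B.covAt_tangentVec hP h𝔤 η' u hX
  have h3 := mfderiv_add hη hη'
  rw [← B.frameForm_add hP h𝔤] at h3
  have h4 := congrArg (fun L : EQ →L[ℝ] EG => B.tangentVecL u (L (B.constField X u))) h3
  refine Eq.trans ?_ h4.symm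
  exact (congrArg₂ (fun a b : EM => a + b) h1 h2).trans ((B.tangentVecL u).map_add _ _).symm

theorem covAt_smul {f : M → ℝ} {η : ∀ y : M, TangentSpace 𝓘(ℝ, EM) y} {u : Q}
    (hf : MDifferentiableAt 𝓘(ℝ, EM) 𝓘(ℝ, ℝ) f (B.proj u))
    (hη : MDifferentiableAt 𝓘(ℝ, EQ) 𝓘(ℝ, EG) (B.frameForm 𝔤 η) u) :
    ∀ ξ v : EM, v = η (B.proj u) → B.covAt 𝔤 (f • η) u ξ = f (B.proj u) • B.covAt 𝔤 η u ξ
      + (mvfderiv 𝓘(ℝ, EM) f (B.proj u) : EM →L[ℝ] ℝ) ξ • v := by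
  intro ξ v hv
  obtain ⟨X, hX, hXξ⟩ := B.exists_mem_tangentVec_eq hP h𝔤 u ξ
  have hξ : (B.tangentVec u X : EM) = ξ := hXξ
  rw [← hξ]
  let Dw : EG :=
    (mfderiv 𝓘(ℝ, EQ) 𝓘(ℝ, EG) (B.frameForm 𝔤 η) u : EQ →L[ℝ] EG) (B.constField X u)
  let df : EM →L[ℝ] ℝ := mvfderiv 𝓘(ℝ, EM) f (B.proj u)
  have h0 := B.covAt_tangentVec hP h𝔤 (f • η) u hX
  have h1 := B.covAt_tangentVec hP h𝔤 η u hX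
  have hfp : MDifferentiableAt 𝓘(ℝ, EQ) 𝓘(ℝ, ℝ) (fun u => f (B.proj u)) u :=
    hf.comp u (B.mdifferentiable_proj u)
  have h2 := mfderiv_apply_of_eventuallyEq_comp (h := fun u => f (B.proj u)) hf
    (B.mdifferentiable_proj u) rfl (Eventually.of_forall fun _ => rfl) (B.constField X u)
  have h3 := congrArg (fun L => (L : EQ →L[ℝ] EG) (B.constField X u)) (mvfderiv_smul hfp hη)
  have h4 : (mfderiv 𝓘(ℝ, EQ) 𝓘(ℝ, EG) (B.frameForm 𝔤 (f • η)) u : EQ →L[ℝ] EG) (B.constField X u)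
      = f (B.proj u) • Dw + df (B.tangentVec u X) • B.frameForm 𝔤 η u := by
    rw [B.frameForm_smul hP h𝔤]
    exact h3.trans (congrArg (fun r : ℝ => f (B.proj u) • Dw + r • B.frameForm 𝔤 η u) h2)
  have h5 := congrArg (B.tangentVecL u) h4
  rw [map_add, map_smul, map_smul] at h5
  refine h0.trans (h5.trans ?_)
  exact congrArg₂ (fun a b : EM => f (B.proj u) • a
    + df (B.tangentVec u X) • b) h1.symm
    ((B.tangentVec_frameForm hP h𝔤 η u : _ = (η (B.proj u) : EM)).trans hv.symm)

end PointwiseDerivative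

end CartanGeometry

/-! ### The Weyl connection of a Weyl structure. -/

namespace CartanGeometry

variable {EG : Type*} [NormedAddCommGroup EG] [NormedSpace ℝ EG] [FiniteDimensional ℝ EG]
  [CompleteSpace EG]
  {G : Type*} [TopologicalSpace G] [T2Space G] [ChartedSpace EG G] [Group G]
  [LieGroup 𝓘(ℝ, EG) ∞ G]
  {𝔤 : ℤ → Submodule ℝ (LieAlg EG G)}
  {EP : Type*} [NormedAddCommGroup EP] [NormedSpace ℝ EP] [FiniteDimensional ℝ EP]
  {P : Subgroup G} [ChartedSpace EP P] [LieGroup 𝓘(ℝ, EP) ∞ P]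
  {EM : Type*} [NormedAddCommGroup EM] [NormedSpace ℝ EM] [FiniteDimensional ℝ EM]
  {M : Type*} [TopologicalSpace M] [T2Space M] [ChartedSpace EM M] [IsManifold 𝓘(ℝ, EM) ∞ M]
  {EQ : Type*} [NormedAddCommGroup EQ] [NormedSpace ℝ EQ] [FiniteDimensional ℝ EQ]
  {Q : Type*} [TopologicalSpace Q] [T2Space Q] [ChartedSpace EQ Q] [IsManifold 𝓘(ℝ, EQ) ∞ Q]
  [MulAction (P)ᵐᵒᵖ Q]
  [GradedLieAlgebra 𝔤]
  {B : CartanGeometry EG EP P EM M EQ Q}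

namespace WeylStructure

variable (σ : B.WeylStructure 𝔤)

omit [GradedLieAlgebra 𝔤] [CompleteSpace EG] [T2Space G] [FiniteDimensional ℝ EP] [T2Space M]
  [T2Space Q] [FiniteDimensional ℝ EM] [FiniteDimensional ℝ EQ] in
theorem proj_apply_π {u : Q} (hu : B.proj u ∈ σ.dom) :
    B.proj (σ.toFun (B.π 𝔤 u)) = B.proj u :=
  congrArg (B.proj₀ 𝔤) (σ.section_eq (B.π 𝔤 u) hu)

omit [GradedLieAlgebra 𝔤] [CompleteSpace EG] [T2Space G] [FiniteDimensional ℝ EP] [T2Space M]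
  [T2Space Q] [FiniteDimensional ℝ EM] [FiniteDimensional ℝ EQ] in
theorem apply_π_apply_π {u : Q} (hu : B.proj u ∈ σ.dom) :
    σ.toFun (B.π 𝔤 (σ.toFun (B.π 𝔤 u))) = σ.toFun (B.π 𝔤 u) :=
  congrArg σ.toFun (σ.section_eq (B.π 𝔤 u) hu)

theorem exists_lift (y : M) :
    ∃ u, B.proj u = y ∧ (y ∈ σ.dom → σ.toFun (B.π 𝔤 u) = u) := by
  obtain ⟨u, rfl⟩ := B.exists_proj_eq y
  by_cases hu : B.proj u ∈ σ.dom
  · exact ⟨_, σ.proj_apply_π hu, fun _ => σ.apply_π_apply_π hu⟩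
  · exact ⟨u, rfl, fun h => absurd h hu⟩

/-- A point of the image of `σ` over `y`. -/
def lift (y : M) : Q := Classical.choose (σ.exists_lift y)

theorem proj_lift (y : M) : B.proj (σ.lift y) = y := (Classical.choose_spec (σ.exists_lift y)).1

theorem apply_π_lift {y : M} (hy : y ∈ σ.dom) : σ.toFun (B.π 𝔤 (σ.lift y)) = σ.lift y :=
  (Classical.choose_spec (σ.exists_lift y)).2 hy

theorem exists_contMDiffOn_lift {y₀ : M} (hy₀ : y₀ ∈ σ.dom) : ∃ (U : Set M) (S : M → Q), IsOpen U ∧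
    y₀ ∈ U ∧ ContMDiffOn 𝓘(ℝ, EM) 𝓘(ℝ, EQ) ∞ S U ∧
    ∀ y ∈ U, y ∈ σ.dom ∧ B.proj (S y) = y ∧ σ.toFun (B.π 𝔤 (S y)) = S y := by
  obtain ⟨e, hx, hes, het, he⟩ := B.exists_trivialization y₀
  let S₀ : M → Q := fun y => e.toOpenPartialHomeomorph.symm (y, (1 : P))
  have ht : ∀ y ∈ e.baseSet, (y, (1 : P)) ∈ e.target := fun y hy => e.mem_target.2 hy
  have hp : ∀ y ∈ e.baseSet, B.proj (S₀ y) = y := fun y hy => e.proj_symm_apply (ht y hy)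
  have hS₀ : ContMDiffOn 𝓘(ℝ, EM) 𝓘(ℝ, EQ) ∞ S₀ e.baseSet :=
    het.comp (f := fun y : M => (y, (1 : P))) (contMDiff_id.prodMk contMDiff_const).contMDiffOn ht
  refine ⟨e.baseSet ∩ σ.dom, fun y => σ.toFun (B.π 𝔤 (S₀ y)), e.open_baseSet.inter σ.isOpen_dom,
    ⟨hx, hy₀⟩, ?_, fun y hy => ?_⟩
  · refine σ.smooth.comp (hS₀.mono inter_subset_left) fun y hy => ?_
    change B.proj (S₀ y) ∈ σ.dom
    rw [hp y hy.1]
    exact hy.2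
  · have h1 : B.proj (S₀ y) ∈ σ.dom := by rw [hp y hy.1]; exact hy.2
    exact ⟨hy.2, (σ.proj_apply_π h1).trans (hp y hy.1), σ.apply_π_apply_π h1⟩

/-- The covariant derivative of the Weyl connection of `σ`. -/
def covDeriv (η : ∀ y : M, TangentSpace 𝓘(ℝ, EM) y) (y : M) :
    TangentSpace 𝓘(ℝ, EM) y →L[ℝ] TangentSpace 𝓘(ℝ, EM) y :=
  B.covAt 𝔤 η (σ.lift y)

variable (hP : IsParabolicSubgroup (EP := EP) 𝔤 P) (h𝔤 : IsOneGrading 𝔤)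
include hP h𝔤

theorem mdifferentiableAt_frameForm_lift {η : ∀ y : M, TangentSpace 𝓘(ℝ, EM) y} {y : M}
    (hη : MDifferentiableAt 𝓘(ℝ, EM) 𝓘(ℝ, EM).tangent
      (fun y => (⟨y, η y⟩ : TangentBundle 𝓘(ℝ, EM) M)) y) :
    MDifferentiableAt 𝓘(ℝ, EQ) 𝓘(ℝ, EG) (B.frameForm 𝔤 η) (σ.lift y) :=
  B.mdifferentiableAt_frameForm hP h𝔤 (by rwa [σ.proj_lift])

theorem isCovariantDerivativeOn_covDeriv : IsCovariantDerivativeOn EM σ.covDeriv σ.dom := by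
  constructor
  · intro η η' y hη hη' _
    exact B.covAt_add hP h𝔤 (σ.mdifferentiableAt_frameForm_lift hP h𝔤 hη)
      (σ.mdifferentiableAt_frameForm_lift hP h𝔤 hη')
  · intro η f y hη hf _
    have hy := σ.proj_lift y
    refine ContinuousLinearMap.ext fun ξ => ?_
    have key : ∀ (z : M) (v : EM), z = B.proj (σ.lift y) → v = η z →
        B.covAt 𝔤 (f • η) (σ.lift y) (ξ : EM) = f z • B.covAt 𝔤 η (σ.lift y) (ξ : EM)
          + (mvfderiv 𝓘(ℝ, EM) f z : EM →L[ℝ] ℝ) (ξ : EM) • v := by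
      rintro _ v rfl hv
      exact B.covAt_smul hP h𝔤 (by rwa [hy]) (σ.mdifferentiableAt_frameForm_lift hP h𝔤 hη) ξ v hv
    exact key y _ hy.symm rfl

variable (hG : LieAlgebra.IsSemisimple ℝ (LieAlg EG G)) {E : LieAlg EG G}
  (hE : IsGradingElement 𝔤 E)
include hG hE

/-- Two points of the image of `σ` in one fibre differ by an element of `G₀`, so the pointwise
choice in `lift` does not matter on differentiable fields. -/
theorem covDeriv_eq {η : ∀ y : M, TangentSpace 𝓘(ℝ, EM) y} {u : Q} (hu : B.proj u ∈ σ.dom)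
    (hσ : σ.toFun (B.π 𝔤 u) = u)
    (hη : MDifferentiableAt 𝓘(ℝ, EM) 𝓘(ℝ, EM).tangent
      (fun y => (⟨y, η y⟩ : TangentBundle 𝓘(ℝ, EM) M)) (B.proj u)) :
    (σ.covDeriv η (B.proj u) : EM →L[ℝ] EM) = B.covAt 𝔤 η u := by
  obtain ⟨v, hv⟩ : ∃ v, v = σ.lift (B.proj u) := ⟨_, rfl⟩
  have hp : B.proj v = B.proj u := by rw [hv, σ.proj_lift]
  have hσv : σ.toFun (B.π 𝔤 v) = v := by rw [hv, σ.apply_π_lift hu]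
  have h1 : (σ.covDeriv η (B.proj u) : EM →L[ℝ] EM) = B.covAt 𝔤 η v := by rw [hv]; rfl
  rw [h1]
  rw [← hp] at hη hu
  obtain ⟨k, rfl⟩ := B.exists_smul_eq hp
  rw [σ.apply_π_smul hP h𝔤 hG hE hu hσv] at hσ
  have hk : k ∈ levi 𝔤 P := by
    rw [← B.smul_injective hσ]
    exact hP.leviPart_mem h𝔤 hG hE k
  exact (B.covAt_smul_levi hP h𝔤 hη ⟨k, hk⟩).symm

/-- A horizontal vector may have an `ω`-component in `𝔤₁` besides the one in `𝔤₋₁`. It drops out on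
both sides, as `Tp` kills it and the frame form is constant along it. -/
theorem isWeylConnection_covDeriv : σ.IsWeylConnection σ.covDeriv := by
  rintro η u hu hσ hη w ⟨-, hw⟩
  have hf := B.mdifferentiableAt_frameForm hP h𝔤 hη
  obtain ⟨X, rfl⟩ : ∃ X, B.constField X u = w := ⟨_, B.constField_form u w⟩
  rw [B.form_constField] at hw
  have hdec := h𝔤.eq_sum X
  rw [hw, add_zero] at hdec
  let D : EQ →L[ℝ] EG := mfderiv 𝓘(ℝ, EQ) 𝓘(ℝ, EG) (B.frameForm 𝔤 η) u
  have h1 : D (B.constField X u) = D (B.constField (grComp 𝔤 (-1) X) u) := by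
    conv_lhs => rw [hdec]
    refine (congrArg D (B.constField_add _ _ u)).trans ((D.map_add _ _).trans ?_)
    refine (congrArg (D (B.constField (grComp 𝔤 (-1) X) u) + ·)
      (B.mfderiv_frameForm_constField_eq_zero hP h𝔤 hf (grComp_mem 1 X))).trans (add_zero _)
  have h2 := B.covAt_tangentVec hP h𝔤 η u (grComp_mem (-1) X)
  have h3 : (B.covAt 𝔤 η u) (B.tangentVec u X) = B.tangentVec u (D (B.constField X u)) := by
    rw [h1, ← B.tangentVec_grComp hP h𝔤 u X]
    exact h2
  exact (congrArg (fun A : EM →L[ℝ] EM => A (B.tangentVec u X))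
    (σ.covDeriv_eq hP h𝔤 hG hE hu hσ hη)).trans h3

end WeylStructure

end CartanGeometry

/-! ### Smoothness and invariance of the Weyl connection. -/

namespace CartanGeometry

variable {EG : Type*} [NormedAddCommGroup EG] [NormedSpace ℝ EG] [FiniteDimensional ℝ EG]
  [CompleteSpace EG]
  {G : Type*} [TopologicalSpace G] [T2Space G] [ChartedSpace EG G] [Group G]
  [LieGroup 𝓘(ℝ, EG) ∞ G]
  {𝔤 : ℤ → Submodule ℝ (LieAlg EG G)}
  {EP : Type*} [NormedAddCommGroup EP] [NormedSpace ℝ EP] [FiniteDimensional ℝ EP]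
  {P : Subgroup G} [ChartedSpace EP P] [LieGroup 𝓘(ℝ, EP) ∞ P]
  {EM : Type*} [NormedAddCommGroup EM] [NormedSpace ℝ EM] [FiniteDimensional ℝ EM]
  {M : Type*} [TopologicalSpace M] [T2Space M] [ChartedSpace EM M] [IsManifold 𝓘(ℝ, EM) ∞ M]
  {EQ : Type*} [NormedAddCommGroup EQ] [NormedSpace ℝ EQ] [FiniteDimensional ℝ EQ]
  {Q : Type*} [TopologicalSpace Q] [T2Space Q] [ChartedSpace EQ Q] [IsManifold 𝓘(ℝ, EQ) ∞ Q]
  [MulAction (P)ᵐᵒᵖ Q]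
  [GradedLieAlgebra 𝔤]
  {B : CartanGeometry EG EP P EM M EQ Q}

section Smoothness

variable (hP : IsParabolicSubgroup (EP := EP) 𝔤 P) (h𝔤 : IsOneGrading 𝔤)

variable (𝔤 B) in
/-- The derivative of the frame form of `η` along the constant vector fields of degree `-1`. -/
def frameDeriv (η : ∀ y : M, TangentSpace 𝓘(ℝ, EM) y) (u : Q) : negPart 𝔤 →L[ℝ] EG :=
  (mfderiv 𝓘(ℝ, EQ) 𝓘(ℝ, EG) (B.frameForm 𝔤 η) u : EQ →L[ℝ] EG).comp
    ((B.constFieldL u).comp (negPart 𝔤).subtypeL)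

variable (𝔤 B) in
/-- The operator `covAt`, in the tangent bundle chart at `y₀`. -/
def covCoord (η : ∀ y : M, TangentSpace 𝓘(ℝ, EM) y) (y₀ : M) (u : Q) : EM →L[ℝ] EM :=
  (B.frameCoord y₀ u).comp ((frameDeriv 𝔤 B η u).comp
    ((B.frameCoord y₀ u).comp (negPart 𝔤).subtypeL).inverse)

include hP h𝔤

theorem covCoord_eq (η : ∀ y : M, TangentSpace 𝓘(ℝ, EM) y) {y₀ : M} {u : Q}
    (hu : B.proj u ∈ (trivializationAt EM (TangentSpace 𝓘(ℝ, EM) : M → Type _) y₀).baseSet) :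
    ContinuousLinearMap.inCoordinates EM (TangentSpace 𝓘(ℝ, EM) : M → Type _) EM
      (TangentSpace 𝓘(ℝ, EM) : M → Type _) y₀ (B.proj u) y₀ (B.proj u) (B.covAt 𝔤 η u)
      = covCoord 𝔤 B η y₀ u := by
  refine ContinuousLinearMap.ext fun v => ?_
  set t := trivializationAt EM (TangentSpace 𝓘(ℝ, EM) : M → Type _) y₀ with ht
  let A : EM →L[ℝ] EM := t.continuousLinearMapAt ℝ (B.proj u)
  obtain ⟨X, hX⟩ : ∃ X, X = ((B.frameCoord y₀ u).comp (negPart 𝔤).subtypeL).inverse v := ⟨_, rfl⟩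
  have h1 : v = B.frameCoord y₀ u (X : EG) :=
    (B.isInvertible_frameCoord hP h𝔤 hu).inverse_apply_eq.1 hX.symm
  have h2 : (t.symmL ℝ (B.proj u) v : EM) = B.tangentVec u ((X : EG) : LieAlg EG G) := by
    rw [h1]
    exact t.symmL_continuousLinearMapAt hu _
  have h3 : covCoord 𝔤 B η y₀ u v = B.frameCoord y₀ u (frameDeriv 𝔤 B η u X) := by
    rw [hX]; rfl
  rw [h3]
  exact congrArg A ((congrArg (B.covAt 𝔤 η u) h2).trans (B.covAt_tangentVec hP h𝔤 η u X.2))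

theorem contMDiffAt_covCoord {η : ∀ y : M, TangentSpace 𝓘(ℝ, EM) y} {U : Set M} (hU : IsOpen U)
    (hη : ContMDiffOn 𝓘(ℝ, EM) 𝓘(ℝ, EM).tangent ∞
      (fun y => (⟨y, η y⟩ : TangentBundle 𝓘(ℝ, EM) M)) U) {u : Q} (hu : B.proj u ∈ U) :
    ContMDiffAt 𝓘(ℝ, EQ) 𝓘(ℝ, EM →L[ℝ] EM) ∞ (covCoord 𝔤 B η (B.proj u)) u := by
  have : CompleteSpace (negPart 𝔤) := FiniteDimensional.complete ℝ _
  have hU' : IsOpen (B.proj ⁻¹' U) := hU.preimage B.contMDiff_proj.continuous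
  have hf : ContMDiffOn 𝓘(ℝ, EQ) 𝓘(ℝ, EG) ∞ (B.frameForm 𝔤 η) (B.proj ⁻¹' U) := fun v hv =>
    (B.contMDiffAt_frameForm hP h𝔤 (hη.contMDiffAt (hU.mem_nhds hv))).contMDiffWithinAt
  refine (B.contMDiffAt_frameCoord u).clm_comp (ContMDiffAt.clm_comp ?_
    (ContinuousLinearMap.contMDiffAt_inverse
      ((B.contMDiffAt_frameCoord u).clm_comp contMDiffAt_const)
      (B.isInvertible_frameCoord hP h𝔤 (FiberBundle.mem_baseSet_trivializationAt' _))))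
  refine contMDiffAt_clm_of_apply fun X => ?_
  exact (hf.mfderiv_apply_vectorSpace hU' (B.contMDiff_constField (X : EG)).contMDiffOn
    (mapsTo_id _)).contMDiffAt (hU'.mem_nhds hu)

theorem WeylStructure.contMDiff_covDeriv (hG : LieAlgebra.IsSemisimple ℝ (LieAlg EG G))
    {E : LieAlg EG G} (hE : IsGradingElement 𝔤 E) (σ : B.WeylStructure 𝔤) :
    ContMDiffCovariantDerivativeOn EM ∞ σ.covDeriv σ.dom := by
  constructor
  intro η hη y₀ hy₀
  have hη' : ContMDiffOn 𝓘(ℝ, EM) 𝓘(ℝ, EM).tangent ∞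
      (fun y => (⟨y, η y⟩ : TangentBundle 𝓘(ℝ, EM) M)) σ.dom := hη.of_le (by simp)
  refine ContMDiffAt.contMDiffWithinAt ?_
  -- The lift in `covDeriv` need not be continuous; it is replaced by a smooth local lift `S`, along
  -- which the coordinate expression is smooth.
  obtain ⟨U, S, hU, hyU, hS, hSU⟩ := σ.exists_contMDiffOn_lift hy₀
  refine (contMDiffAt_hom_bundle _).2 ⟨contMDiffAt_id, ?_⟩
  have h1 : ContMDiffAt 𝓘(ℝ, EQ) 𝓘(ℝ, EM →L[ℝ] EM) ∞ (covCoord 𝔤 B η y₀) (S y₀) := by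
    have h2 := contMDiffAt_covCoord hP h𝔤 σ.isOpen_dom hη' (u := S y₀) (by rwa [(hSU y₀ hyU).2.1])
    rwa [(hSU y₀ hyU).2.1] at h2
  refine (h1.comp y₀ (hS.contMDiffAt (hU.mem_nhds hyU))).congr_of_eventuallyEq ?_
  filter_upwards [hU.mem_nhds hyU,
    (trivializationAt EM (TangentSpace 𝓘(ℝ, EM) : M → Type _) y₀).open_baseSet.mem_nhds
      (FiberBundle.mem_baseSet_trivializationAt' y₀)] with y hy hyb
  obtain ⟨hyd, hpS, hσS⟩ := hSU y hy
  have hηy := (hη'.contMDiffAt (σ.isOpen_dom.mem_nhds hyd)).mdifferentiableAt (by simp)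
  simp only [Function.comp]
  obtain ⟨u, hu⟩ : ∃ u, u = S y := ⟨_, rfl⟩
  rw [← hu] at hpS hσS ⊢
  clear hu hy
  subst hpS
  rw [← covCoord_eq hP h𝔤 η hyb]
  have h3 := σ.covDeriv_eq hP h𝔤 hG hE hyd hσS hηy
  exact congrArg (fun A : EM →L[ℝ] EM => ContinuousLinearMap.inCoordinates EM
    (TangentSpace 𝓘(ℝ, EM) : M → Type _) EM (TangentSpace 𝓘(ℝ, EM) : M → Type _) y₀ (B.proj u) y₀
    (B.proj u) A) h3

end Smoothness

section Invariance

variable (hP : IsParabolicSubgroup (EP := EP) 𝔤 P) (h𝔤 : IsOneGrading 𝔤)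
include hP h𝔤

/-- `Ts` sends `⟦u, X⟧` to `⟦φ(u), X⟧`, so pulling a field back along `s` means composing its frame
form with `φ`. -/
theorem frameForm_mpullback {φ : B.LocalAut} {s : OpenPartialHomeomorph M M}
    (hsm : ContMDiffOn 𝓘(ℝ, EM) 𝓘(ℝ, EM) ∞ s s.source)
    (hsm' : ContMDiffOn 𝓘(ℝ, EM) 𝓘(ℝ, EM) ∞ s.symm s.target) {V : Set M} (hV : IsOpen V)
    (hVs : V ⊆ φ.dom ∩ s.source) (hφ : ∀ u : Q, B.proj u ∈ V → B.proj (φ.toHomeo u) = s (B.proj u))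
    (η : ∀ y : M, TangentSpace 𝓘(ℝ, EM) y) {u : Q} (hu : B.proj u ∈ V) :
    B.frameForm 𝔤 (VectorField.mpullback 𝓘(ℝ, EM) 𝓘(ℝ, EM) s η) u
      = B.frameForm 𝔤 η (φ.toHomeo u) := by
  have h0 : ∀ y, y = s (B.proj u) → (η y : EM) = η (s (B.proj u)) := by rintro _ rfl; rfl
  have h1 := tangentVec_localAut hsm hV hVs hφ hu (B.frameForm 𝔤 η (φ.toHomeo u))
  have h2 : (B.tangentVec (φ.toHomeo u) (B.frameForm 𝔤 η (φ.toHomeo u)) : EM)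
      = η (s (B.proj u)) :=
    (B.tangentVec_frameForm hP h𝔤 η (φ.toHomeo u) : _ = (η (B.proj (φ.toHomeo u)) : EM)).trans
      (h0 _ (hφ u hu))
  have hinv : (mfderiv 𝓘(ℝ, EM) 𝓘(ℝ, EM) s (B.proj u) : EM →L[ℝ] EM).IsInvertible := by
    have hd : s.MDifferentiable 𝓘(ℝ, EM) 𝓘(ℝ, EM) :=
      ⟨hsm.mdifferentiableOn (by simp), hsm'.mdifferentiableOn (by simp)⟩
    exact ⟨hd.mfderiv (hVs hu).2, rfl⟩
  refine (B.eq_frameForm hP h𝔤 (B.frameForm_mem hP h𝔤 η _) ?_).symm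
  exact (hinv.inverse_apply_eq.2 (h2.symm.trans h1)).symm

/-- An invariant `σ` has an image preserved by `φ`, so the connection may be computed at `u` over
`y` and at `φ(u)` over `s y`. The two computations agree because `φ` respects frame forms and
constant fields. -/
theorem WeylStructure.InvariantNear.invariantConnectionNear
    (hG : LieAlgebra.IsSemisimple ℝ (LieAlg EG G)) {E : LieAlg EG G} (hE : IsGradingElement 𝔤 E)
    {σ : B.WeylStructure 𝔤} {φ : B.LocalAut} {x : M} (hσ : σ.InvariantNear φ x)
    {s : OpenPartialHomeomorph M M}
    (hsm : ContMDiffOn 𝓘(ℝ, EM) 𝓘(ℝ, EM) ∞ s s.source)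
    (hsm' : ContMDiffOn 𝓘(ℝ, EM) 𝓘(ℝ, EM) ∞ s.symm s.target) (hφ : φ.Covers s x) :
    InvariantConnectionNear σ.covDeriv σ.dom s x := by
  obtain ⟨V, hV, hxV, hVs, hφV⟩ := hφ
  obtain ⟨W, hW, hxW, hWd, hWσ⟩ := hσ
  refine ⟨V ∩ W, hV.inter hW, ⟨hxV, hxW⟩, fun y hy => ⟨(hWd hy.2).2, (hVs hy.1).2⟩, ?_⟩
  rintro y ⟨hyV, hyW⟩
  have hyσ := (hWd hyW).2
  obtain ⟨u, hu⟩ : ∃ u, u = σ.lift y := ⟨_, rfl⟩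
  have hp : B.proj u = y := by rw [hu, σ.proj_lift]
  have hσu : σ.toFun (B.π 𝔤 u) = u := by rw [hu, σ.apply_π_lift hyσ]
  have hcov : ∀ η, (σ.covDeriv η y : EM →L[ℝ] EM) = B.covAt 𝔤 η u := fun η => by rw [hu]; rfl
  clear hu
  subst hp
  have hus : u ∈ φ.toHomeo.source := by rw [φ.source_eq]; exact (hVs hyV).1
  obtain ⟨hsd, hpull⟩ := hWσ (B.π 𝔤 u) hyW
  rw [WeylStructure.pullback, φ.base₀_π hus, hσu] at hpull
  rw [φ.base₀_π hus] at hsd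
  have hpφ : B.proj (φ.toHomeo u) = s (B.proj u) := hφV u hyV
  -- To cancel `φ⁻¹` the point must lie in the image of `φ`: it is in the fibre of `φ(u)`, hence of
  -- the form `φ(u) k = φ(u k)`.
  have hφσ : σ.toFun (B.π 𝔤 (φ.toHomeo u)) = φ.toHomeo u := by
    obtain ⟨k, hk⟩ := B.exists_smul_eq (σ.proj_apply_π hsd).symm
    rw [← φ.map_smul u hus] at hk
    rw [hk, φ.toHomeo.left_inv (φ.smul_mem_source hus k)] at hpull
    rw [hk, hpull]
  have hsd' : s (B.proj u) ∈ σ.dom := by rw [← hpφ]; exact hsd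
  refine ⟨hsd', fun η hη ξ => ?_⟩
  rw [← hpφ] at hη
  have hcovs : (σ.covDeriv η (s (B.proj u)) : EM →L[ℝ] EM) = B.covAt 𝔤 η (φ.toHomeo u) := by
    rw [← hpφ]
    exact σ.covDeriv_eq hP h𝔤 hG hE hsd hφσ hη
  obtain ⟨X, hX, rfl⟩ := B.exists_mem_tangentVec_eq hP h𝔤 u ξ
  set η' := VectorField.mpullback 𝓘(ℝ, EM) 𝓘(ℝ, EM) s η with hη'
  let T : EM →L[ℝ] EM := mfderiv 𝓘(ℝ, EM) 𝓘(ℝ, EM) s (B.proj u)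
  have hT := tangentVec_localAut hsm hV hVs hφV hyV
  have hφd : MDifferentiableAt 𝓘(ℝ, EQ) 𝓘(ℝ, EQ) φ.toHomeo u :=
    (φ.contMDiffOn.contMDiffAt (φ.toHomeo.open_source.mem_nhds hus)).mdifferentiableAt (by simp)
  let D : EQ →L[ℝ] EG := mfderiv 𝓘(ℝ, EQ) 𝓘(ℝ, EG) (B.frameForm 𝔤 η) (φ.toHomeo u)
  have h1 := mfderiv_apply_of_eventuallyEq_comp (h := B.frameForm 𝔤 η')
    (B.mdifferentiableAt_frameForm hP h𝔤 hη) hφd rfl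
    (mem_of_superset ((hV.preimage B.contMDiff_proj.continuous).mem_nhds hyV)
      fun v hv => frameForm_mpullback hP h𝔤 hsm hsm' hV hVs hφV η hv) (B.constField X u)
  have h2 := h1.trans (congrArg D (B.mfderiv_localAut_constField φ hus X))
  have h3 : T (B.covAt 𝔤 η' u (B.tangentVec u X))
      = B.tangentVec (φ.toHomeo u) (D (B.constField X (φ.toHomeo u))) :=
    (congrArg T (B.covAt_tangentVec hP h𝔤 η' u hX)).trans
      ((hT _).symm.trans (congrArg (B.tangentVecL (φ.toHomeo u)) h2))
  have h4 : B.covAt 𝔤 η (φ.toHomeo u) (T (B.tangentVec u X))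
      = B.tangentVec (φ.toHomeo u) (D (B.constField X (φ.toHomeo u))) :=
    (congrArg (B.covAt 𝔤 η (φ.toHomeo u)) (hT X).symm).trans
      (B.covAt_tangentVec hP h𝔤 η (φ.toHomeo u) hX)
  exact (congrArg (fun A : EM →L[ℝ] EM => T (A (B.tangentVec u X))) (hcov η')).trans
    (h3.trans (h4.symm.trans
      (congrArg (fun A : EM →L[ℝ] EM => A (T (B.tangentVec u X))) hcovs).symm))

end Invariance

end CartanGeometry

end

/-! ### The theorem: the invariant normal Weyl structure, and its connection. -/

theorem mainTheorem3
    {EG : Type*} [NormedAddCommGroup EG] [NormedSpace ℝ EG] [FiniteDimensional ℝ EG]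
    [CompleteSpace EG]
    {G : Type*} [TopologicalSpace G] [T2Space G] [ChartedSpace EG G] [Group G]
    [LieGroup 𝓘(ℝ, EG) ∞ G]
    (hG : LieAlgebra.IsSemisimple ℝ (LieAlg EG G))
    (𝔤 : ℤ → Submodule ℝ (LieAlg EG G)) [GradedLieAlgebra 𝔤] (h𝔤 : IsOneGrading 𝔤)
    {EP : Type*} [NormedAddCommGroup EP] [NormedSpace ℝ EP] [FiniteDimensional ℝ EP]
    (P : Subgroup G) [ChartedSpace EP P] [LieGroup 𝓘(ℝ, EP) ∞ P]
    (hP : IsParabolicSubgroup (EP := EP) 𝔤 P)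
    {EM : Type*} [NormedAddCommGroup EM] [NormedSpace ℝ EM] [FiniteDimensional ℝ EM]
    {M : Type*} [TopologicalSpace M] [T2Space M] [ChartedSpace EM M] [IsManifold 𝓘(ℝ, EM) ∞ M]
    {EQ : Type*} [NormedAddCommGroup EQ] [NormedSpace ℝ EQ] [FiniteDimensional ℝ EQ]
    {Q : Type*} [TopologicalSpace Q] [T2Space Q] [ChartedSpace EQ Q] [IsManifold 𝓘(ℝ, EQ) ∞ Q]
    [MulAction (P)ᵐᵒᵖ Q]
    (B : CartanGeometry EG EP P EM M EQ Q)
    (x : M) (s : OpenPartialHomeomorph M M) (hs : B.IsSymmetry s x) :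
    (∀ φ : B.LocalAut, φ.Covers s x →
      ∃ σ : B.WeylStructure 𝔤,
        ((∃ u : Q, B.proj u = x ∧ σ.IsNormalAt u) ∧ σ.InvariantNear φ x) ∧
        ∀ τ : B.WeylStructure 𝔤,
          (∃ u : Q, B.proj u = x ∧ τ.IsNormalAt u) ∧ τ.InvariantNear φ x → τ.EqNear σ x) ∧
    ∃ (σ : B.WeylStructure 𝔤)
      (cov : (∀ y : M, TangentSpace 𝓘(ℝ, EM) y) →
        (∀ y : M, TangentSpace 𝓘(ℝ, EM) y →L[ℝ] TangentSpace 𝓘(ℝ, EM) y)),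
      x ∈ σ.dom ∧ IsAffineConnectionOn cov σ.dom ∧ σ.IsWeylConnection cov ∧
        InvariantConnectionNear cov σ.dom s x := by
  refine ⟨fun φ hφ => B.exists_invariant_normal_weylStructure hP h𝔤 hG hs hφ, ?_⟩
  have : Module.Finite ℝ (LieAlg EG G) := inferInstanceAs (FiniteDimensional ℝ EG)
  obtain ⟨E, hE0, hEl⟩ := h𝔤.exists_gradingElement hG
  have hE : IsGradingElement 𝔤 E := ⟨hE0, hEl⟩
  obtain ⟨φ, hφ⟩ := hs.exists_covering
  obtain ⟨σ, ⟨-, hσ⟩, -⟩ := B.exists_invariant_normal_weylStructure hP h𝔤 hG hs hφ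
  have hx : x ∈ σ.dom := by
    obtain ⟨V, -, hxV, hVd, -⟩ := hσ
    exact (hVd hxV).2
  exact ⟨σ, σ.covDeriv, hx, ⟨σ.isOpen_dom, σ.isCovariantDerivativeOn_covDeriv hP h𝔤,
      σ.contMDiff_covDeriv hP h𝔤 hG hE⟩, σ.isWeylConnection_covDeriv hP h𝔤 hG hE,
    hσ.invariantConnectionNear hP h𝔤 hG hE hs.contMDiffOn hs.contMDiffOn_symm hφ⟩
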